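/- Let $\mathfrak k=\mathbb F_q$ be a finite field, fix $t\in\mathbb C$ with $t^2=q$, and let $\mathcal A$ be a $\mathfrak k$-linear abelian category which is essentially small with finite morphism sets, has enough projectives, is hereditary (global dimension at most $1$), and in which every nonzero object $X$ has a nonzero class $\widehat X$ in the Grothendieck group $K(\mathcal A)$. **The algebra.** Let $\mathcal C(\mathcal P)$ be the category of $\mathbb Z/2$-graded complexes $M=(M_1\rightleftarrows M_0)$ of projective objects of $\mathcal A$. For $L,M,N\in\mathcal C(\mathcal P)$ let $\mathrm{Ext}^1(M,N)_L$ be the set of equivalence classes of extensions $0\to N\to L'\to M\to 0$ of complexes with $L'\cong L$. The twisted Hall algebra has basis the isomorphism classes $[M]$ of $\mathcal C(\mathcal P)$, unit $[0]$ and product $$[M]*[N]=t^{\langle M_0,N_0\rangle+\langle M_1,N_1\rangle}\sum_{L}\frac{|\mathrm{Ext}^1(M,N)_L|}{|\mathrm{Hom}(M,N)|}\,[L],$$ where $\langle X,Y\rangle=\sum_i(-1)^i\dim_{\mathfrak k}\mathrm{Ext}^i_{\mathcal A}(X,Y)$. Let $\mathcal{DH}(\mathcal A)$ be its localization at the elements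 $[M]$ with $M$ acyclic. For projective $P$ let $K_P$ (resp. $K_P^*$) be the complex with both terms $P$ whose differential $P\to P$ from degree $1$ to degree $0$ is $\mathrm{Id}$ (resp. $0$) and from degree $0$ to degree $1$ is $0$ (resp. $-\mathrm{Id}$). For $\alpha=\widehat P-\widehat Q\in K(\mathcal A)$ with $P,Q$ projective put $K_\alpha=[K_P]*[K_Q]^{-1}$ and $K^*_\alpha=[K^*_P]*[K^*_Q]^{-1}$. Call $N\in\mathcal C(\mathcal P)$ minimal if it has no nonzero acyclic direct summand (so $N=0$ is minimal). **The coproduct.** Let $W^L_{M,N}\subseteq \mathrm{Ext}^1(M,N)_L$ consist of the classes of exact sequences in $\mathcal E_0$, i.e. those with $H_i(M)\ne0\Rightarrow H_{i+1}(N)=0$ for $i=0,1$. Let $\chi$ be any map assigning to two isomorphism classes of $\mathcal C(\mathcal P)$ an integer (or, more generally, a complex number, powers of $t$ being taken with the principal logarithm) such that $$\chi(M,N)+\chi(P,Q)=\chi(P,R)+\chi(Q,N)$$ whenever $\widehat{M_i}=\widehat{P_i}+\widehat{Q_i}$ and $\widehat{R_i}=\widehat{Q_i}+\widehat{N_i}$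 for $i=0,1$. Put $$\Delta'_{\chi,\mathcal E_0}([L])=\sum_{M,N}t^{\chi(M,N)}\frac{|W^L_{M,N}|}{|\mathrm{Hom}(M,N)|}\,\frac{|\mathrm{Aut}(L)|}{|\mathrm{Aut}(M)|\,|\mathrm{Aut}(N)|}\,[M]\otimes[N].$$ **Theorem.** Each of the sums $\Delta'_{\chi,\mathcal E_0}([L])$ has only finitely many nonzero terms. Every $\alpha\in K(\mathcal A)$ is a difference of classes of projectives, $K_\alpha$ and $K^*_\alpha$ are well defined, and the elements $[N]*K_\alpha*K_\beta^*$, with $N$ running over the isomorphism classes of minimal complexes in $\mathcal C(\mathcal P)$ and $\alpha,\beta\in K(\mathcal A)$, form a basis of $\mathcal{DH}(\mathcal A)$. Let $\mathcal{DH}(\mathcal A)\widehat\otimes\mathcal{DH}(\mathcal A)$ be the space of all formal linear combinations of the tensors $x\otimes y$ of two elements of this basis, and define linear maps $\Delta'_\chi:\mathcal{DH}(\mathcal A)\to\mathcal{DH}(\mathcal A)\widehat\otimes\mathcal{DH}(\mathcal A)$ and $\varepsilon:\mathcal{DH}(\mathcal A)\to\mathbb C$ on the basis by $$\Delta'_\chi([N]*K_\alpha*K^*_\beta)=\Delta'_{\chi,\mathcal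 E_0}([N])*(K_\alpha\otimes K_\alpha)*(K^*_\beta\otimes K^*_\beta),\qquad \varepsilon([N]*K_\alpha*K^*_\beta)=\delta_{[N],[0]}.$$ Then $\Delta'_\chi$ is topologically coassociative: $\Delta'_\chi\otimes1$ and $1\otimes\Delta'_\chi$ extend to all formal linear combinations (every coordinate being a finite sum), and $(\Delta'_\chi\otimes1)\circ\Delta'_\chi=(1\otimes\Delta'_\chi)\circ\Delta'_\chi$ in the space of formal linear combinations of triple tensors of basis elements. If moreover $\chi(0,0)=0$, then $\varepsilon$ is a counit: $(\varepsilon\otimes1)\circ\Delta'_\chi=\mathrm{id}=(1\otimes\varepsilon)\circ\Delta'_\chi$, every coordinate again being a finite sum. Thus $(\mathcal{DH}(\mathcal A),\Delta'_\chi,\varepsilon)$ is then a topological counital coassociative coalgebra. -/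

import Mathlib

open CategoryTheory CategoryTheory.Limits

open scoped ZeroObject

universe w' w v u

namespace BridgelandHall

noncomputable section

/-! ### The Grothendieck group and the Euler form -/

/-- The relations `[X₂] = [X₁] + [X₃]` for the short exact sequences `0 ⟶ X₁ ⟶ X₂ ⟶ X₃ ⟶ 0`. -/
def K0Relations (C : Type u) [Category.{v} C] [Abelian C] : AddSubgroup (FreeAbelianGroup C) :=
  AddSubgroup.closure
    {x | ∃ S : ShortComplex C, S.ShortExact ∧
      x = FreeAbelianGroup.of S.X₂ - FreeAbelianGroup.of S.X₁ - FreeAbelianGroup.of S.X₃}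

/-- The Grothendieck group of an abelian category. -/
abbrev K0 (C : Type u) [Category.{v} C] [Abelian C] : Type u :=
  FreeAbelianGroup C ⧸ K0Relations C

/-- The class of an object in the Grothendieck group. -/
def K0.cl {C : Type u} [Category.{v} C] [Abelian C] (X : C) : K0 C :=
  QuotientAddGroup.mk (FreeAbelianGroup.of X)

/-- The Euler form `⟨X, Y⟩ = ∑ i, (-1) ^ i * dim Ext^i(X, Y)`. -/
def eulerForm (k : Type w) [Field k] {C : Type u} [Category.{v} C] [Abelian C] [Linear k C]
    (X Y : C) : ℤ :=
  haveI : HasExt.{max u v} C := HasExt.standard C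
  ∑ᶠ i : ℕ, (-1 : ℤ) ^ i * (Module.finrank k (Abelian.Ext.{max u v} X Y i) : ℤ)

/-! ### Two-periodic complexes of projectives -/

/-- The category of `ℤ/2`-graded complexes: objects `M 0`, `M 1` and differentials
`M 0 ⟶ M 1 ⟶ M 0` with zero composites. -/
abbrev Cpx (C : Type u) [Category.{v} C] [Abelian C] : Type (max u v) :=
  HomologicalComplex C (ComplexShape.up (ZMod 2))

/-- The property of being a complex of projective objects. -/
def isProj (C : Type u) [Category.{v} C] [Abelian C] : ObjectProperty (Cpx C) :=
  fun M => ∀ i, Projective (M.X i)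

/-- The full subcategory of `ℤ/2`-graded complexes of projectives. -/
abbrev CP (C : Type u) [Category.{v} C] [Abelian C] : Type (max u v) :=
  (isProj C).FullSubcategory

/-- The isomorphism classes of `ℤ/2`-graded complexes of projectives. -/
abbrev IsoCP (C : Type u) [Category.{v} C] [Abelian C] : Type (max u v) :=
  Quotient (isIsomorphicSetoid (CP C))

/-- The isomorphism class of a complex of projectives. -/
def isoClass {C : Type u} [Category.{v} C] [Abelian C] (M : CP C) : IsoCP C :=
  Quotient.mk (isIsomorphicSetoid (CP C)) M

/-- The zero complex. -/
def zeroCP (C : Type u) [Category.{v} C] [Abelian C] : CP C where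
  obj := { X := fun _ => 0, d := fun _ _ => 0 }
  property := fun _ => (isZero_zero C).projective

/-- The contractible complex `K_P`: both terms are `P`, the differential from degree `1` to
degree `0` is the identity, the other one is zero. -/
def KP {C : Type u} [Category.{v} C] [Abelian C] (P : C) (hP : Projective P) : CP C where
  obj :=
    { X := fun _ => P
      d := fun i j => if i = 1 ∧ j = 0 then 𝟙 P else 0
      shape := by
        intro i j h
        rw [if_neg]
        rintro ⟨rfl, rfl⟩
        exact h (by decide)
      d_comp_d' := by
        intro i j l _ _
        by_cases hj : j = 0
        · subst hj; simp
        · simp [hj] }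
  property := fun _ => hP

/-- The contractible complex `K_P^*`: both terms are `P`, the differential from degree `0` to
degree `1` is minus the identity, the other one is zero. -/
def KPstar {C : Type u} [Category.{v} C] [Abelian C] (P : C) (hP : Projective P) : CP C where
  obj :=
    { X := fun _ => P
      d := fun i j => if i = 0 ∧ j = 1 then -𝟙 P else 0
      shape := by
        intro i j h
        rw [if_neg]
        rintro ⟨rfl, rfl⟩
        exact h (by decide)
      d_comp_d' := by
        intro i j l _ _
        by_cases hj : j = 1
        · subst hj; simp
        · simp [hj] }
  property := fun _ => hP

theorem KP_acyclic {C : Type u} [Category.{v} C] [Abelian C] (P : C) (hP : Projective P) :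
    (KP P hP).obj.Acyclic := by
  intro i
  have h2 : ∀ i : ZMod 2, i = 0 ∨ i = 1 := by decide
  rcases h2 i with rfl | rfl
  · rw [HomologicalComplex.exactAt_iff' _ 1 0 1 (ComplexShape.prev_eq' _ (by decide))
      (ComplexShape.next_eq' _ (by decide))]
    rw [ShortComplex.exact_iff_epi _ (by
      simp [HomologicalComplex.sc', HomologicalComplex.shortComplexFunctor', KP]; rfl)]
    simp only [HomologicalComplex.sc', HomologicalComplex.shortComplexFunctor', KP]
    simp only [and_self, if_true]
    infer_instance
  · rw [HomologicalComplex.exactAt_iff' _ 0 1 0 (ComplexShape.prev_eq' _ (by decide))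
      (ComplexShape.next_eq' _ (by decide))]
    rw [ShortComplex.exact_iff_mono _ (by
      simp [HomologicalComplex.sc', HomologicalComplex.shortComplexFunctor', KP]; rfl)]
    simp only [HomologicalComplex.sc', HomologicalComplex.shortComplexFunctor', KP]
    simp only [and_self, if_true]
    infer_instance

theorem KPstar_acyclic {C : Type u} [Category.{v} C] [Abelian C] (P : C) (hP : Projective P) :
    (KPstar P hP).obj.Acyclic := by
  intro i
  have h2 : ∀ i : ZMod 2, i = 0 ∨ i = 1 := by decide
  rcases h2 i with rfl | rfl
  · rw [HomologicalComplex.exactAt_iff' _ 1 0 1 (ComplexShape.prev_eq' _ (by decide))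
      (ComplexShape.next_eq' _ (by decide))]
    rw [ShortComplex.exact_iff_mono _ (by
      simp [HomologicalComplex.sc', HomologicalComplex.shortComplexFunctor', KPstar]; rfl)]
    simp only [HomologicalComplex.sc', HomologicalComplex.shortComplexFunctor', KPstar]
    simp only [and_self, if_true]
    infer_instance
  · rw [HomologicalComplex.exactAt_iff' _ 0 1 0 (ComplexShape.prev_eq' _ (by decide))
      (ComplexShape.next_eq' _ (by decide))]
    rw [ShortComplex.exact_iff_epi _ (by
      simp [HomologicalComplex.sc', HomologicalComplex.shortComplexFunctor', KPstar]; rfl)]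
    simp only [HomologicalComplex.sc', HomologicalComplex.shortComplexFunctor', KPstar]
    simp only [and_self, if_true]
    infer_instance

/-- A complex is minimal if it has no nonzero acyclic direct summand
(the zero complex is minimal). -/
def IsMinimal {C : Type u} [Category.{v} C] [Abelian C] (M : CP C) : Prop :=
  ∀ N K : Cpx C, K.Acyclic → Nonempty (M.obj ≅ N ⊞ K) → IsZero K

/-- The isomorphism classes of minimal complexes of projectives. -/
abbrev MinIso (C : Type u) [Category.{v} C] [Abelian C] : Type (max u v) :=
  {x : IsoCP C // ∃ M : CP C, isoClass M = x ∧ IsMinimal M}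

/-- The isomorphism classes of acyclic complexes of projectives. -/
abbrev AcyclicIso (C : Type u) [Category.{v} C] [Abelian C] : Type (max u v) :=
  {x : IsoCP C // ∃ M : CP C, isoClass M = x ∧ M.obj.Acyclic}

/-! ### Extensions and structure constants -/

/-- Short exact sequences `0 ⟶ N ⟶ L ⟶ M ⟶ 0` of complexes with fixed terms. -/
structure Extn {C : Type u} [Category.{v} C] [Abelian C] (M N L : CP C) where
  /-- the first map -/
  i : N.obj ⟶ L.obj
  /-- the second map -/
  p : L.obj ⟶ M.obj
  zero : i ≫ p = 0
  exact : (ShortComplex.mk i p zero).ShortExact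

/-- Equivalence of extensions: an automorphism of the middle term which is compatible with the
identities of the outer terms. -/
def extnSetoid {C : Type u} [Category.{v} C] [Abelian C] (M N L : CP C) :
    Setoid (Extn M N L) where
  r s s' := ∃ φ : L.obj ≅ L.obj, s.i ≫ φ.hom = s'.i ∧ φ.hom ≫ s'.p = s.p
  iseqv :=
    { refl := fun s => ⟨Iso.refl _, by simp, by simp⟩
      symm := by
        rintro s s' ⟨φ, h, h'⟩
        exact ⟨φ.symm, by simp [← h], by simp [← h']⟩
      trans := by
        rintro s s' s'' ⟨φ, h, h'⟩ ⟨ψ, g, g'⟩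
        exact ⟨φ ≪≫ ψ, by simp [← g, ← h], by simp [g', h']⟩ }

/-- `Ext¹(M, N)_L`: the classes of extensions of `M` by `N` with middle term (isomorphic to) `L`. -/
abbrev ExtWith {C : Type u} [Category.{v} C] [Abelian C] (M N L : CP C) : Type v :=
  Quotient (extnSetoid M N L)

/-- The short exact sequences `0 ⟶ N ⟶ L ⟶ M ⟶ 0` in the class `E₀`:
`H_i(M) ≠ 0` implies `H_{i+1}(N) = 0`. -/
def Extn.InE0 {C : Type u} [Category.{v} C] [Abelian C] {M N L : CP C} (_s : Extn M N L) : Prop :=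
  ∀ i : ZMod 2, ¬ IsZero (M.obj.homology i) → IsZero (N.obj.homology (i + 1))

/-- `W^L_{M,N}`: the classes of extensions of `M` by `N` with middle term (isomorphic to) `L`
given by sequences in `E₀`. -/
def ExtE0 {C : Type u} [Category.{v} C] [Abelian C] (M N L : CP C) : Type v :=
  {x : ExtWith M N L // ∃ s : Extn M N L, s.InE0 ∧ Quotient.mk (extnSetoid M N L) s = x}

/-- The structure constant of the twisted Hall algebra, i.e. the coefficient of `[L]` in
`[M] * [N] = t ^ (⟨M₀, N₀⟩ + ⟨M₁, N₁⟩) ∑ L, |Ext¹(M, N)_L| / |Hom(M, N)| [L]`. -/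
def twCoeff (k : Type w) [Field k] {C : Type u} [Category.{v} C] [Abelian C] [Linear k C]
    (t : ℂ) (M N L : CP C) : ℂ :=
  t ^ (eulerForm k (M.obj.X 0) (N.obj.X 0) + eulerForm k (M.obj.X 1) (N.obj.X 1)) *
    ((Nat.card (ExtWith M N L) : ℂ) / (Nat.card (M.obj ⟶ N.obj) : ℂ))

/-- The coefficient of `[M] ⊗ [N]` in the `E₀`-restricted coproduct of `[L]`. -/
def coCoeff {C : Type u} [Category.{v} C] [Abelian C]
    (t : ℂ) (χ : IsoCP C → IsoCP C → ℂ) (L M N : CP C) : ℂ :=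
  t ^ (χ (isoClass M) (isoClass N)) *
    ((Nat.card (ExtE0 M N L) : ℂ) / (Nat.card (M.obj ⟶ N.obj) : ℂ)) *
    ((Nat.card (Aut L.obj) : ℂ) / ((Nat.card (Aut M.obj) : ℂ) * (Nat.card (Aut N.obj) : ℂ)))

/-- Two complexes of projectives have only finitely many extensions up to isomorphism; so the sum
that defines the product of the Hall algebra is finite. -/
theorem finite_middle {C : Type u} [Category.{v} C] [Abelian C]
    (hfin : ∀ X Y : C, Finite (X ⟶ Y)) (M N : CP C) :
    {L : IsoCP C | Nonempty (ExtWith M N (Quotient.out L))}.Finite := by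
  classical
  have key : ∀ L : CP C, Nonempty (ExtWith M N L) → ∀ i,
      Nonempty (L.obj.X i ≅ N.obj.X i ⊞ M.obj.X i) := by
    rintro L ⟨x⟩ i
    obtain ⟨s, -⟩ := Quotient.exists_rep x
    have h := s.exact.map_of_exact (HomologicalComplex.eval C (ComplexShape.up (ZMod 2)) i)
    have : Projective (((ShortComplex.mk s.i s.p s.zero).map
        (HomologicalComplex.eval C (ComplexShape.up (ZMod 2)) i)).X₃) := M.property i
    exact ⟨h.splittingOfProjective.isoBinaryBiproduct⟩
  let S := {L : IsoCP C | Nonempty (ExtWith M N (Quotient.out L))}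
  let e : ∀ L : S, ∀ i, (Quotient.out L.1).obj.X i ≅ N.obj.X i ⊞ M.obj.X i :=
    fun L i => (key _ L.2 i).some
  let f : S → ∀ i : ZMod 2, (N.obj.X i ⊞ M.obj.X i ⟶ N.obj.X (i + 1) ⊞ M.obj.X (i + 1)) :=
    fun L i => (e L i).inv ≫ (Quotient.out L.1).obj.d i (i + 1) ≫ (e L (i + 1)).hom
  have hf : Function.Injective f := by
    intro L L' h
    have hiso : (Quotient.out L.1).obj ≅ (Quotient.out L'.1).obj :=
      HomologicalComplex.Hom.isoOfComponents (fun i => e L i ≪≫ (e L' i).symm) (by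
        intro i j hij
        have hij' : i + 1 = j := hij
        subst hij'
        have h1 := congrFun h i
        simp only [f] at h1
        rw [Iso.inv_comp_eq] at h1
        have h2 := congrArg (fun z => z ≫ (e L' (i + 1)).inv) h1
        simp only [Category.assoc, Iso.hom_inv_id, Category.comp_id] at h2
        simp only [Iso.trans_hom, Iso.symm_hom, Category.assoc]
        exact h2.symm)
    have : Quotient.out L.1 ≅ Quotient.out L'.1 := (isProj C).isoMk hiso
    apply Subtype.ext
    rw [← Quotient.out_eq L.1, ← Quotient.out_eq L'.1]
    exact Quotient.sound ⟨this⟩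
  have := Finite.of_injective f hf
  exact Set.toFinite S

/-! ### Bridgeland's Hall algebra -/

/-- The defining relations of the localized twisted Hall algebra. The generators are the symbols
`[M]` for all isomorphism classes and `[M]⁻¹` for the acyclic ones. The first two relations present
the twisted Hall algebra by its multiplication table, the last two make the `[M]` with `M` acyclic
invertible. -/
inductive DHRel (k : Type w) [Field k] (C : Type u) [Category.{v} C] [Abelian C] [Linear k C]
    (t : ℂ) :
    FreeAlgebra ℂ (IsoCP C ⊕ AcyclicIso C) → FreeAlgebra ℂ (IsoCP C ⊕ AcyclicIso C) → Prop
  | unit : DHRel k C t (FreeAlgebra.ι ℂ (Sum.inl (isoClass (zeroCP C)))) 1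
  | mul (M N : CP C) : DHRel k C t
      (FreeAlgebra.ι ℂ (Sum.inl (isoClass M)) * FreeAlgebra.ι ℂ (Sum.inl (isoClass N)))
      (∑ᶠ L : IsoCP C, twCoeff k t M N (Quotient.out L) • FreeAlgebra.ι ℂ (Sum.inl L))
  | mul_inv (x : AcyclicIso C) : DHRel k C t
      (FreeAlgebra.ι ℂ (Sum.inl x.1) * FreeAlgebra.ι ℂ (Sum.inr x)) 1
  | inv_mul (x : AcyclicIso C) : DHRel k C t
      (FreeAlgebra.ι ℂ (Sum.inr x) * FreeAlgebra.ι ℂ (Sum.inl x.1)) 1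

/-- Bridgeland's Hall algebra: the localization of the twisted Hall algebra of complexes of
projectives at the classes of acyclic complexes. -/
abbrev DH (k : Type w) [Field k] (C : Type u) [Category.{v} C] [Abelian C] [Linear k C]
    (t : ℂ) : Type (max u v) :=
  RingQuot (DHRel k C t)

/-- The element `[M]` of Bridgeland's Hall algebra. -/
def DH.of (k : Type w) [Field k] {C : Type u} [Category.{v} C] [Abelian C] [Linear k C]
    (t : ℂ) (x : IsoCP C) : DH k C t :=
  RingQuot.mkAlgHom ℂ (DHRel k C t) (FreeAlgebra.ι ℂ (Sum.inl x))

/-- The element `[M]⁻¹` of Bridgeland's Hall algebra, for an acyclic complex `M`. -/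
def DH.inv (k : Type w) [Field k] {C : Type u} [Category.{v} C] [Abelian C] [Linear k C]
    (t : ℂ) (M : CP C) (hM : M.obj.Acyclic) : DH k C t :=
  RingQuot.mkAlgHom ℂ (DHRel k C t) (FreeAlgebra.ι ℂ (Sum.inr ⟨isoClass M, M, rfl, hM⟩))

/-- `[K_P] * [K_Q]⁻¹`. -/
def KPQ (k : Type w) [Field k] {C : Type u} [Category.{v} C] [Abelian C] [Linear k C]
    (t : ℂ) (P Q : C) (hP : Projective P) (hQ : Projective Q) : DH k C t :=
  DH.of k t (isoClass (KP P hP)) * DH.inv k t (KP Q hQ) (KP_acyclic Q hQ)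

/-- `[K_P^*] * [K_Q^*]⁻¹`. -/
def KPQstar (k : Type w) [Field k] {C : Type u} [Category.{v} C] [Abelian C] [Linear k C]
    (t : ℂ) (P Q : C) (hP : Projective P) (hQ : Projective Q) : DH k C t :=
  DH.of k t (isoClass (KPstar P hP)) * DH.inv k t (KPstar Q hQ) (KPstar_acyclic Q hQ)

/-- `KFam` is the family of the elements `K_α` and `KFamStar` that of the elements `K_α^*`: every `α`
is a difference of classes of projectives, and whenever `α = cl P - cl Q` one has
`K_α = [K_P] * [K_Q]⁻¹` and `K_α^* = [K_P^*] * [K_Q^*]⁻¹`. This determines both families. -/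
def IsKFamily (k : Type w) [Field k] {C : Type u} [Category.{v} C] [Abelian C] [Linear k C]
    (t : ℂ) (KFam KFamStar : K0 C → DH k C t) : Prop :=
  (∀ α : K0 C, ∃ P Q : C, Projective P ∧ Projective Q ∧ α = K0.cl P - K0.cl Q) ∧
  ∀ (P Q : C) (hP : Projective P) (hQ : Projective Q),
    KFam (K0.cl P - K0.cl Q) = KPQ k t P Q hP hQ ∧
    KFamStar (K0.cl P - K0.cl Q) = KPQstar k t P Q hP hQ

/-- The index set of the basis `[N] * K_α * K_β^*`: `N` is minimal, `α` and `β` are arbitrary. -/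
abbrev BIdx (C : Type u) [Category.{v} C] [Abelian C] : Type (max u v) :=
  MinIso C × K0 C × K0 C

/-! ### The coproduct and the counit -/

/-- The additivity condition on `χ`. -/
def IsAdditiveChi {C : Type u} [Category.{v} C] [Abelian C] (χ : IsoCP C → IsoCP C → ℂ) : Prop :=
  ∀ M N P Q R : CP C,
    (∀ i, K0.cl (M.obj.X i) = K0.cl (P.obj.X i) + K0.cl (Q.obj.X i)) →
    (∀ i, K0.cl (R.obj.X i) = K0.cl (Q.obj.X i) + K0.cl (N.obj.X i)) →
    χ (isoClass M) (isoClass N) + χ (isoClass P) (isoClass Q) =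
      χ (isoClass P) (isoClass R) + χ (isoClass Q) (isoClass N)

/-- The `E₀`-restricted coproduct `Δ'_{χ,E₀}` on the Hall algebra of complexes of projectives. Its
target is the completed tensor square: the space of all formal linear combinations of the symbols
`[M] ⊗ [N]`. -/
def comulE0 {C : Type u} [Category.{v} C] [Abelian C] (t : ℂ) (χ : IsoCP C → IsoCP C → ℂ) :
    (IsoCP C →₀ ℂ) →ₗ[ℂ] (IsoCP C × IsoCP C → ℂ) :=
  Finsupp.linearCombination ℂ (fun (L : IsoCP C) (p : IsoCP C × IsoCP C) =>
    coCoeff t χ (Quotient.out L) (Quotient.out p.1) (Quotient.out p.2))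

/-- The completed tensor square of a space with basis `b`: all formal linear combinations of the
symbols `b i ⊗ b j`. -/
abbrev CTensor (ι : Type w) : Type w := ι × ι → ℂ

/-- The image of `x ⊗ y` in the completed tensor square. -/
def ctmul {ι : Type w} {V : Type v} [AddCommGroup V] [Module ℂ V] (b : Module.Basis ι ℂ V)
    (x y : V) : CTensor ι :=
  fun p => b.repr x p.1 * b.repr y p.2

/-- For `F = ∑ c_{M,N} [M] ⊗ [N]` in the completed tensor square of the Hall algebra of complexes,
the element `F * (y ⊗ y) * (z ⊗ z) = ∑ c_{M,N} ([M] * y * z) ⊗ ([N] * y * z)` of that of Bridgeland's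
Hall algebra. -/
def ctensorMul (k : Type w) [Field k] {C : Type u} [Category.{v} C] [Abelian C] [Linear k C]
    (t : ℂ) (b : Module.Basis (BIdx C) ℂ (DH k C t))
    (F : IsoCP C × IsoCP C → ℂ) (y z : DH k C t) : CTensor (BIdx C) :=
  fun p => ∑ᶠ m : IsoCP C × IsoCP C,
    F m * ctmul b (DH.of k t m.1 * y * z) (DH.of k t m.2 * y * z) p

/-- The coproduct `Δ'_χ`, given on the basis by
`Δ'_χ([N] * K_α * K_β^*) = Δ'_{χ,E₀}([N]) * (K_α ⊗ K_α) * (K_β^* ⊗ K_β^*)`. -/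
def comul (k : Type w) [Field k] {C : Type u} [Category.{v} C] [Abelian C] [Linear k C]
    (t : ℂ) (χ : IsoCP C → IsoCP C → ℂ) (KFam KFamStar : K0 C → DH k C t)
    (b : Module.Basis (BIdx C) ℂ (DH k C t)) : DH k C t →ₗ[ℂ] CTensor (BIdx C) :=
  b.constr ℂ (fun i => ctensorMul k t b (comulE0 t χ (Finsupp.single i.1.1 1))
    (KFam i.2.1) (KFamStar i.2.2))

open Classical in
/-- The counit, given on the basis by `ε([N] * K_α * K_β^*) = δ_{N,0}`. -/
def counit (k : Type w) [Field k] {C : Type u} [Category.{v} C] [Abelian C] [Linear k C]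
    (t : ℂ) (b : Module.Basis (BIdx C) ℂ (DH k C t)) : DH k C t →ₗ[ℂ] ℂ :=
  b.constr ℂ (fun i => if i.1.1 = isoClass (zeroCP C) then (1 : ℂ) else 0)

/-- Topological coassociativity of `Δ`: the extensions of `Δ ⊗ 1` and `1 ⊗ Δ` to all formal linear
combinations are given by finite sums in each coordinate, and `(Δ ⊗ 1) ∘ Δ = (1 ⊗ Δ) ∘ Δ` in the
space of formal linear combinations of the `b i ⊗ b j ⊗ b l`. -/
structure IsTopCoassoc {ι : Type w} {V : Type v} [AddCommGroup V] [Module ℂ V]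
    (b : Module.Basis ι ℂ V) (Δ : V →ₗ[ℂ] CTensor ι) : Prop where
  finite : ∀ i j : ι, {m : ι | Δ (b m) (i, j) ≠ 0}.Finite
  coassoc : ∀ (x : V) (i j l : ι),
    ∑ᶠ m : ι, Δ x (m, l) * Δ (b m) (i, j) = ∑ᶠ m : ι, Δ x (i, m) * Δ (b m) (j, l)

/-- The counit axioms `(ε ⊗ 1) ∘ Δ = id = (1 ⊗ ε) ∘ Δ`, where the infinite sums that define the left
and the right side have finitely many nonzero terms in each coordinate. -/
structure IsTopCounit {ι : Type w} {V : Type v} [AddCommGroup V] [Module ℂ V]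
    (b : Module.Basis ι ℂ V) (Δ : V →ₗ[ℂ] CTensor ι) (ε : V →ₗ[ℂ] ℂ) : Prop where
  finite_left : ∀ (x : V) (j : ι), {m : ι | ε (b m) * Δ x (m, j) ≠ 0}.Finite
  finite_right : ∀ (x : V) (i : ι), {m : ι | Δ x (i, m) * ε (b m) ≠ 0}.Finite
  counit_left : ∀ (x : V) (j : ι), ∑ᶠ m : ι, ε (b m) * Δ x (m, j) = b.repr x j
  counit_right : ∀ (x : V) (i : ι), ∑ᶠ m : ι, Δ x (i, m) * ε (b m) = b.repr x i

end

end BridgelandHall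

open CategoryTheory CategoryTheory.Limits

open scoped ZeroObject

namespace BridgelandHall

noncomputable section

/-! ### Flags in abelian categories -/

section Flags

variable {D : Type u} [Category.{v} D] [Abelian D]

/-! The coalgebra axioms come from one count of flags; the basis comes from the splitting of acyclic
complexes over a hereditary category.

Counting. The group `Aut L` acts on the short exact sequences `0 ⟶ N ⟶ L ⟶ M ⟶ 0` with fixed terms;
the orbits are the equivalence classes of extensions and the stabilizers are copies of `Hom(M, N)`.
Hence (Riedtmann, `card_extWith_mul`) the coefficient of the product is, up to a power of `t`, the
number of sequences divided by `|Aut L|`, and that of the coproduct is the same number divided by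
`|Aut M| |Aut N|`. Associativity and coassociativity then both reduce to `sum_extnCard_mul`, whose
two sides count the flags `N ⊆ Y ⊆ L` with successive quotients `N`, `Q`, `P`: such a flag is given
either by `N ⊆ L` and `Q ⊆ L / N`, or by `Y ⊆ L` and `N ⊆ Y`.

The restriction to `E₀` respects this identity. In a sequence in `E₀` every connecting morphism in
homology has zero source or zero target, so the homology of the middle term vanishes exactly where
that of both outer terms does (`Extn.isZero_homology_iff`). On both sides the condition becomes the
same one on the pairs `(P, Q)`, `(P, N)`, `(Q, N)`. Additivity of `χ` makes the two exponents of `t`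
agree as well.

Acyclic complexes. Subobjects of projectives are projective, so an acyclic complex of projectives
splits along its cycles as `K_P ⊞ K_Q^*`. Such a complex is projective, and it is injective relative
to the degreewise split monomorphisms, which include all monomorphisms in the sequences considered.
Therefore subobjects and quotients of minimal complexes in such sequences are minimal, the coproduct
of a minimal class involves only minimal classes, and on the vectors `[N] * K_α * K_β^*` the pair
`(α, β)` is merely carried along. Coassociativity on the Hall algebra of complexes thus passes to
the localization. The counit axioms hold because a sequence with a zero end is an isomorphism.

Basis. Every complex is a minimal one plus an acyclic one, with unique minimal part by a Fitting
argument in finite endomorphism rings. Multiplication by an acyclic class is direct sum up to a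
nonzero scalar, which gives spanning. For independence, left multiplication is modelled on the free
vector space on the index set: the acyclic part of a complex is remembered only through the classes
of its cycles in the Grothendieck group, so acyclic complexes act invertibly and the model extends
to the localization (`exists_representation`). Applied to the vector of index `(0, 0, 0)`, the
candidate basis elements give the standard basis. -/

theorem exists_kernel_flag {N L X Q P : D} {j : N ⟶ L} {r : L ⟶ X} {i : Q ⟶ X} {p : X ⟶ P}
    {w : j ≫ r = 0} {w' : i ≫ p = 0} (h : (ShortComplex.mk j r w).ShortExact)
    (h' : (ShortComplex.mk i p w').ShortExact) :
    ∃ (Y : D) (i₀ : N ⟶ Y) (p₀ : Y ⟶ Q) (j₀ : Y ⟶ L) (w₀ : i₀ ≫ p₀ = 0)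
      (w₁ : j₀ ≫ r ≫ p = 0), (ShortComplex.mk i₀ p₀ w₀).ShortExact ∧
      (ShortComplex.mk j₀ (r ≫ p) w₁).ShortExact ∧ i₀ ≫ j₀ = j ∧ p₀ ≫ i = j₀ ≫ r := by
  have m1 : Mono j := h.mono_f
  have e1 : Epi r := h.epi_g
  have m2 : Mono i := h'.mono_f
  have e2 : Epi p := h'.epi_g
  have hp0 : kernel.lift p (kernel.ι (r ≫ p) ≫ r) (by simp) ≫ kernel.ι p =
    kernel.ι (r ≫ p) ≫ r := by simp
  -- The kernel of `L ⟶ X ⟶ P` is the preimage of `Q` in `L`, so `r` restricts to it with values in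
  -- `Q`.
  let p₀ : kernel (r ≫ p) ⟶ Q := h'.exact.lift (kernel.ι (r ≫ p) ≫ r) (by simp)
  have hp₀ : p₀ ≫ i = kernel.ι (r ≫ p) ≫ r := h'.exact.lift_f _ _
  let i₀ : N ⟶ kernel (r ≫ p) := kernel.lift (r ≫ p) j (by rw [← Category.assoc, w, zero_comp])
  have hi₀ : i₀ ≫ kernel.ι (r ≫ p) = j := kernel.lift_ι _ _ _
  have w₀ : i₀ ≫ p₀ = 0 := by
    rw [← cancel_mono i, Category.assoc, hp₀, ← Category.assoc, hi₀, w, zero_comp]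
  have mi₀ : Mono i₀ := by
    have : Mono (i₀ ≫ kernel.ι (r ≫ p)) := by rw [hi₀]; exact m1
    exact mono_of_mono i₀ (kernel.ι (r ≫ p))
  have ep₀ : Epi p₀ := by
    rw [epi_iff_surjective_up_to_refinements]
    intro A y
    obtain ⟨A', π, hπ, x, hx⟩ := surjective_up_to_refinements_of_epi r (y ≫ i)
    refine ⟨A', π, hπ, kernel.lift (r ≫ p) x ?_, ?_⟩
    · rw [← Category.assoc, ← hx, Category.assoc, Category.assoc, w', comp_zero, comp_zero]
    · rw [← cancel_mono i, Category.assoc, Category.assoc, hp₀, kernel.lift_ι_assoc, hx]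
  refine ⟨kernel (r ≫ p), i₀, p₀, kernel.ι _, w₀, kernel.condition _,
    ⟨?_⟩, ⟨ShortComplex.exact_kernel _⟩, hi₀, hp₀⟩
  rw [ShortComplex.exact_iff_exact_up_to_refinements]
  intro A x hx
  dsimp at x hx
  refine ⟨A, 𝟙 A, inferInstance, h.exact.lift (x ≫ kernel.ι _) ?_, ?_⟩
  · dsimp
    rw [Category.assoc, ← hp₀, ← Category.assoc, hx, zero_comp]
  · dsimp
    rw [← cancel_mono (kernel.ι (r ≫ p)), Category.id_comp, Category.assoc, hi₀]
    exact (h.exact.lift_f _ _).symm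

/-- Dual to `exists_kernel_flag`: `X` is `L / N`, obtained by working in the opposite category. -/
theorem exists_cokernel_flag {N L Y Q P : D} {i : N ⟶ Y} {p : Y ⟶ Q} {j : Y ⟶ L} {r : L ⟶ P}
    {w : i ≫ p = 0} {w' : j ≫ r = 0} (h : (ShortComplex.mk i p w).ShortExact)
    (h' : (ShortComplex.mk j r w').ShortExact) :
    ∃ (X : D) (r₀ : L ⟶ X) (i₀ : Q ⟶ X) (p₀ : X ⟶ P) (w₀ : i₀ ≫ p₀ = 0)
      (w₁ : (i ≫ j) ≫ r₀ = 0), (ShortComplex.mk i₀ p₀ w₀).ShortExact ∧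
      (ShortComplex.mk (i ≫ j) r₀ w₁).ShortExact ∧ r₀ ≫ p₀ = r ∧ p ≫ i₀ = j ≫ r₀ := by
  obtain ⟨Y, i₀, p₀, j₀, w₀, w₁, h₀, h₁, e₀, e₁⟩ := exists_kernel_flag
    (w := by rw [← op_comp, w', op_zero]) (w' := by rw [← op_comp, w, op_zero]) h'.op h.op
  refine ⟨Y.unop, j₀.unop, p₀.unop, i₀.unop, by rw [← unop_comp, w₀, unop_zero], ?_, h₀.unop,
    h₁.unop, ?_, ?_⟩
  · have := congrArg Quiver.Hom.unop w₁
    simpa using this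
  · exact congrArg Quiver.Hom.unop e₀
  · exact congrArg Quiver.Hom.unop e₁

/-- Short exact sequences with the same second map have isomorphic first terms. -/
theorem exists_iso_of_shortExact_right {Y Y' L P : D} {j : Y ⟶ L} {j' : Y' ⟶ L} {r : L ⟶ P}
    {w : j ≫ r = 0} {w' : j' ≫ r = 0} (h : (ShortComplex.mk j r w).ShortExact)
    (h' : (ShortComplex.mk j' r w').ShortExact) : ∃ φ : Y ≅ Y', φ.hom ≫ j' = j := by
  have := h.mono_f
  have := h'.mono_f
  exact ⟨IsLimit.conePointUniqueUpToIso h.exact.fIsKernel h'.exact.fIsKernel,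
    IsLimit.conePointUniqueUpToIso_hom_comp h.exact.fIsKernel h'.exact.fIsKernel
      WalkingParallelPair.zero⟩

/-- Short exact sequences with the same first map have isomorphic third terms. -/
theorem exists_iso_of_shortExact_left {X X' L N : D} {j : N ⟶ L} {r : L ⟶ X} {r' : L ⟶ X'}
    {w : j ≫ r = 0} {w' : j ≫ r' = 0} (h : (ShortComplex.mk j r w).ShortExact)
    (h' : (ShortComplex.mk j r' w').ShortExact) : ∃ φ : X ≅ X', r ≫ φ.hom = r' := by
  have := h.epi_g
  have := h'.epi_g
  exact ⟨IsColimit.coconePointUniqueUpToIso h.exact.gIsCokernel h'.exact.gIsCokernel,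
    IsColimit.comp_coconePointUniqueUpToIso_hom h.exact.gIsCokernel h'.exact.gIsCokernel
      WalkingParallelPair.one⟩

/-- A short exact sequence remains so after replacing its terms by isomorphic objects. -/
theorem shortExact_of_isos {M M' N N' L L' : D} {i : N ⟶ L} {p : L ⟶ M} {w : i ≫ p = 0}
    (h : (ShortComplex.mk i p w).ShortExact) (eN : N ≅ N') (eL : L ≅ L') (eM : M ≅ M')
    {i' : N' ⟶ L'} {p' : L' ⟶ M'} (w' : i' ≫ p' = 0)
    (hi : i ≫ eL.hom = eN.hom ≫ i') (hp : p ≫ eM.hom = eL.hom ≫ p') :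
    (ShortComplex.mk i' p' w').ShortExact :=
  ShortComplex.shortExact_of_iso
    (ShortComplex.isoMk (S₁ := ShortComplex.mk i p w) (S₂ := ShortComplex.mk i' p' w')
      eN eL eM hi.symm hp.symm) h

end Flags

/-! ### Counting extensions and flags -/

section Counting

variable {C : Type u} [Category.{v} C] [Abelian C]

theorem finite_hom_cpx (hfin : ∀ X Y : C, Finite (X ⟶ Y)) (M N : Cpx C) : Finite (M ⟶ N) :=
  Finite.of_injective (fun (f : M ⟶ N) (i : ZMod 2) => f.f i)
    (fun _ _ h => HomologicalComplex.hom_ext _ _ (fun i => congrFun h i))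

theorem finite_iso {D : Type u} [Category.{v} D] {X Y : D} (h : Finite (X ⟶ Y)) :
    Finite (X ≅ Y) :=
  Finite.of_injective (fun e : X ≅ Y => e.hom) (fun _ _ h => Iso.ext h)

theorem isoClass_eq_iff {M N : CP C} : isoClass M = isoClass N ↔ Nonempty (M.obj ≅ N.obj) := by
  constructor
  · intro h
    obtain ⟨e⟩ := Quotient.exact h
    exact ⟨(isProj C).ι.mapIso e⟩
  · rintro ⟨e⟩
    exact Quotient.sound ⟨(isProj C).isoMk e⟩

theorem isoClass_out (x : IsoCP C) : isoClass (Quotient.out x) = x := Quotient.out_eq x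

theorem nonempty_iso_out (M : CP C) : Nonempty ((Quotient.out (isoClass M)).obj ≅ M.obj) :=
  isoClass_eq_iff.1 (isoClass_out _)

/-- The order of the automorphism group of a complex. -/
def autCard (M : CP C) : ℂ := (Nat.card (Aut M.obj) : ℂ)

/-- The number of short exact sequences with fixed terms. -/
def extnCard (M N L : CP C) : ℂ := (Nat.card (Extn M N L) : ℂ)

theorem card_iso_of_iso {D : Type u} [Category.{v} D] {X X' Y Y' : D} (e : X ≅ X') (f : Y ≅ Y') :
    Nat.card (X ≅ Y) = Nat.card (X' ≅ Y') :=
  Nat.card_congr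
    { toFun := fun φ => e.symm ≪≫ φ ≪≫ f
      invFun := fun φ => e ≪≫ φ ≪≫ f.symm
      left_inv := fun φ => by ext; simp
      right_inv := fun φ => by ext; simp }

theorem autCard_congr {M N : CP C} (e : M.obj ≅ N.obj) : autCard M = autCard N :=
  congrArg Nat.cast (card_iso_of_iso e e)

theorem autCard_ne_zero (hfin : ∀ X Y : C, Finite (X ⟶ Y)) (M : CP C) : autCard M ≠ 0 := by
  have : Finite (Aut M.obj) := finite_iso (finite_hom_cpx hfin _ _)
  exact Nat.cast_ne_zero.2 Nat.card_pos.ne'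

theorem Extn.ext_of {M N L : CP C} {s s' : Extn M N L} (hi : s.i = s'.i) (hp : s.p = s'.p) :
    s = s' := by
  cases s; cases s'; cases hi; cases hp; rfl

/-- Transport of a short exact sequence along isomorphisms. -/
def Extn.transport {M N L M' N' L' : CP C} (s : Extn M N L) (eM : M.obj ≅ M'.obj)
    (eN : N.obj ≅ N'.obj) (eL : L.obj ≅ L'.obj) : Extn M' N' L' where
  i := eN.inv ≫ s.i ≫ eL.hom
  p := eL.inv ≫ s.p ≫ eM.hom
  zero := by simp [reassoc_of% s.zero]
  exact := shortExact_of_isos s.exact eN eL eM _ (by simp) (by simp)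

/-- Transport along isomorphisms as an equivalence. -/
def Extn.transportEquiv {M N L M' N' L' : CP C} (eM : M.obj ≅ M'.obj)
    (eN : N.obj ≅ N'.obj) (eL : L.obj ≅ L'.obj) : Extn M N L ≃ Extn M' N' L' where
  toFun s := s.transport eM eN eL
  invFun s := s.transport eM.symm eN.symm eL.symm
  left_inv s := Extn.ext_of (by simp [Extn.transport]) (by simp [Extn.transport])
  right_inv s := Extn.ext_of (by simp [Extn.transport]) (by simp [Extn.transport])

theorem extnCard_congr {M N L M' N' L' : CP C} (eM : M.obj ≅ M'.obj)
    (eN : N.obj ≅ N'.obj) (eL : L.obj ≅ L'.obj) : extnCard M N L = extnCard M' N' L' :=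
  congrArg Nat.cast (Nat.card_congr (Extn.transportEquiv eM eN eL))

theorem finite_extn (hfin : ∀ X Y : C, Finite (X ⟶ Y)) (M N L : CP C) : Finite (Extn M N L) := by
  have := finite_hom_cpx hfin
  exact Finite.of_injective (fun s : Extn M N L => (s.i, s.p)) (fun s s' h =>
    Extn.ext_of (congrArg Prod.fst h) (congrArg Prod.snd h))

theorem extnCard_ne_zero_iff (hfin : ∀ X Y : C, Finite (X ⟶ Y)) {M N L : CP C} :
    extnCard M N L ≠ 0 ↔ Nonempty (Extn M N L) := by
  have := finite_extn hfin M N L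
  unfold extnCard
  rw [Nat.cast_ne_zero, Nat.card_ne_zero]
  exact and_iff_left this

/-- The terms of a short exact sequence of complexes of projectives are split. -/
theorem Extn.nonempty_iso_X {M N L : CP C} (s : Extn M N L) (i : ZMod 2) :
    Nonempty (L.obj.X i ≅ N.obj.X i ⊞ M.obj.X i) := by
  have h := s.exact.map_of_exact (HomologicalComplex.eval C (ComplexShape.up (ZMod 2)) i)
  have : Projective (((ShortComplex.mk s.i s.p s.zero).map
      (HomologicalComplex.eval C (ComplexShape.up (ZMod 2)) i)).X₃) := M.property i
  exact ⟨h.splittingOfProjective.isoBinaryBiproduct⟩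

theorem isProj_of_shortExact {M N L : Cpx C} (hM : isProj C M) (hN : isProj C N) {i : N ⟶ L}
    {p : L ⟶ M} {w : i ≫ p = 0} (h : (ShortComplex.mk i p w).ShortExact) : isProj C L := by
  intro j
  have h := h.map_of_exact (HomologicalComplex.eval C (ComplexShape.up (ZMod 2)) j)
  have : Projective (((ShortComplex.mk i p w).map
      (HomologicalComplex.eval C (ComplexShape.up (ZMod 2)) j)).X₃) := hM j
  have : Projective (N.X j) := hN j
  have : Projective (M.X j) := hM j
  have e : L.X j ≅ N.X j ⊞ M.X j := h.splittingOfProjective.isoBinaryBiproduct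
  exact Projective.of_iso e.symm inferInstance

/-- The compatibility of two flags `(Q ⊆ X, N ⊆ L)` and `(N ⊆ Y, Y ⊆ L)` with `X = L / N`. -/
def FlagRel {P Q N L X Y : CP C} (a : Extn P Q X × Extn X N L) (b : Extn Q N Y × Extn P Y L) :
    Prop :=
  b.1.i ≫ b.2.i = a.2.i ∧ b.2.p = a.2.p ≫ a.1.p ∧ b.1.p ≫ a.1.i = b.2.i ≫ a.2.p

/-- The subobjects `N ⊆ L` and `Q ⊆ L / N` force `Y` to be the preimage `Y₀` of `Q`, so a compatible
pair amounts to an identification of `Y₀` with `Y`. That `Y₀` does not depend on `Y` is what permits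
summation over all classes of `Y`. -/
theorem exists_card_flagRel_right {P Q N L X : CP C} (a : Extn P Q X × Extn X N L) :
    ∃ Y₀ : CP C, Nonempty (Extn Q N Y₀) ∧
      ∀ Y : CP C, Nat.card {b : Extn Q N Y × Extn P Y L // FlagRel a b} =
        Nat.card (Y₀.obj ≅ Y.obj) := by
  obtain ⟨Y, i₀, p₀, j₀, w₀, w₁, h₀, h₁, e₀, e₁⟩ := exists_kernel_flag a.2.exact a.1.exact
  let Y₀ : CP C := ⟨Y, isProj_of_shortExact Q.property N.property h₀⟩
  let c₀ : Extn Q N Y₀ := ⟨i₀, p₀, w₀, h₀⟩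
  let d₀ : Extn P Y₀ L := ⟨j₀, _, w₁, h₁⟩
  refine ⟨Y₀, ⟨c₀⟩, fun Y => ?_⟩
  symm
  let F : (Y₀.obj ≅ Y.obj) → {b : Extn Q N Y × Extn P Y L // FlagRel a b} := fun φ =>
    ⟨(c₀.transport (Iso.refl _) (Iso.refl _) φ, d₀.transport (Iso.refl _) φ (Iso.refl _)), by
      refine ⟨?_, ?_, ?_⟩
      · simp [Extn.transport, c₀, d₀, e₀]
      · simp [Extn.transport, d₀]
      · simp [Extn.transport, c₀, d₀, e₁]⟩
  refine Nat.card_congr (Equiv.ofBijective F ⟨?_, ?_⟩)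
  · intro φ ψ h
    have : Mono j₀ := h₁.mono_f
    have h2 : φ.inv ≫ j₀ = ψ.inv ≫ j₀ := by
      have := congrArg (fun z => z.1.2.i) h
      simpa [F, Extn.transport, d₀] using this
    rw [cancel_mono] at h2
    exact Iso.symm_eq_iff.1 (Iso.ext h2)
  · rintro ⟨⟨c, d⟩, r₁, r₂, r₃⟩
    dsimp only at r₁ r₂ r₃
    have : Mono d.i := d.exact.mono_f
    have : Mono a.1.i := a.1.exact.mono_f
    have hd : (ShortComplex.mk d.i (a.2.p ≫ a.1.p) (by rw [← r₂]; exact d.zero)).ShortExact := by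
      have := d.exact
      simp only [r₂] at this
      exact this
    -- Both `Y₀` and `Y` are kernels of the same morphism `L ⟶ P`; the comparison isomorphism is the
    -- required preimage.
    obtain ⟨φ, hφ⟩ := exists_iso_of_shortExact_right h₁ hd
    refine ⟨φ, Subtype.ext (Prod.ext (Extn.ext_of ?_ ?_) (Extn.ext_of ?_ ?_))⟩
    · rw [← cancel_mono d.i, r₁]
      simp [F, Extn.transport, c₀, hφ, e₀]
    · rw [← cancel_mono a.1.i, r₃]
      simp [F, Extn.transport, c₀, e₁, ← hφ]
    · simp [F, Extn.transport, d₀, ← hφ]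
    · simp [F, Extn.transport, d₀, r₂]

theorem exists_card_flagRel_left {P Q N L Y : CP C} (b : Extn Q N Y × Extn P Y L) :
    ∃ X₀ : CP C, Nonempty (Extn P Q X₀) ∧
      ∀ X : CP C, Nat.card {a : Extn P Q X × Extn X N L // FlagRel a b} =
        Nat.card (X₀.obj ≅ X.obj) := by
  obtain ⟨X, r₀, i₀, p₀, w₀, w₁, h₀, h₁, e₀, e₁⟩ := exists_cokernel_flag b.1.exact b.2.exact
  let X₀ : CP C := ⟨X, isProj_of_shortExact P.property Q.property h₀⟩
  let c₀ : Extn P Q X₀ := ⟨i₀, p₀, w₀, h₀⟩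
  let d₀ : Extn X₀ N L := ⟨_, r₀, w₁, h₁⟩
  refine ⟨X₀, ⟨c₀⟩, fun X => ?_⟩
  symm
  let F : (X₀.obj ≅ X.obj) → {a : Extn P Q X × Extn X N L // FlagRel a b} := fun φ =>
    ⟨(c₀.transport (Iso.refl _) (Iso.refl _) φ, d₀.transport φ (Iso.refl _) (Iso.refl _)), by
      refine ⟨?_, ?_, ?_⟩
      · simp [Extn.transport, d₀]
      · simp [Extn.transport, c₀, d₀, e₀]
      · simp [Extn.transport, c₀, d₀, reassoc_of% e₁]⟩
  refine Nat.card_congr (Equiv.ofBijective F ⟨?_, ?_⟩)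
  · intro φ ψ h
    have : Epi r₀ := h₁.epi_g
    have h2 : r₀ ≫ φ.hom = r₀ ≫ ψ.hom := by
      have := congrArg (fun z => z.1.2.p) h
      simpa [F, Extn.transport, d₀] using this
    rw [cancel_epi] at h2
    exact Iso.ext h2
  · rintro ⟨⟨c, d⟩, r₁, r₂, r₃⟩
    dsimp only at r₁ r₂ r₃
    have : Epi d.p := d.exact.epi_g
    have : Epi b.1.p := b.1.exact.epi_g
    have hd : (ShortComplex.mk (b.1.i ≫ b.2.i) d.p (by rw [r₁]; exact d.zero)).ShortExact := by
      have := d.exact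
      simp only [← r₁] at this
      exact this
    obtain ⟨φ, hφ⟩ := exists_iso_of_shortExact_left h₁ hd
    refine ⟨φ, Subtype.ext (Prod.ext (Extn.ext_of ?_ ?_) (Extn.ext_of ?_ ?_))⟩
    · rw [← cancel_epi b.1.p, r₃]
      simp [F, Extn.transport, c₀, reassoc_of% e₁, hφ]
    · rw [← cancel_epi d.p, ← r₂, ← hφ]
      simp [F, Extn.transport, c₀, e₀]
    · simp [F, Extn.transport, d₀, r₁]
    · simp [F, Extn.transport, d₀, hφ]

/-- Only the class of `Y₀` contributes, and there the isomorphisms form a torsor under the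
automorphism group. -/
theorem sum_card_iso_div_autCard (hfin : ∀ X Y : C, Finite (X ⟶ Y)) (Y₀ : CP C)
    (S : Finset (IsoCP C)) (hS : isoClass Y₀ ∈ S) :
    ∑ y ∈ S, (Nat.card (Y₀.obj ≅ (Quotient.out y).obj) : ℂ) / autCard (Quotient.out y) = 1 := by
  rw [Finset.sum_eq_single_of_mem _ hS]
  · obtain ⟨e⟩ := nonempty_iso_out Y₀
    rw [div_eq_one_iff_eq (autCard_ne_zero hfin _), card_iso_of_iso e.symm (Iso.refl _)]
    rfl
  · intro y _ hy
    have : IsEmpty (Y₀.obj ≅ (Quotient.out y).obj) := by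
      refine ⟨fun e => hy ?_⟩
      rw [isoClass_eq_iff.2 ⟨e⟩, isoClass_out]
    simp

/-- Counting pairs of related elements by the fibres over the first factor. -/
theorem card_rel_eq_sum {α β : Type*} [Fintype α] [Finite β] (r : α → β → Prop) :
    Nat.card {x : α × β // r x.1 x.2} = ∑ a, Nat.card {b // r a b} := by
  rw [Nat.card_congr (Equiv.subtypeProdEquivSigmaSubtype r), Nat.card_sigma]

/-- Counting pairs of related elements by the fibres over the second factor. -/
theorem card_rel_eq_sum' {α β : Type*} [Finite α] [Fintype β] (r : α → β → Prop) :
    Nat.card {x : α × β // r x.1 x.2} = ∑ b, Nat.card {a // r a b} := by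
  rw [← card_rel_eq_sum (fun b a => r a b)]
  exact Nat.card_congr ((Equiv.prodComm α β).subtypeEquiv (fun _ => Iff.rfl))

open Classical in
/-- The identity behind the associativity of Hall algebras. -/
theorem sum_extnCard_mul (hfin : ∀ X Y : C, Finite (X ⟶ Y)) (P Q N L : CP C) :
    ∑ᶠ x : IsoCP C, extnCard P Q (Quotient.out x) * extnCard (Quotient.out x) N L /
        autCard (Quotient.out x) =
      ∑ᶠ y : IsoCP C, extnCard Q N (Quotient.out y) * extnCard P (Quotient.out y) L /
        autCard (Quotient.out y) := by
  have hE := finite_extn hfin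
  have hmid : ∀ A B X : CP C, Nonempty (Extn A B X) →
      isoClass X ∈ (finite_middle hfin A B).toFinset := by
    rintro A B X ⟨s⟩
    obtain ⟨e⟩ := nonempty_iso_out X
    rw [Set.Finite.mem_toFinset]
    exact ⟨Quotient.mk _ (s.transport (Iso.refl _) (Iso.refl _) e.symm)⟩
  have hsupp : ∀ A B : CP C, ∀ f : IsoCP C → ℂ,
      Function.support (fun x => extnCard A B (Quotient.out x) * f x / autCard (Quotient.out x)) ⊆
        ((finite_middle hfin A B).toFinset : Set (IsoCP C)) := by
    intro A B f x hx
    have h1 : extnCard A B (Quotient.out x) ≠ 0 := by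
      intro h
      simp [h] at hx
    have := hmid _ _ _ ((extnCard_ne_zero_iff hfin).1 h1)
    rwa [isoClass_out] at this
  rw [finsum_eq_sum_of_support_subset _ (hsupp P Q _),
    finsum_eq_sum_of_support_subset _ (hsupp Q N _)]
  -- `W x y` counts the compatible pairs of flags through `x` and `y`. Weighted by `1 / |Aut y|` and
  -- summed over `y`, every flag through `x` counts once, and symmetrically. Both sides of the
  -- identity are thus the double sum of `W x y / (|Aut x| |Aut y|)`.
  let W : IsoCP C → IsoCP C → ℂ := fun x y =>
    (Nat.card {z : (Extn P Q (Quotient.out x) × Extn (Quotient.out x) N L) ×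
      (Extn Q N (Quotient.out y) × Extn P (Quotient.out y) L) // FlagRel z.1 z.2} : ℂ)
  have h1 : ∀ x, ∑ y ∈ (finite_middle hfin Q N).toFinset, W x y / autCard (Quotient.out y) =
      extnCard P Q (Quotient.out x) * extnCard (Quotient.out x) N L := by
    intro x
    have := Fintype.ofFinite (Extn P Q (Quotient.out x) × Extn (Quotient.out x) N L)
    simp only [W, card_rel_eq_sum, Nat.cast_sum, Finset.sum_div]
    rw [Finset.sum_comm]
    rw [Finset.sum_congr rfl (g := fun _ => (1 : ℂ))]
    · simp [extnCard, ← Nat.card_eq_fintype_card]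
    · intro a _
      obtain ⟨Y₀, hY₀, h⟩ := exists_card_flagRel_right a
      simp only [h]
      exact sum_card_iso_div_autCard hfin Y₀ _ (hmid _ _ _ hY₀)
  have h2 : ∀ y, ∑ x ∈ (finite_middle hfin P Q).toFinset, W x y / autCard (Quotient.out x) =
      extnCard Q N (Quotient.out y) * extnCard P (Quotient.out y) L := by
    intro y
    have := Fintype.ofFinite (Extn Q N (Quotient.out y) × Extn P (Quotient.out y) L)
    simp only [W, card_rel_eq_sum', Nat.cast_sum, Finset.sum_div]
    rw [Finset.sum_comm]
    rw [Finset.sum_congr rfl (g := fun _ => (1 : ℂ))]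
    · simp [extnCard, ← Nat.card_eq_fintype_card]
    · intro b _
      obtain ⟨X₀, hX₀, h⟩ := exists_card_flagRel_left b
      simp only [h]
      exact sum_card_iso_div_autCard hfin X₀ _ (hmid _ _ _ hX₀)
  simp only [← h1, ← h2, Finset.sum_div]
  rw [Finset.sum_comm]
  refine Finset.sum_congr rfl fun y _ => Finset.sum_congr rfl fun x _ => ?_
  rw [div_right_comm]

end Counting

/-! ### Riedtmann's formula -/

section Riedtmann

variable {C : Type u} [Category.{v} C] [Abelian C]

/-- The automorphism `1 + p h i` of the middle term of a short exact sequence. -/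
def Extn.shear {M N L : CP C} (s : Extn M N L) (h : M.obj ⟶ N.obj) : L.obj ≅ L.obj where
  hom := 𝟙 _ + s.p ≫ h ≫ s.i
  inv := 𝟙 _ - s.p ≫ h ≫ s.i
  hom_inv_id := by simp [reassoc_of% s.zero]
  inv_hom_id := by simp [reassoc_of% s.zero]

/-- The stabilizer of a sequence: `φ - 1` vanishes on `N` and takes values in `N`, so it factors
through `p` and through `i`. -/
theorem Extn.exists_shear {M N L : CP C} (s : Extn M N L) (φ : L.obj ≅ L.obj)
    (hi : s.i ≫ φ.hom = s.i) (hp : φ.hom ≫ s.p = s.p) : ∃ h, s.shear h = φ := by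
  have : Mono s.i := s.exact.mono_f
  have : Epi s.p := s.exact.epi_g
  let a : L.obj ⟶ N.obj := s.exact.exact.lift (φ.hom - 𝟙 _) (by simp [hp])
  have ha : a ≫ s.i = φ.hom - 𝟙 _ := s.exact.exact.lift_f _ _
  let h : M.obj ⟶ N.obj := s.exact.exact.desc a (by
    dsimp
    rw [← cancel_mono s.i, Category.assoc, ha]
    simp [hi])
  have hh : s.p ≫ h = a := s.exact.exact.g_desc _ _
  refine ⟨h, Iso.ext ?_⟩
  simp [Extn.shear, reassoc_of% hh, ha]

/-- Orbit counting for the action of `Aut L` on sequences, with the shears by `Hom(M, N)` as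
stabilizers, made into an explicit bijection by means of chosen representatives of the orbits. -/
theorem card_extWith_mul (M N L : CP C) :
    Nat.card (ExtWith M N L) * Nat.card (Aut L.obj) =
      Nat.card (Extn M N L) * Nat.card (M.obj ⟶ N.obj) := by
  classical
  rw [← Nat.card_prod, ← Nat.card_prod]
  change Nat.card (ExtWith M N L × (L.obj ≅ L.obj)) = _
  symm
  -- An automorphism carrying the chosen representative of the class of `s` to `s` itself. Every
  -- other such automorphism differs from it by a shear of the representative.
  have key : ∀ s : Extn M N L, ∃ φ : L.obj ≅ L.obj,
      (Quotient.out (Quotient.mk (extnSetoid M N L) s)).i ≫ φ.hom = s.i ∧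
      φ.hom ≫ s.p = (Quotient.out (Quotient.mk (extnSetoid M N L) s)).p :=
    fun s => Quotient.mk_out (s := extnSetoid M N L) s
  choose φ hφ hφ' using key
  let F : Extn M N L × (M.obj ⟶ N.obj) → ExtWith M N L × (L.obj ≅ L.obj) := fun z =>
    (Quotient.mk _ z.1, (Quotient.out (Quotient.mk (extnSetoid M N L) z.1)).shear z.2 ≪≫ φ z.1)
  have hF : ∀ z, (Quotient.out (F z).1).i ≫ (F z).2.hom = z.1.i ∧
      (F z).2.hom ≫ z.1.p = (Quotient.out (F z).1).p := by
    rintro ⟨s, h⟩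
    simp [F, Extn.shear, hφ, hφ', reassoc_of% (Extn.zero), Extn.zero]
  refine Nat.card_congr (Equiv.ofBijective F ⟨?_, ?_⟩)
  · intro z z' h
    have h1 := hF z
    have h2 := hF z'
    rw [← h] at h2
    have hs : z.1 = z'.1 := by
      refine Extn.ext_of (h1.1.symm.trans h2.1) ?_
      rw [← cancel_epi (F z).2.hom, h1.2, h2.2]
    obtain ⟨s, g⟩ := z
    obtain ⟨s', g'⟩ := z'
    dsimp only at hs
    subst hs
    refine Prod.ext rfl ?_
    have h3 := congrArg (fun y => y.2.hom ≫ (φ s).inv) h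
    have : Mono (Quotient.out (Quotient.mk (extnSetoid M N L) s)).i := Extn.exact _ |>.mono_f
    have : Epi (Quotient.out (Quotient.mk (extnSetoid M N L) s)).p := Extn.exact _ |>.epi_g
    simpa [F, Extn.shear, cancel_epi, cancel_mono] using h3
  · rintro ⟨x, ψ⟩
    let s₀ : Extn M N L := Quotient.out x
    let s : Extn M N L :=
      { i := s₀.i ≫ ψ.hom
        p := ψ.inv ≫ s₀.p
        zero := by simp [s₀.zero]
        exact := shortExact_of_isos s₀.exact (Iso.refl _) ψ (Iso.refl _) _ (by simp) (by simp) }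
    have hs : Quotient.mk (extnSetoid M N L) s = x := by
      rw [← Quotient.out_eq x]
      refine Quotient.sound (Setoid.symm' _ ⟨ψ, rfl, ?_⟩)
      simp [s, s₀]
    have h1 := hφ s
    have h2 := hφ' s
    rw [hs] at h1 h2
    obtain ⟨h, hh⟩ := s₀.exists_shear (ψ ≪≫ (φ s).symm)
      (by
        simp only [Iso.trans_hom, Iso.symm_hom]
        rw [← Category.assoc, Iso.comp_inv_eq]
        exact h1.symm)
      (by
        simp only [Iso.trans_hom, Iso.symm_hom, Category.assoc]
        refine (congrArg (fun z => ψ.hom ≫ (φ s).inv ≫ z) h2.symm).trans ?_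
        rw [Iso.inv_hom_id_assoc]
        simp [s, s₀])
    refine ⟨(s, h), Prod.ext hs ?_⟩
    apply Iso.ext
    simp only [F, hs]
    change ((s₀.shear h) ≪≫ φ s).hom = ψ.hom
    rw [hh]
    simp

theorem card_extWith_div (hfin : ∀ X Y : C, Finite (X ⟶ Y)) (M N L : CP C) :
    (Nat.card (ExtWith M N L) : ℂ) / (Nat.card (M.obj ⟶ N.obj) : ℂ) =
      extnCard M N L / autCard L := by
  have h := card_extWith_mul M N L
  have := finite_hom_cpx hfin M.obj N.obj
  have h1 : (Nat.card (M.obj ⟶ N.obj) : ℂ) ≠ 0 := Nat.cast_ne_zero.2 Nat.card_pos.ne'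
  rw [div_eq_div_iff h1 (autCard_ne_zero hfin L)]
  unfold extnCard autCard
  exact_mod_cast h

theorem twCoeff_eq (k : Type w) [Field k] [Linear k C] (hfin : ∀ X Y : C, Finite (X ⟶ Y))
    (t : ℂ) (M N L : CP C) :
    twCoeff k t M N L =
      t ^ (eulerForm k (M.obj.X 0) (N.obj.X 0) + eulerForm k (M.obj.X 1) (N.obj.X 1)) *
        (extnCard M N L / autCard L) := by
  rw [twCoeff, card_extWith_div hfin]

/-- The condition on the outer terms that defines the class `E₀`. -/
def OrthHomology (M N : CP C) : Prop :=
  ∀ i : ZMod 2, ¬ IsZero (M.obj.homology i) → IsZero (N.obj.homology (i + 1))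

-- Membership in `E₀` depends only on the outer terms, so either all classes of extensions qualify
-- or none.
open Classical in
theorem card_extE0 (M N L : CP C) : Nat.card (ExtE0 M N L) =
    if OrthHomology M N then Nat.card (ExtWith M N L) else 0 := by
  split_ifs with h
  · refine Nat.card_congr (Equiv.subtypeUnivEquiv fun x => ?_)
    exact ⟨Quotient.out x, h, Quotient.out_eq x⟩
  · have : IsEmpty (ExtE0 M N L) := ⟨fun x => h (x.2.choose_spec.1)⟩
    exact Nat.card_of_isEmpty

-- After Riedtmann's formula the factor `|Aut L|` cancels, which leaves a count of sequences
-- normalized by the outer terms.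
open Classical in
theorem coCoeff_eq (hfin : ∀ X Y : C, Finite (X ⟶ Y)) (t : ℂ) (χ : IsoCP C → IsoCP C → ℂ)
    (L M N : CP C) : coCoeff t χ L M N = if OrthHomology M N then
      t ^ (χ (isoClass M) (isoClass N)) * (extnCard M N L / (autCard M * autCard N)) else 0 := by
  unfold coCoeff
  rw [card_extE0]
  split_ifs with h
  · rw [card_extWith_div hfin, mul_assoc]
    congr 1
    have := autCard_ne_zero hfin L
    have := autCard_ne_zero hfin M
    have := autCard_ne_zero hfin N
    change extnCard M N L / autCard L * (autCard L / (autCard M * autCard N)) = _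
    field_simp
  · simp

end Riedtmann

/-! ### Contractible complexes -/

section Disk

variable {C : Type u} [Category.{v} C] [Abelian C]

theorem zmod_eq_or {a b : ZMod 2} (hab : a ≠ b) (i : ZMod 2) : i = a ∨ i = b := by
  revert a b i
  decide

theorem rel_of_ne {a b : ZMod 2} (hab : a ≠ b) : (ComplexShape.up (ZMod 2)).Rel a b := by
  change a + 1 = b
  revert a b
  decide

theorem eq_of_rel {a b i j : ZMod 2} (hab : a ≠ b) (h : (ComplexShape.up (ZMod 2)).Rel i j) :
    (i = a ∧ j = b) ∨ (i = b ∧ j = a) := by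
  change i + 1 = j at h
  revert a b i j
  decide

theorem exists_hom_of_components {M N : Cpx C} {a b : ZMod 2} (hab : a ≠ b) (fa : M.X a ⟶ N.X a)
    (fb : M.X b ⟶ N.X b) (h₁ : fa ≫ N.d a b = M.d a b ≫ fb) (h₂ : fb ≫ N.d b a = M.d b a ≫ fa) :
    ∃ f : M ⟶ N, f.f a = fa ∧ f.f b = fb := by
  have hg : ∃ g : ∀ i, M.X i ⟶ N.X i, g a = fa ∧ g b = fb := by
    classical
    refine ⟨fun i => if h : i = a then eqToHom (by rw [h]) ≫ fa ≫ eqToHom (by rw [h])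
      else if h : i = b then eqToHom (by rw [h]) ≫ fb ≫ eqToHom (by rw [h]) else 0, ?_, ?_⟩
    · simp
    · simp [hab.symm]
  obtain ⟨g, ga, gb⟩ := hg
  refine ⟨{ f := g, comm' := fun i j hij => ?_ }, ga, gb⟩
  rcases eq_of_rel hab hij with ⟨rfl, rfl⟩ | ⟨rfl, rfl⟩
  · rw [ga, gb, h₁]
  · rw [ga, gb, h₂]

theorem hom_ext_of_ne {M N : Cpx C} {a b : ZMod 2} (hab : a ≠ b) {f g : M ⟶ N}
    (ha : f.f a = g.f a) (hb : f.f b = g.f b) : f = g := by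
  refine HomologicalComplex.hom_ext _ _ fun i => ?_
  rcases zmod_eq_or hab i with rfl | rfl
  · exact ha
  · exact hb

theorem d_eq_zero_of_isIso_d {K : Cpx C} {a b : ZMod 2} [IsIso (K.d a b)] : K.d b a = 0 := by
  rw [← cancel_epi (K.d a b), K.d_comp_d, comp_zero]

/-- Morphisms from a complex with invertible differential `a ⟶ b` are given by their component in
degree `a`. -/
theorem bijective_hom_from {K : Cpx C} {a b : ZMod 2} (hab : a ≠ b) [IsIso (K.d a b)] (M : Cpx C) :
    Function.Bijective (fun f : K ⟶ M => f.f a) := by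
  constructor
  · intro f g h
    refine hom_ext_of_ne hab h ?_
    rw [← cancel_epi (K.d a b), ← f.comm, ← g.comm]
    exact congrArg (· ≫ M.d a b) h
  · intro g
    obtain ⟨f, hf, -⟩ := exists_hom_of_components hab g (inv (K.d a b) ≫ g ≫ M.d a b) (by simp)
      (by simp [d_eq_zero_of_isIso_d (K := K) (a := a) (b := b)])
    exact ⟨f, hf⟩

/-- Morphisms to a complex with invertible differential `a ⟶ b` are given by their component in
degree `b`. -/
theorem bijective_hom_to {K : Cpx C} {a b : ZMod 2} (hab : a ≠ b) [IsIso (K.d a b)] (M : Cpx C) :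
    Function.Bijective (fun f : M ⟶ K => f.f b) := by
  constructor
  · intro f g h
    refine hom_ext_of_ne hab ?_ h
    rw [← cancel_mono (K.d a b), f.comm, g.comm]
    exact congrArg (M.d a b ≫ ·) h
  · intro g
    obtain ⟨f, -, hf⟩ := exists_hom_of_components hab (M.d a b ≫ g ≫ inv (K.d a b)) g (by simp)
      (by simp [d_eq_zero_of_isIso_d (K := K) (a := a) (b := b)])
    exact ⟨f, hf⟩

/-- Morphisms out of `K` are determined by their component in degree `a`, which may be arbitrary; a
lifting problem for `K` is one for `K.X a`. -/
theorem projective_of_isIso_d {K : Cpx C} {a b : ZMod 2} (hab : a ≠ b) [IsIso (K.d a b)]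
    (hK : Projective (K.X a)) : Projective K where
  factors {E X} f e _ := by
    have : Epi (e.f a) :=
      inferInstanceAs (Epi ((HomologicalComplex.eval C (ComplexShape.up (ZMod 2)) a).map e))
    obtain ⟨g, hg⟩ := (bijective_hom_from (K := K) hab E).2 (Projective.factorThru (f.f a) (e.f a))
    refine ⟨g, (bijective_hom_from (K := K) hab X).1 ?_⟩
    dsimp only at hg ⊢
    rw [HomologicalComplex.comp_f, hg, Projective.factorThru_comp]

/-- Morphisms to `K` extend along degreewise split monomorphisms. -/
def RelInjective (K : Cpx C) : Prop :=
  ∀ ⦃N L : Cpx C⦄ (i : N ⟶ L), (∀ j, IsSplitMono (i.f j)) → ∀ f : N ⟶ K, ∃ g, i ≫ g = f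

/-- Morphisms into `K` are the morphisms into `K.X b` in degree `b`, and there a retraction of `i`
extends any of them. -/
theorem relInjective_of_isIso_d {K : Cpx C} {a b : ZMod 2} (hab : a ≠ b) [IsIso (K.d a b)] :
    RelInjective K := by
  intro N L i hi f
  have := hi b
  obtain ⟨g, hg⟩ := (bijective_hom_to (K := K) hab L).2 (retraction (i.f b) ≫ f.f b)
  refine ⟨g, (bijective_hom_to (K := K) hab N).1 ?_⟩
  dsimp only at hg ⊢
  rw [HomologicalComplex.comp_f, hg]
  simp

theorem RelInjective.biprod {K K' : Cpx C} (h : RelInjective K) (h' : RelInjective K') :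
    RelInjective (K ⊞ K') := by
  intro N L i hi f
  obtain ⟨g, hg⟩ := h i hi (f ≫ biprod.fst)
  obtain ⟨g', hg'⟩ := h' i hi (f ≫ biprod.snd)
  exact ⟨biprod.lift g g', biprod.hom_ext _ _ (by simp [hg]) (by simp [hg'])⟩

theorem RelInjective.of_iso {K K' : Cpx C} (h : RelInjective K) (e : K ≅ K') :
    RelInjective K' := by
  intro N L i hi f
  obtain ⟨g, hg⟩ := h i hi (f ≫ e.inv)
  exact ⟨g ≫ e.hom, by simp [reassoc_of% hg]⟩

instance isIso_d_KP (P : C) (hP : Projective P) : IsIso ((KP P hP).obj.d 1 0) := by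
  change IsIso (if (1 : ZMod 2) = 1 ∧ (0 : ZMod 2) = 0 then 𝟙 P else 0)
  rw [if_pos ⟨rfl, rfl⟩]
  infer_instance

instance isIso_d_KPstar (P : C) (hP : Projective P) : IsIso ((KPstar P hP).obj.d 0 1) := by
  change IsIso (if (0 : ZMod 2) = 0 ∧ (1 : ZMod 2) = 1 then -𝟙 P else 0)
  rw [if_pos ⟨rfl, rfl⟩]
  exact ⟨-𝟙 P, by simp, by simp⟩

theorem projective_KP (P : C) (hP : Projective P) : Projective (KP P hP).obj :=
  projective_of_isIso_d (a := 1) (b := 0) (by decide) hP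

theorem projective_KPstar (P : C) (hP : Projective P) : Projective (KPstar P hP).obj :=
  projective_of_isIso_d (a := 0) (b := 1) (by decide) hP

theorem relInjective_KP (P : C) (hP : Projective P) : RelInjective (KP P hP).obj :=
  relInjective_of_isIso_d (a := 1) (b := 0) (by decide)

theorem relInjective_KPstar (P : C) (hP : Projective P) : RelInjective (KPstar P hP).obj :=
  relInjective_of_isIso_d (a := 0) (b := 1) (by decide)

end Disk

/-! ### Acyclic complexes of projectives -/

section Acyclic

variable {C : Type u} [Category.{v} C] [Abelian C]

/-- The cokernel of `f` has projective dimension at most one, so in a sequence with projective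
middle term its kernel is projective. -/
theorem projective_of_mono (hher : ∀ X : C, HasProjectiveDimensionLE X 1) {X P : C} (f : X ⟶ P)
    [Mono f] (hP : Projective P) : Projective X := by
  have h : (ShortComplex.mk f (cokernel.π f) (cokernel.condition f)).ShortExact :=
    { exact := ShortComplex.exact_cokernel f }
  exact (projective_iff_hasProjectiveDimensionLT_one).2
    (h.hasProjectiveDimensionLT_X₁ 1 ((projective_iff_hasProjectiveDimensionLT_one).1 hP)
      (hher _))

theorem projective_cycles (hher : ∀ X : C, HasProjectiveDimensionLE X 1) (M : CP C) (i : ZMod 2) :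
    Projective (M.obj.cycles i) :=
  projective_of_mono hher (M.obj.iCycles i) (M.property i)

/-- The sequence `Z_a ⟶ M_a ⟶ Z_b`. -/
def cyclesSequence (M : Cpx C) (a b : ZMod 2) : ShortComplex C :=
  ShortComplex.mk (M.iCycles a) (M.toCycles a b) (by
    rw [← cancel_mono (M.iCycles b), Category.assoc, HomologicalComplex.toCycles_i, zero_comp,
      HomologicalComplex.iCycles_d])

theorem shortExact_cyclesSequence {M : Cpx C} (hM : M.Acyclic) {a b : ZMod 2} (hab : a ≠ b) :
    (cyclesSequence M a b).ShortExact where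
  exact := by
    have h := ShortComplex.exact_of_f_is_kernel (ShortComplex.mk (M.iCycles a) (M.d a b)
      (M.iCycles_d a b)) (M.cyclesIsKernel a b (ComplexShape.next_eq' _ (rel_of_ne hab)))
    rw [ShortComplex.exact_iff_exact_up_to_refinements] at h ⊢
    intro A (x : A ⟶ M.X a) (hx : x ≫ M.toCycles a b = 0)
    refine h x ?_
    change x ≫ M.d a b = 0
    rw [← M.toCycles_i a b, reassoc_of% hx, zero_comp]
  mono_f := inferInstanceAs (Mono (M.iCycles a))
  epi_g := by
    have h := hM b
    have h' := ShortComplex.Exact.epi_toCycles h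
    have := ComplexShape.prev_eq' _ (rel_of_ne hab)
    change Epi (M.toCycles ((ComplexShape.up (ZMod 2)).prev b) b) at h'
    rw [this] at h'
    exact h'

/-- A complex whose terms split along their cycles is a sum of two contractible complexes. -/
theorem nonempty_biprod_iso_of_splittings {M K K' : Cpx C} {Z₀ Z₁ : C}
    {i₀ : Z₀ ⟶ M.X 0} {p₀ : M.X 0 ⟶ Z₁} {i₁ : Z₁ ⟶ M.X 1} {p₁ : M.X 1 ⟶ Z₀}
    {w₀ : i₀ ≫ p₀ = 0} {w₁ : i₁ ≫ p₁ = 0} (σ : (ShortComplex.mk i₀ p₀ w₀).Splitting)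
    (τ : (ShortComplex.mk i₁ p₁ w₁).Splitting) (h₀₁ : M.d 0 1 = p₀ ≫ i₁)
    (h₁₀ : M.d 1 0 = p₁ ≫ i₀) [IsIso (K.d 1 0)] [IsIso (K'.d 0 1)] (e : K.X 0 ≅ Z₀)
    (e' : K'.X 1 ≅ Z₁) : Nonempty (K ⊞ K' ≅ M) := by
  have h01 : (0 : ZMod 2) ≠ 1 := by decide
  have h10 : (1 : ZMod 2) ≠ 0 := by decide
  have dK : K.d 0 1 = 0 := d_eq_zero_of_isIso_d (a := 1) (b := 0)
  have dK' : K'.d 1 0 = 0 := d_eq_zero_of_isIso_d (a := 0) (b := 1)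
  obtain ⟨σr, σs, σfr, σsg, σid⟩ := σ
  obtain ⟨τr, τs, τfr, τsg, τid⟩ := τ
  dsimp only at σr σs σfr σsg σid τr τs τfr τsg τid
  -- Composing the splitting identity with `s` and `r` on its two sides shows that twice `s ≫ r`
  -- equals `s ≫ r`.
  have σsr : σs ≫ σr = 0 := by
    have h := congrArg (fun z => σs ≫ z ≫ σr) σid
    simpa [σfr, reassoc_of% σsg] using h
  have τsr : τs ≫ τr = 0 := by
    have h := congrArg (fun z => τs ≫ z ≫ τr) τid
    simpa [τfr, reassoc_of% τsg] using h
  -- Inclusions and projections of the two summands. Since `K` and `K'` are contractible with one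
  -- invertible differential, each of the four orthogonality relations needs to be checked in a
  -- single degree only.
  obtain ⟨u, u1, u0⟩ := exists_hom_of_components (M := K) (N := M) h10
    (K.d 1 0 ≫ e.hom ≫ τs) (e.hom ≫ i₀) (by simp [h₁₀, reassoc_of% τsg])
    (by simp [h₀₁, reassoc_of% w₀, dK])
  obtain ⟨r, r1, r0⟩ := exists_hom_of_components (M := M) (N := K) h10
    (p₁ ≫ e.inv ≫ inv (K.d 1 0)) (σr ≫ e.inv) (by simp [h₁₀, reassoc_of% σfr])
    (by simp [h₀₁, reassoc_of% w₁, dK])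
  obtain ⟨u', u'0, u'1⟩ := exists_hom_of_components (M := K') (N := M) h01
    (K'.d 0 1 ≫ e'.hom ≫ σs) (e'.hom ≫ i₁) (by simp [h₀₁, reassoc_of% σsg])
    (by simp [h₁₀, reassoc_of% w₁, dK'])
  obtain ⟨r', r'0, r'1⟩ := exists_hom_of_components (M := M) (N := K') h01
    (p₀ ≫ e'.inv ≫ inv (K'.d 0 1)) (τr ≫ e'.inv) (by simp [h₀₁, reassoc_of% τfr])
    (by simp [h₁₀, reassoc_of% w₀, dK'])
  have ur : u ≫ r = 𝟙 _ := (bijective_hom_to (K := K) h10 _).1 (by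
    simp [u0, r0, reassoc_of% σfr])
  have u'r' : u' ≫ r' = 𝟙 _ := (bijective_hom_to (K := K') h01 _).1 (by
    simp [u'1, r'1, reassoc_of% τfr])
  have ur' : u ≫ r' = 0 := (bijective_hom_from (K := K) h10 _).1 (by
    simp [u1, r'1, reassoc_of% τsr])
  have u'r : u' ≫ r = 0 := (bijective_hom_from (K := K') h01 _).1 (by
    simp [u'0, r0, reassoc_of% σsr])
  have hid : r ≫ u + r' ≫ u' = 𝟙 _ := by
    refine hom_ext_of_ne h01 ?_ ?_
    · simp [u0, r0, u'0, r'0, σid]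
    · simp [u1, r1, u'1, r'1, add_comm (p₁ ≫ τs), τid]
  exact ⟨{
    hom := biprod.desc u u'
    inv := biprod.lift r r'
    hom_inv_id := by
      apply biprod.hom_ext' <;> apply biprod.hom_ext <;> simp [ur, u'r', ur', u'r]
    inv_hom_id := by rw [biprod.lift_desc, hid] }⟩

theorem nonempty_iso_KP_biprod_KPstar (hher : ∀ X : C, HasProjectiveDimensionLE X 1) (M : CP C)
    (hM : M.obj.Acyclic) :
    Nonempty ((KP (M.obj.cycles 0) (projective_cycles hher M 0)).obj ⊞
      (KPstar (M.obj.cycles 1) (projective_cycles hher M 1)).obj ≅ M.obj) := by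
  have e0 := shortExact_cyclesSequence hM (a := 0) (b := 1) (by decide)
  have e1 := shortExact_cyclesSequence hM (a := 1) (b := 0) (by decide)
  have : Projective (cyclesSequence M.obj 0 1).X₃ := projective_cycles hher M 1
  have : Projective (cyclesSequence M.obj 1 0).X₃ := projective_cycles hher M 0
  exact nonempty_biprod_iso_of_splittings e0.splittingOfProjective e1.splittingOfProjective
    (M.obj.toCycles_i 0 1).symm (M.obj.toCycles_i 1 0).symm (Iso.refl _) (Iso.refl _)

theorem projective_of_acyclic (hher : ∀ X : C, HasProjectiveDimensionLE X 1) (M : CP C)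
    (hM : M.obj.Acyclic) : Projective M.obj := by
  obtain ⟨e⟩ := nonempty_iso_KP_biprod_KPstar hher M hM
  have := projective_KP _ (projective_cycles hher M 0)
  have := projective_KPstar _ (projective_cycles hher M 1)
  exact Projective.of_iso e inferInstance

theorem relInjective_of_acyclic (hher : ∀ X : C, HasProjectiveDimensionLE X 1) (M : CP C)
    (hM : M.obj.Acyclic) : RelInjective M.obj := by
  obtain ⟨e⟩ := nonempty_iso_KP_biprod_KPstar hher M hM
  exact RelInjective.of_iso (RelInjective.biprod (relInjective_KP _ _) (relInjective_KPstar _ _)) e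

end Acyclic

/-! ### Minimal complexes -/

theorem exists_pow_isIdempotentElem {R : Type*} [Monoid R] [Finite R] (e : R) :
    ∃ n, IsIdempotentElem (e ^ (n + 1)) := by
  obtain ⟨a, b, hab, h⟩ := Finite.exists_ne_map_eq_of_infinite (fun n : ℕ => e ^ n)
  wlog hlt : a < b generalizing a b
  · exact this b a hab.symm h.symm (by omega)
  obtain ⟨p, rfl⟩ : ∃ p, b = a + (p + 1) := ⟨b - a - 1, by omega⟩
  have h1 : ∀ n, a ≤ n → ∀ m, e ^ (n + m * (p + 1)) = e ^ n := by
    intro n hn m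
    induction m with
    | zero => simp
    | succ m ih =>
      obtain ⟨c, rfl⟩ := Nat.exists_eq_add_of_le hn
      rw [← ih, show a + c + (m + 1) * (p + 1) = (a + (p + 1)) + (c + m * (p + 1)) by ring,
        pow_add, ← h, ← pow_add, add_assoc]
  -- From exponent `a` on, the powers of `e` have period `p + 1`. The exponent `(a + 1) * (p + 1)`
  -- is a positive multiple of the period and at least `a`, so doubling it leaves the power
  -- unchanged.
  refine ⟨(a + 1) * (p + 1) - 1, ?_⟩
  have h2 : (a + 1) * (p + 1) - 1 + 1 = (a + 1) * (p + 1) := Nat.sub_add_cancel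
    (Nat.mul_pos a.succ_pos p.succ_pos)
  rw [h2]
  unfold IsIdempotentElem
  rw [← pow_add]
  exact h1 _ (by nlinarith) _

section Minimal

/-- A retract in an abelian category is a direct summand. -/
theorem exists_iso_biprod_of_retract {D : Type u} [Category.{v} D] [Abelian D] {A X : D}
    (i : A ⟶ X) (r : X ⟶ A) (h : i ≫ r = 𝟙 A) : ∃ B : D, Nonempty (X ≅ B ⊞ A) := by
  have : Mono i := mono_of_mono_fac h
  let S := ShortComplex.mk i (cokernel.π i) (cokernel.condition i)
  have hS : S.Exact := ShortComplex.exact_cokernel i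
  let σ : S.Splitting := ShortComplex.Splitting.ofExactOfRetraction S hS r h inferInstance
  exact ⟨cokernel i, ⟨σ.isoBinaryBiproduct ≪≫ biprod.braiding _ _⟩⟩

variable {C : Type u} [Category.{v} C] [Abelian C]

theorem acyclic_of_retract {A K : Cpx C} (i : A ⟶ K) (r : K ⟶ A) (h : i ≫ r = 𝟙 A)
    (hK : K.Acyclic) : A.Acyclic := by
  intro j
  rw [HomologicalComplex.exactAt_iff_isZero_homology]
  have h0 : IsZero (K.homology j) :=
    (HomologicalComplex.exactAt_iff_isZero_homology _ _).1 (hK j)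
  rw [IsZero.iff_id_eq_zero, ← HomologicalComplex.homologyMap_id, ← h,
    HomologicalComplex.homologyMap_comp, h0.eq_of_tgt (HomologicalComplex.homologyMap i j) 0,
    zero_comp]

theorem isProj_of_retract {A M : Cpx C} (i : A ⟶ M) (r : M ⟶ A) (h : i ≫ r = 𝟙 A)
    (hM : isProj C M) : isProj C A := by
  intro j
  have := hM j
  exact Retract.projective ⟨i.f j, r.f j, by rw [← HomologicalComplex.comp_f, h]; rfl⟩

/-- The direct sum of two complexes of projectives. -/
def CP.sum (M N : CP C) : CP C :=
  ⟨N.obj ⊞ M.obj, isProj_of_shortExact M.property N.property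
    (ShortComplex.Splitting.ofHasBinaryBiproduct N.obj M.obj).shortExact⟩

/-- The split extension. -/
def CP.sumExtn (M N : CP C) : Extn M N (CP.sum M N) where
  i := biprod.inl
  p := biprod.snd
  zero := biprod.inl_snd
  exact := (ShortComplex.Splitting.ofHasBinaryBiproduct N.obj M.obj).shortExact

theorem acyclic_biprod {K K' : Cpx C} (h : K.Acyclic) (h' : K'.Acyclic) : (K ⊞ K').Acyclic := by
  intro j
  rw [HomologicalComplex.exactAt_iff_isZero_homology]
  have h0 : IsZero (K.homology j) :=
    (HomologicalComplex.exactAt_iff_isZero_homology _ _).1 (h j)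
  have h0' : IsZero (K'.homology j) :=
    (HomologicalComplex.exactAt_iff_isZero_homology _ _).1 (h' j)
  rw [IsZero.iff_id_eq_zero, ← HomologicalComplex.homologyMap_id, ← biprod.total,
    HomologicalComplex.homologyMap_add, HomologicalComplex.homologyMap_comp,
    HomologicalComplex.homologyMap_comp, h0.eq_of_tgt (HomologicalComplex.homologyMap _ j) 0,
    h0'.eq_of_tgt (HomologicalComplex.homologyMap _ j) 0, zero_comp, zero_comp, add_zero]

theorem acyclic_of_iso {K K' : Cpx C} (e : K ≅ K') (h : K.Acyclic) : K'.Acyclic :=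
  acyclic_of_retract e.inv e.hom e.inv_hom_id h

theorem acyclic_sum {K K' : CP C} (h : K.obj.Acyclic) (h' : K'.obj.Acyclic) :
    (CP.sum K K').obj.Acyclic :=
  acyclic_biprod h' h

theorem acyclic_of_isZero {K : Cpx C} (h : IsZero K) : K.Acyclic := by
  intro j
  rw [HomologicalComplex.exactAt_iff_isZero_homology, IsZero.iff_id_eq_zero,
    ← HomologicalComplex.homologyMap_id, h.eq_of_src (𝟙 K) 0, HomologicalComplex.homologyMap_zero]

theorem isZero_zeroCP : IsZero (zeroCP C).obj := by
  rw [IsZero.iff_id_eq_zero]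
  exact HomologicalComplex.hom_ext _ _ (fun _ => (isZero_zero C).eq_of_src _ _)

theorem IsMinimal.isZero_of_retract {M : CP C} (hM : IsMinimal M) {K : Cpx C} (hK : K.Acyclic)
    (i : K ⟶ M.obj) (r : M.obj ⟶ K) (h : i ≫ r = 𝟙 K) : IsZero K := by
  obtain ⟨B, e⟩ := exists_iso_biprod_of_retract i r h
  exact hM B K hK e

theorem isMinimal_of_retracts {M : CP C}
    (h : ∀ (K : Cpx C) (i : K ⟶ M.obj) (r : M.obj ⟶ K), K.Acyclic → i ≫ r = 𝟙 K → IsZero K) :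
    IsMinimal M := by
  rintro N K hK ⟨e⟩
  exact h K (biprod.inr ≫ e.inv) (e.hom ≫ biprod.snd) hK (by simp)

theorem IsMinimal.of_iso {M M' : CP C} (hM : IsMinimal M) (e : M.obj ≅ M'.obj) : IsMinimal M' := by
  rintro N K hK ⟨e'⟩
  exact hM N K hK ⟨e ≪≫ e'⟩

theorem isMinimal_zeroCP : IsMinimal (zeroCP C) :=
  isMinimal_of_retracts fun K i r _ h => by
    rw [IsZero.iff_id_eq_zero, ← h, isZero_zeroCP.eq_of_tgt i 0, zero_comp]

/-- Quotients of minimal complexes are minimal. -/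
theorem IsMinimal.quotient (hher : ∀ X : C, HasProjectiveDimensionLE X 1) {M N L : CP C}
    (s : Extn M N L) (hL : IsMinimal L) : IsMinimal M := by
  refine isMinimal_of_retracts fun K i r hK h => ?_
  -- An acyclic summand of the quotient is projective, so its inclusion lifts to `L` and it becomes
  -- a summand of `L`.
  have : Projective K := projective_of_acyclic hher ⟨K, isProj_of_retract i r h M.property⟩ hK
  have : Epi s.p := s.exact.epi_g
  exact hL.isZero_of_retract hK (Projective.factorThru i s.p) (s.p ≫ r) (by simp [h])

/-- Subobjects of minimal complexes are minimal. -/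
theorem IsMinimal.sub (hher : ∀ X : C, HasProjectiveDimensionLE X 1) {M N L : CP C}
    (s : Extn M N L) (hL : IsMinimal L) : IsMinimal N := by
  refine isMinimal_of_retracts fun K i r hK h => ?_
  -- Dually, the projection of `N` onto an acyclic summand extends to `L`, because `N ⟶ L` splits
  -- degreewise.
  have hinj := relInjective_of_acyclic hher ⟨K, isProj_of_retract i r h N.property⟩ hK
  obtain ⟨g, hg⟩ := hinj s.i (fun j => by
    have h := s.exact.map_of_exact (HomologicalComplex.eval C (ComplexShape.up (ZMod 2)) j)
    have : Projective (((ShortComplex.mk s.i s.p s.zero).map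
        (HomologicalComplex.eval C (ComplexShape.up (ZMod 2)) j)).X₃) := M.property j
    exact ⟨⟨h.splittingOfProjective.splitMono_f⟩⟩) r
  exact hL.isZero_of_retract hK (i ≫ s.i) g (by simp [hg, h])

/-- Some power of the endomorphism `f ≫ g` is idempotent by finiteness. Its image is a retract of
`K`, hence an acyclic summand of `N`, hence zero. So `f ≫ g` is nilpotent. -/
theorem isIso_one_sub_of_isMinimal (hfin : ∀ X Y : C, Finite (X ⟶ Y)) {N : CP C}
    (hN : IsMinimal N) {K : Cpx C} (hK : K.Acyclic) (f : N.obj ⟶ K) (g : K ⟶ N.obj) :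
    IsIso (𝟙 N.obj - f ≫ g) := by
  have : Finite (End N.obj) := finite_hom_cpx hfin N.obj N.obj
  let e : End N.obj := f ≫ g
  obtain ⟨n, hn⟩ := exists_pow_isIdempotentElem e
  have he : e ^ (n + 1) = f ≫ g ≫ (e ^ n : End N.obj) := by
    rw [pow_succ, End.mul_def, Category.assoc]
  obtain ⟨Y, i, p, hip, hpi⟩ := IsIdempotentComplete.idempotents_split N.obj
    (e ^ (n + 1) : End N.obj) hn
  have h1 : (i ≫ f) ≫ g ≫ (e ^ n : End N.obj) ≫ p = 𝟙 Y := by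
    have : i ≫ (e ^ (n + 1) : End N.obj) ≫ p = 𝟙 Y := by
      rw [← hpi]
      simp [hip]
    rw [he] at this
    simpa using this
  have hY := hN.isZero_of_retract (acyclic_of_retract _ _ h1 hK) i p hip
  have h0 : e ^ (n + 1) = 0 := by
    rw [← hpi, hY.eq_of_tgt p 0, zero_comp]
  have hu : IsUnit (1 - e) := IsNilpotent.isUnit_one_sub ⟨n + 1, h0⟩
  exact (isUnit_iff_isIso (1 - e)).1 hu

/-- The minimal part of a complex is unique up to isomorphism. -/
theorem nonempty_iso_of_isMinimal (hfin : ∀ X Y : C, Finite (X ⟶ Y)) {N N' : CP C}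
    (hN : IsMinimal N) (hN' : IsMinimal N') {K K' : Cpx C} (hK : K.Acyclic) (hK' : K'.Acyclic)
    (φ : N.obj ⊞ K ≅ N'.obj ⊞ K') : Nonempty (N.obj ≅ N'.obj) := by
  let a := biprod.inl ≫ φ.hom ≫ biprod.fst
  let a' := biprod.inl ≫ φ.inv ≫ biprod.fst
  -- The identity of `N` passes through `N' ⊞ K'`; the part through `N'` is `a ≫ a'`, and the part
  -- through the acyclic `K'` is the error term.
  have h1 : a ≫ a' = 𝟙 _ - (biprod.inl ≫ φ.hom ≫ biprod.snd) ≫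
      (biprod.inr ≫ φ.inv ≫ biprod.fst) := by
    have h : (biprod.inl : N.obj ⟶ N.obj ⊞ K) ≫ φ.hom ≫ (biprod.fst ≫ biprod.inl +
        biprod.snd ≫ biprod.inr) ≫ φ.inv ≫ biprod.fst = 𝟙 _ := by
      rw [biprod.total]; simp
    rw [eq_sub_iff_add_eq]
    simpa only [a, a', Preadditive.add_comp, Preadditive.comp_add, Category.assoc] using h
  have h2 : a' ≫ a = 𝟙 _ - (biprod.inl ≫ φ.inv ≫ biprod.snd) ≫
      (biprod.inr ≫ φ.hom ≫ biprod.fst) := by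
    have h : (biprod.inl : N'.obj ⟶ N'.obj ⊞ K') ≫ φ.inv ≫ (biprod.fst ≫ biprod.inl +
        biprod.snd ≫ biprod.inr) ≫ φ.hom ≫ biprod.fst = 𝟙 _ := by
      rw [biprod.total]; simp
    rw [eq_sub_iff_add_eq]
    simpa only [a, a', Preadditive.add_comp, Preadditive.comp_add, Category.assoc] using h
  have i1 : IsIso (a ≫ a') := by rw [h1]; exact isIso_one_sub_of_isMinimal hfin hN hK' _ _
  have i2 : IsIso (a' ≫ a) := by rw [h2]; exact isIso_one_sub_of_isMinimal hfin hN' hK _ _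
  have : Mono a := mono_of_mono a a'
  have : Epi a := epi_of_epi a' a
  have : IsIso a := isIso_of_mono_of_epi a
  exact ⟨asIso a⟩

theorem card_end_lt_of_iso_biprod (hfin : ∀ X Y : C, Finite (X ⟶ Y)) {M N K : Cpx C}
    (e : M ≅ N ⊞ K) (hK : ¬ IsZero K) : Nat.card (N ⟶ N) < Nat.card (M ⟶ M) := by
  have hf := finite_hom_cpx hfin
  have h1 : Nat.card ((N ⟶ N) × (K ⟶ K)) ≤ Nat.card (M ⟶ M) := by
    refine Nat.card_le_card_of_injective (fun f => e.hom ≫ biprod.map f.1 f.2 ≫ e.inv) ?_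
    intro f g h
    have h' : biprod.map f.1 f.2 = biprod.map g.1 g.2 := by simpa using h
    refine Prod.ext ?_ ?_
    · simpa using congrArg (fun z => biprod.inl ≫ z ≫ biprod.fst) h'
    · simpa using congrArg (fun z => biprod.inr ≫ z ≫ biprod.snd) h'
  have h2 : 1 < Nat.card (K ⟶ K) := by
    rw [Finite.one_lt_card_iff_nontrivial]
    exact ⟨𝟙 K, 0, fun h => hK ((IsZero.iff_id_eq_zero K).2 h)⟩
  have h3 : 0 < Nat.card (N ⟶ N) := Nat.card_pos
  rw [Nat.card_prod] at h1
  nlinarith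

/-- Splitting off a nonzero acyclic summand strictly decreases the number of endomorphisms, so the
process ends. -/
theorem exists_minimal_decomposition (hfin : ∀ X Y : C, Finite (X ⟶ Y)) (M : CP C) :
    ∃ N K : CP C, IsMinimal N ∧ K.obj.Acyclic ∧ Nonempty (M.obj ≅ N.obj ⊞ K.obj) := by
  induction hn : Nat.card (M.obj ⟶ M.obj) using Nat.strong_induction_on generalizing M with
  | _ n ih =>
    by_cases hM : IsMinimal M
    · refine ⟨M, zeroCP C, hM, acyclic_of_isZero isZero_zeroCP, ⟨?_⟩⟩
      exact isoBiprodZero isZero_zeroCP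
    · unfold IsMinimal at hM
      push Not at hM
      obtain ⟨N, K, hK, ⟨e⟩, hK0⟩ := hM
      have pN : isProj C N := isProj_of_retract (biprod.inl ≫ e.inv) (e.hom ≫ biprod.fst)
        (by simp) M.property
      have pK : isProj C K := isProj_of_retract (biprod.inr ≫ e.inv) (e.hom ≫ biprod.snd)
        (by simp) M.property
      have hlt := card_end_lt_of_iso_biprod hfin e hK0
      obtain ⟨N', K', hN', hK', ⟨e'⟩⟩ := ih _ (hn ▸ hlt) ⟨N, pN⟩ rfl
      refine ⟨N', CP.sum ⟨K, pK⟩ K', hN', acyclic_sum hK hK', ⟨?_⟩⟩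
      exact e ≪≫ biprod.mapIso e' (Iso.refl _) ≪≫ biprod.associator _ _ _

end Minimal

/-! ### Classes in the Grothendieck group -/

section Classes

variable {C : Type u} [Category.{v} C] [Abelian C]

theorem K0.cl_of_shortExact {S : ShortComplex C} (h : S.ShortExact) :
    K0.cl S.X₂ = K0.cl S.X₁ + K0.cl S.X₃ := by
  have h1 : FreeAbelianGroup.of S.X₂ - FreeAbelianGroup.of S.X₁ - FreeAbelianGroup.of S.X₃ ∈
      K0Relations C := AddSubgroup.subset_closure ⟨S, h, rfl⟩
  have h2 := (QuotientAddGroup.eq_zero_iff _).2 h1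
  rw [QuotientAddGroup.mk_sub, QuotientAddGroup.mk_sub, sub_sub, sub_eq_zero] at h2
  exact h2

theorem K0.cl_biprod (X Y : C) : K0.cl (X ⊞ Y) = K0.cl X + K0.cl Y :=
  K0.cl_of_shortExact (ShortComplex.Splitting.ofHasBinaryBiproduct X Y).shortExact

theorem K0.cl_of_isZero {X : C} (h : IsZero X) : K0.cl X = 0 := by
  have h1 := K0.cl_of_shortExact (S := ShortComplex.mk (0 : X ⟶ X) (0 : X ⟶ X) (by simp))
    { exact := ShortComplex.exact_of_isZero_X₂ _ h
      mono_f := ⟨fun _ _ _ => h.eq_of_tgt _ _⟩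
      epi_g := ⟨fun _ _ _ => h.eq_of_src _ _⟩ }
  simpa using h1

theorem K0.cl_of_iso {X Y : C} (e : X ≅ Y) : K0.cl X = K0.cl Y := by
  have h1 := K0.cl_of_shortExact (S := ShortComplex.mk e.hom (0 : Y ⟶ 0) (by simp))
    { exact := (ShortComplex.exact_iff_epi _ (by simp)).2 inferInstance
      mono_f := inferInstance
      epi_g := ⟨fun _ _ _ => (isZero_zero C).eq_of_src _ _⟩ }
  rw [K0.cl_of_isZero (isZero_zero C), add_zero] at h1
  exact h1.symm

theorem Extn.cl_X {M N L : CP C} (s : Extn M N L) (i : ZMod 2) :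
    K0.cl (L.obj.X i) = K0.cl (N.obj.X i) + K0.cl (M.obj.X i) :=
  K0.cl_of_shortExact
    (s.exact.map_of_exact (HomologicalComplex.eval C (ComplexShape.up (ZMod 2)) i))

end Classes

/-! ### The coproduct -/

section Coproduct

variable {C : Type u} [Category.{v} C] [Abelian C]

/-- In the long exact homology sequence each connecting morphism `H_i(M) ⟶ H_{i+1}(N)` has zero
source or zero target. -/
theorem Extn.isZero_homology_iff {M N L : CP C} (s : Extn M N L) (h : OrthHomology M N)
    (i : ZMod 2) :
    IsZero (L.obj.homology i) ↔ IsZero (M.obj.homology i) ∧ IsZero (N.obj.homology i) := by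
  have hrel : ∀ j : ZMod 2, (ComplexShape.up (ZMod 2)).Rel j (j + 1) := fun j => rfl
  have hi : i + 1 + 1 = i := by revert i; decide
  constructor
  · intro hL
    constructor
    · by_contra hM
      exact hM ((s.exact.homology_exact₃ i (i + 1) (hrel i)).isZero_of_both_isZero hL (h i hM))
    · obtain ⟨j, rfl⟩ : ∃ j, i = j + 1 := ⟨i + 1, hi.symm⟩
      by_contra hN
      have hM : IsZero (M.obj.homology j) := by
        by_contra hM
        exact hN (h j hM)
      exact hN ((s.exact.homology_exact₁ j (j + 1) (hrel j)).isZero_of_both_isZero hM hL)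
  · rintro ⟨hM, hN⟩
    exact (s.exact.homology_exact₂ i).isZero_of_both_isZero hN hM

/-- The condition sees only the degrees in which homology is nonzero, and for a sequence in `E₀`
those of the middle term are the union of those of the ends. With `extn_right_iff`, both iterated
coproducts carry the same condition on the three factors. -/
theorem OrthHomology.extn_left_iff {P Q X : CP C} (s : Extn P Q X) (h : OrthHomology P Q)
    (N : CP C) : OrthHomology X N ↔ OrthHomology P N ∧ OrthHomology Q N := by
  simp only [OrthHomology, s.isZero_homology_iff h, not_and_or]
  exact ⟨fun H => ⟨fun i hi => H i (Or.inl hi), fun i hi => H i (Or.inr hi)⟩,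
    fun H i hi => hi.elim (H.1 i) (H.2 i)⟩

theorem OrthHomology.extn_right_iff {Q N Y : CP C} (s : Extn Q N Y) (h : OrthHomology Q N)
    (P : CP C) : OrthHomology P Y ↔ OrthHomology P Q ∧ OrthHomology P N := by
  simp only [OrthHomology, s.isZero_homology_iff h]
  exact ⟨fun H => ⟨fun i hi => (H i hi).1, fun i hi => (H i hi).2⟩,
    fun H i hi => ⟨H.1 i hi, H.2 i hi⟩⟩

open Classical in
/-- Coassociativity of the coproduct on the Hall algebra of complexes, coordinatewise. -/
theorem finsum_coCoeff_mul (hfin : ∀ X Y : C, Finite (X ⟶ Y)) {t : ℂ} (ht : t ≠ 0)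
    {χ : IsoCP C → IsoCP C → ℂ} (hχ : IsAdditiveChi χ) (L P Q N : CP C) :
    ∑ᶠ x : IsoCP C, coCoeff t χ L (Quotient.out x) N * coCoeff t χ (Quotient.out x) P Q =
      ∑ᶠ y : IsoCP C, coCoeff t χ L P (Quotient.out y) * coCoeff t χ (Quotient.out y) Q N := by
  -- The common factor of both sides. The direct sum `Q ⊞ N` serves as a reference middle term:
  -- additivity of `χ` sees only the classes of the terms, so any extension of `Q` by `N` gives the
  -- same exponent.
  let κ : ℂ := if OrthHomology P Q ∧ OrthHomology P N ∧ OrthHomology Q N then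
    t ^ (χ (isoClass P) (isoClass (CP.sum Q N)) + χ (isoClass Q) (isoClass N)) /
      (autCard P * autCard Q * autCard N) else 0
  have hl : ∀ x : IsoCP C, coCoeff t χ L (Quotient.out x) N * coCoeff t χ (Quotient.out x) P Q =
      κ * (extnCard P Q (Quotient.out x) * extnCard (Quotient.out x) N L /
        autCard (Quotient.out x)) := by
    intro x
    by_cases he : Nonempty (Extn P Q (Quotient.out x))
    · obtain ⟨s⟩ := he
      rw [coCoeff_eq hfin, coCoeff_eq hfin]
      simp only [κ]
      by_cases h1 : OrthHomology P Q
      · simp only [h1, OrthHomology.extn_left_iff s h1, true_and, if_true]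
        split_ifs with h2
        · have h3 := hχ (Quotient.out x) N P Q (CP.sum Q N)
            (fun i => by rw [s.cl_X i, add_comm])
            (fun i => by rw [(CP.sumExtn Q N).cl_X i, add_comm])
          rw [← h3, Complex.cpow_add _ _ ht]
          have := autCard_ne_zero hfin P
          have := autCard_ne_zero hfin Q
          have := autCard_ne_zero hfin N
          have := autCard_ne_zero hfin (Quotient.out x)
          field_simp
        · simp
      · simp [h1]
    · have h0 : extnCard P Q (Quotient.out x) = 0 := by
        by_contra h
        exact he ((extnCard_ne_zero_iff hfin).1 h)
      rw [coCoeff_eq hfin _ _ (Quotient.out x), h0]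
      simp
  have hr : ∀ y : IsoCP C, coCoeff t χ L P (Quotient.out y) * coCoeff t χ (Quotient.out y) Q N =
      κ * (extnCard Q N (Quotient.out y) * extnCard P (Quotient.out y) L /
        autCard (Quotient.out y)) := by
    intro y
    by_cases he : Nonempty (Extn Q N (Quotient.out y))
    · obtain ⟨s⟩ := he
      rw [coCoeff_eq hfin, coCoeff_eq hfin]
      simp only [κ]
      by_cases h1 : OrthHomology Q N
      · simp only [h1, OrthHomology.extn_right_iff s h1, and_true, if_true]
        split_ifs with h2
        · have h3 := hχ (CP.sum P Q) N P Q (CP.sum Q N)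
            (fun i => by rw [(CP.sumExtn P Q).cl_X i, add_comm])
            (fun i => by rw [(CP.sumExtn Q N).cl_X i, add_comm])
          have h4 := hχ (CP.sum P Q) N P Q (Quotient.out y)
            (fun i => by rw [(CP.sumExtn P Q).cl_X i, add_comm])
            (fun i => by rw [s.cl_X i, add_comm])
          rw [← h3, h4, Complex.cpow_add _ _ ht]
          have := autCard_ne_zero hfin P
          have := autCard_ne_zero hfin Q
          have := autCard_ne_zero hfin N
          have := autCard_ne_zero hfin (Quotient.out y)
          field_simp
        · simp
      · simp [h1]
    · have h0 : extnCard Q N (Quotient.out y) = 0 := by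
        by_contra h
        exact he ((extnCard_ne_zero_iff hfin).1 h)
      rw [coCoeff_eq hfin _ _ (Quotient.out y), h0]
      simp
  simp only [hl, hr, ← smul_eq_mul κ]
  rw [← smul_finsum, ← smul_finsum, sum_extnCard_mul hfin]

theorem nonempty_extn_of_coCoeff_ne_zero (hfin : ∀ X Y : C, Finite (X ⟶ Y)) {t : ℂ}
    {χ : IsoCP C → IsoCP C → ℂ} {L M N : CP C} (h : coCoeff t χ L M N ≠ 0) :
    Nonempty (Extn M N L) := by
  rw [← extnCard_ne_zero_iff hfin]
  intro h0
  rw [coCoeff_eq hfin, h0] at h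
  simp at h

/-- A short exact sequence with split terms is determined, up to isomorphism of the outer terms,
by projections onto the first term. -/
theorem Extn.isos_of_projections_eq {M N M' N' L : CP C} (s : Extn M N L) (s' : Extn M' N' L)
    (r : ∀ j, L.obj.X j ⟶ N.obj.X j) (r' : ∀ j, L.obj.X j ⟶ N'.obj.X j)
    (hr : ∀ j, s.i.f j ≫ r j = 𝟙 _) (hr' : ∀ j, s'.i.f j ≫ r' j = 𝟙 _)
    (h : ∀ j, r j ≫ s.i.f j = r' j ≫ s'.i.f j) :
    Nonempty (M.obj ≅ M'.obj) ∧ Nonempty (N.obj ≅ N'.obj) := by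
  have m : Mono s.i := s.exact.mono_f
  have m' : Mono s'.i := s'.exact.mono_f
  have z : s.i ≫ s'.p = 0 := by
    ext j
    have h1 : s'.i.f j ≫ s'.p.f j = 0 := by
      rw [← HomologicalComplex.comp_f, s'.zero]; rfl
    have h2 : s.i.f j = (s.i.f j ≫ r' j) ≫ s'.i.f j := by
      rw [Category.assoc, ← h, ← Category.assoc, hr, Category.id_comp]
    rw [HomologicalComplex.comp_f, h2, Category.assoc, h1, comp_zero]
    rfl
  have z' : s'.i ≫ s.p = 0 := by
    ext j
    have h1 : s.i.f j ≫ s.p.f j = 0 := by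
      rw [← HomologicalComplex.comp_f, s.zero]; rfl
    have h2 : s'.i.f j = (s'.i.f j ≫ r j) ≫ s.i.f j := by
      rw [Category.assoc, h, ← Category.assoc, hr', Category.id_comp]
    rw [HomologicalComplex.comp_f, h2, Category.assoc, h1, comp_zero]
    rfl
  let a : N.obj ⟶ N'.obj := s'.exact.exact.lift s.i z
  let a' : N'.obj ⟶ N.obj := s.exact.exact.lift s'.i z'
  have ha : a ≫ s'.i = s.i := s'.exact.exact.lift_f _ _
  have ha' : a' ≫ s.i = s'.i := s.exact.exact.lift_f _ _
  let e : N.obj ≅ N'.obj :=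
    { hom := a
      inv := a'
      hom_inv_id := by rw [← cancel_mono s.i, Category.assoc, ha', ha, Category.id_comp]
      inv_hom_id := by rw [← cancel_mono s'.i, Category.assoc, ha, ha', Category.id_comp] }
  have hs : (ShortComplex.mk s'.i s.p z').ShortExact :=
    shortExact_of_isos s.exact e (Iso.refl _) (Iso.refl _) z' (by simp [e, ha]) (by simp)
  obtain ⟨φ, -⟩ := exists_iso_of_shortExact_left hs s'.exact
  exact ⟨⟨φ⟩, ⟨e⟩⟩

/-- A complex of projectives has only finitely many subobjects with quotient a complex of
projectives, up to isomorphism. -/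
theorem finite_outer (hfin : ∀ X Y : C, Finite (X ⟶ Y)) (L : CP C) :
    {p : IsoCP C × IsoCP C | Nonempty (Extn (Quotient.out p.1) (Quotient.out p.2) L)}.Finite := by
  let S := {p : IsoCP C × IsoCP C | Nonempty (Extn (Quotient.out p.1) (Quotient.out p.2) L)}
  let s : ∀ p : S, Extn (Quotient.out p.1.1) (Quotient.out p.1.2) L := fun p => p.2.some
  have hr : ∀ p : S, ∀ j, ∃ r, (s p).i.f j ≫ r = 𝟙 _ := by
    intro p j
    have h := (s p).exact.map_of_exact (HomologicalComplex.eval C (ComplexShape.up (ZMod 2)) j)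
    have : Projective (((ShortComplex.mk (s p).i (s p).p (s p).zero).map
        (HomologicalComplex.eval C (ComplexShape.up (ZMod 2)) j)).X₃) :=
      (Quotient.out p.1.1).property j
    exact ⟨_, h.splittingOfProjective.f_r⟩
  choose r hr using hr
  -- A subobject with degreewise retractions is recovered from the idempotents `r ≫ i` on the terms
  -- of `L`, of which there are finitely many.
  let f : S → ∀ j : ZMod 2, (L.obj.X j ⟶ L.obj.X j) := fun p j => r p j ≫ (s p).i.f j
  have hf : Function.Injective f := by
    intro p p' h
    obtain ⟨h1, h2⟩ := (s p).isos_of_projections_eq (s p') (r p) (r p') (hr p) (hr p')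
      (fun j => congrFun h j)
    refine Subtype.ext (Prod.ext ?_ ?_)
    · rw [← isoClass_out p.1.1, ← isoClass_out p'.1.1, isoClass_eq_iff]
      exact h1
    · rw [← isoClass_out p.1.2, ← isoClass_out p'.1.2, isoClass_eq_iff]
      exact h2
  have := Finite.of_injective f hf
  exact Set.toFinite S

/-! ### Finiteness of the coproduct, and `χ` with a zero argument -/

theorem comulE0_single (t : ℂ) (χ : IsoCP C → IsoCP C → ℂ) (L : IsoCP C)
    (p : IsoCP C × IsoCP C) : comulE0 t χ (Finsupp.single L 1) p =
      coCoeff t χ (Quotient.out L) (Quotient.out p.1) (Quotient.out p.2) := by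
  simp [comulE0]

theorem finite_support_comulE0 (hfin : ∀ X Y : C, Finite (X ⟶ Y)) (t : ℂ)
    (χ : IsoCP C → IsoCP C → ℂ) (L : IsoCP C) :
    {p : IsoCP C × IsoCP C | comulE0 t χ (Finsupp.single L 1) p ≠ 0}.Finite := by
  refine (finite_outer hfin (Quotient.out L)).subset fun p hp => ?_
  rw [Set.mem_ofPred_eq, comulE0_single] at hp
  exact nonempty_extn_of_coCoeff_ne_zero hfin hp

theorem chi_zero_left {χ : IsoCP C → IsoCP C → ℂ} (hχ : IsAdditiveChi χ) (N : CP C) :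
    χ (isoClass (zeroCP C)) (isoClass N) =
      χ (isoClass (zeroCP C)) (isoClass (zeroCP C)) := by
  have h0 : ∀ i, K0.cl ((zeroCP C).obj.X i) = 0 := fun i => K0.cl_of_isZero (isZero_zero C)
  have := hχ (zeroCP C) N (zeroCP C) (zeroCP C) N (fun i => by simp [h0]) (fun i => by simp [h0])
  linear_combination -this

theorem chi_zero_right {χ : IsoCP C → IsoCP C → ℂ} (hχ : IsAdditiveChi χ) (M : CP C) :
    χ (isoClass M) (isoClass (zeroCP C)) =
      χ (isoClass (zeroCP C)) (isoClass (zeroCP C)) := by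
  have h0 : ∀ i, K0.cl ((zeroCP C).obj.X i) = 0 := fun i => K0.cl_of_isZero (isZero_zero C)
  have := hχ M (zeroCP C) M (zeroCP C) (zeroCP C) (fun i => by simp [h0]) (fun i => by simp [h0])
  linear_combination this

end Coproduct

/-! ### The coproduct on the basis -/

section CoproductBasis

variable {k : Type w} [Field k] {C : Type u} [Category.{v} C] [Abelian C] [Linear k C]

theorem MinIso.isMinimal_out (x : MinIso C) : IsMinimal (Quotient.out x.1) := by
  obtain ⟨x, M, rfl, hM⟩ := x
  obtain ⟨e⟩ := nonempty_iso_out M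
  exact hM.of_iso e.symm

/-- The class of the zero complex as a minimal class. -/
def MinIso.zero (C : Type u) [Category.{v} C] [Abelian C] : MinIso C :=
  ⟨isoClass (zeroCP C), zeroCP C, rfl, isMinimal_zeroCP⟩

-- Both tensor factors in the coproduct of a minimal class are minimal, so multiplying each by `K_α
-- * K_β^*` yields basis vectors again. A coordinate is therefore one structure constant, and the
-- pair `(α, β)` is the same in all three places.
open Classical in
theorem comul_basis_apply (hfin : ∀ X Y : C, Finite (X ⟶ Y))
    (hher : ∀ X : C, HasProjectiveDimensionLE X 1) (t : ℂ) (χ : IsoCP C → IsoCP C → ℂ)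
    {KFam KFamStar : K0 C → DH k C t} {b : Module.Basis (BIdx C) ℂ (DH k C t)}
    (hb : ∀ i : BIdx C, b i = DH.of k t i.1.1 * KFam i.2.1 * KFamStar i.2.2)
    (i p q : BIdx C) :
    comul k t χ KFam KFamStar b (b i) (p, q) = if p.2 = i.2 ∧ q.2 = i.2 then
      coCoeff t χ (Quotient.out i.1.1) (Quotient.out p.1.1) (Quotient.out q.1.1) else 0 := by
  obtain ⟨L, α, β⟩ := i
  rw [comul, Module.Basis.constr_basis, ctensorMul]
  have key : ∀ m : IsoCP C × IsoCP C,
      comulE0 t χ (Finsupp.single L.1 1) m *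
        ctmul b (DH.of k t m.1 * KFam α * KFamStar β) (DH.of k t m.2 * KFam α * KFamStar β)
          (p, q) = if m = (p.1.1, q.1.1) ∧ p.2 = (α, β) ∧ q.2 = (α, β) then
        coCoeff t χ (Quotient.out L.1) (Quotient.out p.1.1) (Quotient.out q.1.1) else 0 := by
    rintro ⟨x, y⟩
    rw [comulE0_single]
    by_cases h0 : coCoeff t χ (Quotient.out L.1) (Quotient.out x) (Quotient.out y) = 0
    · rw [h0, zero_mul]
      split_ifs with h
      · obtain ⟨h, -⟩ := h
        rw [Prod.mk.injEq] at h
        rw [← h.1, ← h.2, h0]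
      · rfl
    · obtain ⟨s⟩ := nonempty_extn_of_coCoeff_ne_zero hfin h0
      have hx : IsMinimal (Quotient.out x) := L.isMinimal_out.quotient hher s
      have hy : IsMinimal (Quotient.out y) := L.isMinimal_out.sub hher s
      let X : MinIso C := ⟨x, _, isoClass_out x, hx⟩
      let Y : MinIso C := ⟨y, _, isoClass_out y, hy⟩
      have hX : DH.of k t x * KFam α * KFamStar β = b (X, α, β) := (hb (X, α, β)).symm
      have hY : DH.of k t y * KFam α * KFamStar β = b (Y, α, β) := (hb (Y, α, β)).symm
      simp only [ctmul, hX, hY, Module.Basis.repr_self]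
      by_cases h : (x, y) = (p.1.1, q.1.1) ∧ p.2 = (α, β) ∧ q.2 = (α, β)
      · rw [if_pos h]
        obtain ⟨h1, h2, h3⟩ := h
        rw [Prod.mk.injEq] at h1
        have e1 : (X, α, β) = p := Prod.ext (Subtype.ext h1.1) h2.symm
        have e2 : (Y, α, β) = q := Prod.ext (Subtype.ext h1.2) h3.symm
        rw [e1, e2, Finsupp.single_eq_same, Finsupp.single_eq_same, ← h1.1, ← h1.2]
        ring
      · rw [if_neg h]
        by_cases e1 : (X, α, β) = p
        · have e2 : (Y, α, β) ≠ q := by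
            intro e2
            subst e1 e2
            exact h ⟨rfl, rfl, rfl⟩
          rw [Finsupp.single_eq_of_ne e2.symm]
          ring
        · rw [Finsupp.single_eq_of_ne (Ne.symm e1)]
          ring
  rw [finsum_congr key, finsum_eq_single _ (p.1.1, q.1.1) (fun m hm => if_neg fun h => hm h.1)]
  simp

/-- Sums over the part of the index set with fixed `α` and `β`. -/
theorem finsum_bIdx_eq {F : BIdx C → ℂ} {G : IsoCP C → ℂ} (γ : K0 C × K0 C)
    (h₁ : ∀ X : MinIso C, F (X, γ) = G X.1) (h₂ : ∀ m : BIdx C, m.2 ≠ γ → F m = 0)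
    (h₃ : ∀ x, G x ≠ 0 → IsMinimal (Quotient.out x)) : ∑ᶠ m, F m = ∑ᶠ x, G x := by
  have hF : Function.support F ⊆ Set.range (fun X : MinIso C => ((X, γ) : BIdx C)) := by
    rintro ⟨X, γ'⟩ hm
    refine ⟨X, ?_⟩
    by_contra h
    refine hm (h₂ _ fun h' => h ?_)
    dsimp only at h'
    rw [h']
  have hG : Function.support G ⊆ Set.range (fun X : MinIso C => X.1) := by
    intro x hx
    exact ⟨⟨x, _, isoClass_out x, h₃ x hx⟩, rfl⟩
  rw [← finsum_mem_univ F, ← finsum_mem_inter_support, Set.univ_inter,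
    ← Set.inter_eq_right.2 hF, finsum_mem_inter_support, finsum_mem_range (fun X Y h => by
      simpa using h)]
  rw [← finsum_mem_univ G, ← finsum_mem_inter_support, Set.univ_inter,
    ← Set.inter_eq_right.2 hG, finsum_mem_inter_support,
    finsum_mem_range Subtype.val_injective]
  exact finsum_congr h₁

/-- The pair `(α, β)` of `m` is dictated by `i`, and its minimal part is one of the finitely many
middle terms of extensions. -/
theorem comul_finite (hfin : ∀ X Y : C, Finite (X ⟶ Y))
    (hher : ∀ X : C, HasProjectiveDimensionLE X 1) (t : ℂ) (χ : IsoCP C → IsoCP C → ℂ)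
    {KFam KFamStar : K0 C → DH k C t} {b : Module.Basis (BIdx C) ℂ (DH k C t)}
    (hb : ∀ i : BIdx C, b i = DH.of k t i.1.1 * KFam i.2.1 * KFamStar i.2.2) (i j : BIdx C) :
    {m : BIdx C | comul k t χ KFam KFamStar b (b m) (i, j) ≠ 0}.Finite := by
  have key : ∀ m ∈ {m : BIdx C | comul k t χ KFam KFamStar b (b m) (i, j) ≠ 0}, i.2 = m.2 ∧
      Nonempty (Extn (Quotient.out i.1.1) (Quotient.out j.1.1) (Quotient.out m.1.1)) := by
    intro m hm
    rw [Set.mem_ofPred_eq, comul_basis_apply hfin hher t χ hb] at hm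
    have h : i.2 = m.2 ∧ j.2 = m.2 := by
      by_contra h
      exact hm (if_neg h)
    rw [if_pos h] at hm
    exact ⟨h.1, nonempty_extn_of_coCoeff_ne_zero hfin hm⟩
  refine Set.Finite.of_injOn (f := fun m : BIdx C => m.1.1) (fun m hm => ?_)
    (fun m hm m' hm' h => ?_) (finite_middle hfin (Quotient.out i.1.1) (Quotient.out j.1.1))
  · obtain ⟨s⟩ := (key m hm).2
    exact ⟨Quotient.mk _ s⟩
  · exact Prod.ext (Subtype.ext h) ((key m hm).1.symm.trans (key m' hm').1)

theorem comul_apply_eq_zero (hfin : ∀ X Y : C, Finite (X ⟶ Y))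
    (hher : ∀ X : C, HasProjectiveDimensionLE X 1) (t : ℂ) (χ : IsoCP C → IsoCP C → ℂ)
    {KFam KFamStar : K0 C → DH k C t} {b : Module.Basis (BIdx C) ℂ (DH k C t)}
    (hb : ∀ i : BIdx C, b i = DH.of k t i.1.1 * KFam i.2.1 * KFamStar i.2.2) {m l : BIdx C}
    (h : m.2 ≠ l.2) (x : DH k C t) : comul k t χ KFam KFamStar b x (m, l) = 0 := by
  have : (LinearMap.proj (m, l)).comp (comul k t χ KFam KFamStar b) = 0 := by
    refine b.ext fun i => ?_
    change comul k t χ KFam KFamStar b (b i) (m, l) = 0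
    rw [comul_basis_apply hfin hher t χ hb, if_neg]
    exact fun h' => h (h'.1.trans h'.2.symm)
  exact LinearMap.congr_fun this x

/-- By finiteness each coordinate of either side is a finite combination of linear functionals of
`x`, so comparison on the basis suffices. -/
theorem isTopCoassoc_of_basis {ι : Type*} {V : Type*} [AddCommGroup V] [Module ℂ V]
    (b : Module.Basis ι ℂ V) (Δ : V →ₗ[ℂ] CTensor ι)
    (hfinite : ∀ i j : ι, {m : ι | Δ (b m) (i, j) ≠ 0}.Finite)
    (h : ∀ n i j l : ι, ∑ᶠ m : ι, Δ (b n) (m, l) * Δ (b m) (i, j) =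
      ∑ᶠ m : ι, Δ (b n) (i, m) * Δ (b m) (j, l)) : IsTopCoassoc b Δ where
  finite := hfinite
  coassoc x i j l := by
    have key : ∀ (i j : ι) (p : ι → ι × ι), ∃ A : V →ₗ[ℂ] ℂ,
        ∀ x, ∑ᶠ m : ι, Δ x (p m) * Δ (b m) (i, j) = A x := by
      intro i j p
      refine ⟨∑ m ∈ (hfinite i j).toFinset, Δ (b m) (i, j) • (LinearMap.proj (p m)).comp Δ,
        fun x => ?_⟩
      rw [finsum_eq_sum_of_support_subset (s := (hfinite i j).toFinset), LinearMap.sum_apply]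
      · exact Finset.sum_congr rfl fun m _ => mul_comm _ _
      · intro m hm
        rw [Set.Finite.coe_toFinset]
        exact right_ne_zero_of_mul hm
    obtain ⟨A, hA⟩ := key i j (fun m => (m, l))
    obtain ⟨B, hB⟩ := key j l (fun m => (i, m))
    rw [hA, hB]
    refine LinearMap.congr_fun (b.ext fun n => ?_) x
    rw [← hA, ← hB, h]

theorem comul_isTopCoassoc (hfin : ∀ X Y : C, Finite (X ⟶ Y))
    (hher : ∀ X : C, HasProjectiveDimensionLE X 1) {t : ℂ} (ht : t ≠ 0)
    {χ : IsoCP C → IsoCP C → ℂ} (hχ : IsAdditiveChi χ)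
    {KFam KFamStar : K0 C → DH k C t} {b : Module.Basis (BIdx C) ℂ (DH k C t)}
    (hb : ∀ i : BIdx C, b i = DH.of k t i.1.1 * KFam i.2.1 * KFamStar i.2.2) :
    IsTopCoassoc b (comul k t χ KFam KFamStar b) := by
  classical
  refine isTopCoassoc_of_basis b _ (comul_finite hfin hher t χ hb) fun n i j l => ?_
  simp only [comul_basis_apply hfin hher t χ hb]
  obtain ⟨L, γ⟩ := n
  dsimp only
  -- If the three pairs agree with that of the argument, the claim is coassociativity for complexes;
  -- the sum over minimal classes is the sum over all classes, since no others contribute. Otherwise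
  -- every term on both sides vanishes.
  by_cases h : i.2 = γ ∧ j.2 = γ ∧ l.2 = γ
  · obtain ⟨h1, h2, h3⟩ := h
    rw [finsum_bIdx_eq (G := fun x =>
        coCoeff t χ (Quotient.out L.1) (Quotient.out x) (Quotient.out l.1.1) *
        coCoeff t χ (Quotient.out x) (Quotient.out i.1.1) (Quotient.out j.1.1)) γ
        (fun X => by simp [h1, h2, h3]) (fun m hm => by simp [hm]),
      finsum_bIdx_eq (G := fun x =>
        coCoeff t χ (Quotient.out L.1) (Quotient.out i.1.1) (Quotient.out x) *
        coCoeff t χ (Quotient.out x) (Quotient.out j.1.1) (Quotient.out l.1.1)) γ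
        (fun X => by simp [h1, h2, h3]) (fun m hm => by simp [hm])]
    · exact finsum_coCoeff_mul hfin ht hχ _ _ _ _
    · intro x hx
      obtain ⟨s⟩ := nonempty_extn_of_coCoeff_ne_zero hfin (left_ne_zero_of_mul hx)
      exact L.isMinimal_out.sub hher s
    · intro x hx
      obtain ⟨s⟩ := nonempty_extn_of_coCoeff_ne_zero hfin (left_ne_zero_of_mul hx)
      exact L.isMinimal_out.quotient hher s
  · rw [finsum_eq_zero_of_forall_eq_zero, finsum_eq_zero_of_forall_eq_zero]
    · intro m
      split_ifs with h1 h2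
      · exact absurd ⟨h1.1, h2.1.trans h1.2, h2.2.trans h1.2⟩ h
      all_goals simp
    · intro m
      split_ifs with h1 h2
      · exact absurd ⟨h2.1.trans h1.1, h2.2.trans h1.1, h1.2⟩ h
      all_goals simp

/-! ### The counit -/

theorem extnCard_of_isZero_left {Z N L : CP C} (hZ : IsZero Z.obj) :
    extnCard Z N L = (Nat.card (N.obj ≅ L.obj) : ℂ) := by
  refine congrArg Nat.cast (Nat.card_congr (Equiv.symm (Equiv.ofBijective
    (fun e : N.obj ≅ L.obj => (⟨e.hom, 0, comp_zero,
      { exact := (ShortComplex.exact_iff_epi _ rfl).2 inferInstance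
        mono_f := inferInstance
        epi_g := ⟨fun _ _ _ => hZ.eq_of_src _ _⟩ }⟩ : Extn Z N L)) ⟨?_, ?_⟩)))
  · intro e e' h
    exact Iso.ext (congrArg Extn.i h)
  · intro s
    have : Mono s.i := s.exact.mono_f
    have : Epi s.i := (ShortComplex.exact_iff_epi _ (hZ.eq_of_tgt _ _)).1 s.exact.exact
    have : IsIso s.i := isIso_of_mono_of_epi _
    exact ⟨asIso s.i, Extn.ext_of rfl (hZ.eq_of_tgt _ _)⟩

theorem extnCard_of_isZero_right {M Z L : CP C} (hZ : IsZero Z.obj) :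
    extnCard M Z L = (Nat.card (L.obj ≅ M.obj) : ℂ) := by
  refine congrArg Nat.cast (Nat.card_congr (Equiv.symm (Equiv.ofBijective
    (fun e : L.obj ≅ M.obj => (⟨0, e.hom, zero_comp,
      { exact := (ShortComplex.exact_iff_mono _ rfl).2 inferInstance
        mono_f := ⟨fun _ _ _ => hZ.eq_of_tgt _ _⟩
        epi_g := inferInstance }⟩ : Extn M Z L)) ⟨?_, ?_⟩)))
  · intro e e' h
    exact Iso.ext (congrArg Extn.p h)
  · intro s
    have : Epi s.p := s.exact.epi_g
    have : Mono s.p := (ShortComplex.exact_iff_mono _ (hZ.eq_of_src _ _)).1 s.exact.exact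
    have : IsIso s.p := isIso_of_mono_of_epi _
    exact ⟨asIso s.p, Extn.ext_of (hZ.eq_of_src _ _) rfl⟩

theorem autCard_of_isZero {Z : CP C} (hZ : IsZero Z.obj) : autCard Z = 1 := by
  have : Nat.card (Aut Z.obj) = 1 := by
    rw [Nat.card_eq_one_iff_unique]
    exact ⟨⟨fun e e' => Iso.ext (hZ.eq_of_src _ _)⟩, ⟨Iso.refl _⟩⟩
  rw [autCard, this, Nat.cast_one]

theorem isZero_homology_of_isZero {Z : Cpx C} (hZ : IsZero Z) (i : ZMod 2) :
    IsZero (Z.homology i) :=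
  (HomologicalComplex.exactAt_iff_isZero_homology _ _).1 (acyclic_of_isZero hZ i)

open Classical in
theorem coCoeff_zero_left (hfin : ∀ X Y : C, Finite (X ⟶ Y)) (t : ℂ)
    {χ : IsoCP C → IsoCP C → ℂ} (hχ : IsAdditiveChi χ)
    (h0 : χ (isoClass (zeroCP C)) (isoClass (zeroCP C)) = 0) (x y : IsoCP C) :
    coCoeff t χ (Quotient.out x) (Quotient.out (isoClass (zeroCP C))) (Quotient.out y) =
      if x = y then 1 else 0 := by
  obtain ⟨e⟩ := nonempty_iso_out (zeroCP C)
  have hZ : IsZero (Quotient.out (isoClass (zeroCP C))).obj := isZero_zeroCP.of_iso e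
  rw [coCoeff_eq hfin, if_pos (show OrthHomology _ _ from
      fun i hi => absurd (isZero_homology_of_isZero hZ i) hi),
    isoClass_out, chi_zero_left hχ, h0, Complex.cpow_zero, one_mul, extnCard_of_isZero_left hZ,
    autCard_of_isZero hZ, one_mul]
  split_ifs with h
  · subst h
    exact div_self (autCard_ne_zero hfin _)
  · have : IsEmpty ((Quotient.out y).obj ≅ (Quotient.out x).obj) := ⟨fun e => h (by
      rw [← isoClass_out x, ← isoClass_out y, isoClass_eq_iff]
      exact ⟨e.symm⟩)⟩
    simp

open Classical in
theorem coCoeff_zero_right (hfin : ∀ X Y : C, Finite (X ⟶ Y)) (t : ℂ)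
    {χ : IsoCP C → IsoCP C → ℂ} (hχ : IsAdditiveChi χ)
    (h0 : χ (isoClass (zeroCP C)) (isoClass (zeroCP C)) = 0) (x y : IsoCP C) :
    coCoeff t χ (Quotient.out x) (Quotient.out y) (Quotient.out (isoClass (zeroCP C))) =
      if x = y then 1 else 0 := by
  obtain ⟨e⟩ := nonempty_iso_out (zeroCP C)
  have hZ : IsZero (Quotient.out (isoClass (zeroCP C))).obj := isZero_zeroCP.of_iso e
  rw [coCoeff_eq hfin, if_pos (show OrthHomology _ _ from fun i _ => isZero_homology_of_isZero hZ _),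
    isoClass_out (isoClass (zeroCP C)), chi_zero_right hχ, h0, Complex.cpow_zero, one_mul,
    extnCard_of_isZero_right hZ, autCard_of_isZero hZ, mul_one]
  split_ifs with h
  · subst h
    exact div_self (autCard_ne_zero hfin _)
  · have : IsEmpty ((Quotient.out x).obj ≅ (Quotient.out y).obj) := ⟨fun e => h (by
      rw [← isoClass_out x, ← isoClass_out y, isoClass_eq_iff]
      exact ⟨e⟩)⟩
    simp

open Classical in
theorem counit_basis (t : ℂ) (b : Module.Basis (BIdx C) ℂ (DH k C t)) (i : BIdx C) :
    counit k t b (b i) = if i.1 = MinIso.zero C then 1 else 0 := by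
  rw [counit, Module.Basis.constr_basis]
  simp only [MinIso.zero, Subtype.ext_iff]

theorem comul_isTopCounit (hfin : ∀ X Y : C, Finite (X ⟶ Y))
    (hher : ∀ X : C, HasProjectiveDimensionLE X 1) (t : ℂ)
    {χ : IsoCP C → IsoCP C → ℂ} (hχ : IsAdditiveChi χ)
    {KFam KFamStar : K0 C → DH k C t} {b : Module.Basis (BIdx C) ℂ (DH k C t)}
    (hb : ∀ i : BIdx C, b i = DH.of k t i.1.1 * KFam i.2.1 * KFamStar i.2.2)
    (h0 : χ (isoClass (zeroCP C)) (isoClass (zeroCP C)) = 0) :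
    IsTopCounit b (comul k t χ KFam KFamStar b) (counit k t b) := by
  classical
  -- The counit selects the zero complex and the coproduct forces the pair `(α, β)` of `m` to be
  -- that of `j`, so at most one index contributes.
  have hl : ∀ x (j m : BIdx C), m ≠ (MinIso.zero C, j.2) →
      counit k t b (b m) * comul k t χ KFam KFamStar b x (m, j) = 0 := by
    intro x j m hm
    rw [counit_basis]
    split_ifs with h
    · have h2 : m.2 ≠ j.2 := fun h' => hm (Prod.ext h h')
      rw [comul_apply_eq_zero hfin hher t χ hb h2, mul_zero]
    · exact zero_mul _
  have hr : ∀ x (i m : BIdx C), m ≠ (MinIso.zero C, i.2) →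
      comul k t χ KFam KFamStar b x (i, m) * counit k t b (b m) = 0 := by
    intro x i m hm
    rw [counit_basis]
    split_ifs with h
    · have h2 : i.2 ≠ m.2 := fun h' => hm (Prod.ext h h'.symm)
      rw [comul_apply_eq_zero hfin hher t χ hb h2, zero_mul]
    · exact mul_zero _
  refine ⟨fun x j => ?_, fun x i => ?_, fun x j => ?_, fun x i => ?_⟩
  · exact (Set.finite_singleton (MinIso.zero C, j.2)).subset fun m hm => by
      by_contra h
      exact hm (hl x j m h)
  · exact (Set.finite_singleton (MinIso.zero C, i.2)).subset fun m hm => by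
      by_contra h
      exact hm (hr x i m h)
  · rw [finsum_eq_single _ _ (hl x j), counit_basis, if_pos rfl, one_mul]
    have : (LinearMap.proj ((MinIso.zero C, j.2), j)).comp (comul k t χ KFam KFamStar b) =
        b.coord j := by
      refine b.ext fun i => ?_
      change comul k t χ KFam KFamStar b (b i) ((MinIso.zero C, j.2), j) = b.repr (b i) j
      rw [comul_basis_apply hfin hher t χ hb, b.repr_self, Finsupp.single_apply]
      by_cases h : i = j
      · subst h
        rw [if_pos ⟨rfl, rfl⟩, if_pos rfl]
        exact (coCoeff_zero_left hfin t hχ h0 _ _).trans (if_pos rfl)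
      · rw [if_neg h]
        split_ifs with h'
        · exact (coCoeff_zero_left hfin t hχ h0 _ _).trans
            (if_neg fun e => h (Prod.ext (Subtype.ext e) h'.2.symm))
        · rfl
    exact LinearMap.congr_fun this x
  · rw [finsum_eq_single _ _ (hr x i), counit_basis, if_pos rfl, mul_one]
    have : (LinearMap.proj (i, (MinIso.zero C, i.2))).comp (comul k t χ KFam KFamStar b) =
        b.coord i := by
      refine b.ext fun j => ?_
      change comul k t χ KFam KFamStar b (b j) (i, (MinIso.zero C, i.2)) = b.repr (b j) i
      rw [comul_basis_apply hfin hher t χ hb, b.repr_self, Finsupp.single_apply]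
      by_cases h : j = i
      · subst h
        rw [if_pos ⟨rfl, rfl⟩, if_pos rfl]
        exact (coCoeff_zero_right hfin t hχ h0 _ _).trans (if_pos rfl)
      · rw [if_neg h]
        split_ifs with h'
        · exact (coCoeff_zero_right hfin t hχ h0 _ _).trans
            (if_neg fun e => h (Prod.ext (Subtype.ext e) h'.1.symm))
        · rfl
    exact LinearMap.congr_fun this x

end CoproductBasis

/-! ### Homomorphisms on the Grothendieck group -/

section GrothendieckGroup

variable {C : Type u} [Category.{v} C] [Abelian C]

/-- Additive functions on objects extend to the Grothendieck group. -/
def K0.lift {G : Type*} [AddCommGroup G] (f : C → G)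
    (hf : ∀ S : ShortComplex C, S.ShortExact → f S.X₂ = f S.X₁ + f S.X₃) : K0 C →+ G :=
  QuotientAddGroup.lift (K0Relations C) (FreeAbelianGroup.lift f) (by
    unfold K0Relations
    rw [AddSubgroup.closure_le]
    rintro x ⟨S, hS, rfl⟩
    simp [hf S hS])

theorem K0.lift_cl {G : Type*} [AddCommGroup G] (f : C → G)
    (hf : ∀ S : ShortComplex C, S.ShortExact → f S.X₂ = f S.X₁ + f S.X₃) (X : C) :
    K0.lift f hf (K0.cl X) = f X :=
  FreeAbelianGroup.lift_apply_of f X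

theorem shortExact_of_isPullback {A P Q R X : C} {a : A ⟶ P} {p : P ⟶ X} {q : Q ⟶ X}
    {w : a ≫ p = 0} (h : (ShortComplex.mk a p w).ShortExact) {f : R ⟶ P} {g : R ⟶ Q}
    (sq : IsPullback f g p q) :
    ∃ (i : A ⟶ R) (w' : i ≫ g = 0), (ShortComplex.mk i g w').ShortExact := by
  have := h.mono_f
  have := h.epi_g
  have hi : sq.lift a 0 (by simp [w]) ≫ f = a := sq.lift_fst _ _ _
  refine ⟨sq.lift a 0 (by simp [w]), sq.lift_snd _ _ _, ?_⟩
  have hm : Mono (sq.lift a 0 (by simp [w])) := by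
    have : Mono (sq.lift a 0 (by simp [w]) ≫ f) := by rw [hi]; infer_instance
    exact mono_of_mono _ f
  have he : Epi g := by
    rw [epi_iff_surjective_up_to_refinements]
    intro T y
    obtain ⟨T', π, hπ, x, hx⟩ := surjective_up_to_refinements_of_epi p (y ≫ q)
    exact ⟨T', π, hπ, sq.lift x (π ≫ y) (by simp [hx]), by simp⟩
  refine { exact := ?_, mono_f := hm, epi_g := he }
  rw [ShortComplex.exact_iff_exact_up_to_refinements]
  intro T (x : T ⟶ R) (hx : x ≫ g = 0)
  have hx' : (x ≫ f) ≫ p = 0 := by rw [Category.assoc, sq.w, reassoc_of% hx, zero_comp]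
  refine ⟨T, 𝟙 T, inferInstance, h.exact.lift (x ≫ f) hx', ?_⟩
  apply sq.hom_ext
  · simp only [Category.id_comp, Category.assoc]
    rw [hi]
    exact (h.exact.lift_f (x ≫ f) hx').symm
  · simp [hx]

/-- Every object has a projective resolution `0 ⟶ A ⟶ P ⟶ X ⟶ 0`, and the value at `X` must be `φ P
- φ A`. Schanuel's lemma makes this independent of the resolution. -/
theorem exists_hom_of_additive_on_projectives [EnoughProjectives C]
    (hher : ∀ X : C, HasProjectiveDimensionLE X 1) {G : Type*} [AddCommGroup G] (φ : C → G)
    (hadd : ∀ P Q : C, Projective P → Projective Q → φ (P ⊞ Q) = φ P + φ Q)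
    (hiso : ∀ P Q : C, Projective P → (P ≅ Q) → φ P = φ Q) :
    ∃ Φ : K0 C →+ G, ∀ P : C, Projective P → Φ (K0.cl P) = φ P := by
  have hses : ∀ {S : ShortComplex C}, S.ShortExact → Projective S.X₁ → Projective S.X₃ →
      φ S.X₂ = φ S.X₁ + φ S.X₃ := by
    intro S hS h1 h3
    have e := hS.splittingOfProjective.isoBinaryBiproduct
    rw [← hadd _ _ h1 h3, hiso _ _ inferInstance e.symm]
  have schanuel : ∀ {A P B Q X : C} {a : A ⟶ P} {p : P ⟶ X} {b : B ⟶ Q} {q : Q ⟶ X}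
      {w : a ≫ p = 0} {w' : b ≫ q = 0}, (ShortComplex.mk a p w).ShortExact →
      (ShortComplex.mk b q w').ShortExact → Projective P → Projective Q →
      φ P - φ A = φ Q - φ B := by
    intro A P B Q X a p b q w w' h h' hP hQ
    have := h.mono_f
    have := h'.mono_f
    have hA : Projective A := projective_of_mono hher a hP
    have hB : Projective B := projective_of_mono hher b hQ
    -- The pullback of `P` and `Q` over `X` is an extension of `Q` by `A` and one of `P` by `B`, and
    -- both split.
    have sq := IsPullback.of_hasPullback p q
    obtain ⟨_, _, h1⟩ := shortExact_of_isPullback h sq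
    obtain ⟨_, _, h2⟩ := shortExact_of_isPullback h' sq.flip
    have e1 := hses h1 hA hQ
    have e2 := hses h2 hB hP
    dsimp only at e1 e2
    rw [sub_eq_sub_iff_add_eq_add, add_comm (φ Q), ← e1, add_comm, ← e2]
  let f : C → G := fun X => φ (Projective.over X) - φ (kernel (Projective.π X))
  have hf : ∀ {A P X : C} {a : A ⟶ P} {p : P ⟶ X} {w : a ≫ p = 0},
      (ShortComplex.mk a p w).ShortExact → Projective P → f X = φ P - φ A := by
    intro A P X a p w h hP
    have h' : (ShortComplex.mk (kernel.ι (Projective.π X)) (Projective.π X)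
      (kernel.condition _)).ShortExact := { exact := ShortComplex.exact_kernel _ }
    exact schanuel h' h inferInstance hP
  refine ⟨K0.lift f fun S hS => ?_, fun P hP => ?_⟩
  · have h' : (ShortComplex.mk (kernel.ι (Projective.π S.X₂)) (Projective.π S.X₂)
      (kernel.condition _)).ShortExact := { exact := ShortComplex.exact_kernel _ }
    have hS' : (ShortComplex.mk S.f S.g S.zero).ShortExact := hS
    -- Let `P ⟶ X₂` be the chosen projective cover map with kernel `A`, and let `Y` be the kernel of
    -- `P ⟶ X₃`. Then `A ⟶ Y` resolves `X₁` and `Y ⟶ P` resolves `X₃`, so the alternating values add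
    -- up.
    obtain ⟨Y, i₀, p₀, j₀, w₀, w₁, h₀, h₁, -, -⟩ := exists_kernel_flag h' hS'
    have := h₁.mono_f
    have hY : Projective Y := projective_of_mono hher j₀ inferInstance
    rw [hf h' inferInstance, hf h₀ hY, hf h₁ inferInstance]
    abel
  · have h0 : φ 0 = 0 := by
      have h1 := hadd 0 0 inferInstance inferInstance
      rw [hiso (0 ⊞ 0 : C) 0 inferInstance (isoBiprodZero (isZero_zero C)).symm] at h1
      simpa using h1
    have hS : (ShortComplex.mk (0 : 0 ⟶ P) (𝟙 P) (by simp)).ShortExact :=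
      { exact := (ShortComplex.exact_iff_mono _ rfl).2 inferInstance
        mono_f := ⟨fun _ _ _ => (isZero_zero C).eq_of_tgt _ _⟩
        epi_g := inferInstance }
    rw [K0.lift_cl, hf hS hP, h0, sub_zero]

theorem K0.exists_eq_sub [EnoughProjectives C] (hher : ∀ X : C, HasProjectiveDimensionLE X 1)
    (α : K0 C) : ∃ P Q : C, Projective P ∧ Projective Q ∧ α = K0.cl P - K0.cl Q := by
  have hcl : ∀ X : C, ∃ P Q : C, Projective P ∧ Projective Q ∧ K0.cl X = K0.cl P - K0.cl Q := by
    intro X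
    have h : (ShortComplex.mk (kernel.ι (Projective.π X)) (Projective.π X)
      (kernel.condition _)).ShortExact := { exact := ShortComplex.exact_kernel _ }
    refine ⟨Projective.over X, _, inferInstance, projective_of_mono hher (kernel.ι (Projective.π X)) inferInstance,
      ?_⟩
    have := K0.cl_of_shortExact h
    dsimp only at this
    rw [this]
    abel
  obtain ⟨x, rfl⟩ := QuotientAddGroup.mk_surjective α
  induction x using FreeAbelianGroup.induction_on with
  | zero => exact ⟨0, 0, inferInstance, inferInstance, by simp⟩
  | of X => exact hcl X
  | neg X h =>
    obtain ⟨P, Q, hP, hQ, h⟩ := h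
    exact ⟨Q, P, hQ, hP, by rw [QuotientAddGroup.mk_neg, h, neg_sub]⟩
  | add x y hx hy =>
    obtain ⟨P, Q, hP, hQ, h⟩ := hx
    obtain ⟨P', Q', hP', hQ', h'⟩ := hy
    refine ⟨P ⊞ P', Q ⊞ Q', inferInstance, inferInstance, ?_⟩
    rw [QuotientAddGroup.mk_add, h, h', K0.cl_biprod, K0.cl_biprod]
    abel

end GrothendieckGroup

/-! ### Dimensions of morphism spaces -/

section HomRank

variable (k : Type w) [Field k] {C : Type u} [Category.{v} C] [Abelian C] [Linear k C]

theorem finrank_hom_add (hfin : ∀ X Y : C, Finite (X ⟶ Y)) (P : C) (hP : Projective P)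
    {S : ShortComplex C} (hS : S.ShortExact) :
    Module.finrank k (P ⟶ S.X₂) = Module.finrank k (P ⟶ S.X₁) + Module.finrank k (P ⟶ S.X₃) := by
  have := hS.mono_f
  have := hS.epi_g
  have : Module.Finite k (P ⟶ S.X₂) := Module.Finite.of_finite
  let f : (P ⟶ S.X₁) →ₗ[k] (P ⟶ S.X₂) := Linear.rightComp k P S.f
  let g : (P ⟶ S.X₂) →ₗ[k] (P ⟶ S.X₃) := Linear.rightComp k P S.g
  have hf : Function.Injective f := fun x y h => (cancel_mono S.f).1 h
  have hg : Function.Surjective g := fun x =>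
    ⟨Projective.factorThru x S.g, Projective.factorThru_comp x S.g⟩
  have hfg : LinearMap.ker g = LinearMap.range f := by
    ext x
    constructor
    · intro hx
      exact ⟨hS.exact.lift x hx, hS.exact.lift_f _ _⟩
    · rintro ⟨y, rfl⟩
      change (y ≫ S.f) ≫ S.g = 0
      simp
  have h := g.finrank_range_add_finrank_ker
  rw [hfg, LinearMap.finrank_range_of_inj hf, LinearMap.range_eq_top.2 hg, finrank_top] at h
  omega

/-- The dimension of `Hom(P, -)`, for `P` projective, as a function on the Grothendieck group. -/
def homRank (hfin : ∀ X Y : C, Finite (X ⟶ Y)) (P : C) (hP : Projective P) : K0 C →+ ℤ :=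
  K0.lift (fun X => (Module.finrank k (P ⟶ X) : ℤ))
    (fun S hS => by rw [finrank_hom_add k hfin P hP hS, Nat.cast_add])

theorem homRank_cl (hfin : ∀ X Y : C, Finite (X ⟶ Y)) (P : C) (hP : Projective P) (X : C) :
    homRank k hfin P hP (K0.cl X) = Module.finrank k (P ⟶ X) :=
  K0.lift_cl _ _ X

/-- Higher `Ext` out of a projective vanishes, so the twist involves dimensions of morphism spaces
only. -/
theorem eulerForm_eq (P X : C) (hP : Projective P) :
    eulerForm k P X = Module.finrank k (P ⟶ X) := by
  have : HasExt.{max u v} C := HasExt.standard C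
  unfold eulerForm
  rw [finsum_eq_single _ 0]
  · rw [pow_zero, one_mul, (Abelian.Ext.linearEquiv₀ (R := k) (X := P) (Y := X)).finrank_eq]
  · intro i hi
    obtain ⟨j, rfl⟩ := Nat.exists_eq_succ_of_ne_zero hi
    have : Subsingleton (Abelian.Ext.{max u v} P X (j + 1)) :=
      Abelian.Ext.subsingleton_of_projective P X j
    rw [Module.finrank_zero_of_subsingleton]
    simp

theorem card_hom_eq [Finite k] (hfin : ∀ X Y : C, Finite (X ⟶ Y)) {t : ℂ}
    (ht : t ^ 2 = (Nat.card k : ℂ)) (P X : C) :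
    (Nat.card (P ⟶ X) : ℂ) = t ^ (2 * (Module.finrank k (P ⟶ X) : ℤ)) := by
  have : Module.Finite k (P ⟶ X) := Module.Finite.of_finite
  rw [Module.natCard_eq_pow_finrank (K := k), Nat.cast_pow, ← ht, ← pow_mul]
  exact_mod_cast rfl

theorem finrank_hom_biprod_left (hfin : ∀ X Y : C, Finite (X ⟶ Y)) (P Q X : C) :
    Module.finrank k (P ⊞ Q ⟶ X) = Module.finrank k (P ⟶ X) + Module.finrank k (Q ⟶ X) := by
  have : Module.Finite k (P ⟶ X) := Module.Finite.of_finite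
  have : Module.Finite k (Q ⟶ X) := Module.Finite.of_finite
  rw [← Module.finrank_prod]
  exact LinearEquiv.finrank_eq
    { toFun := fun f => (biprod.inl ≫ f, biprod.inr ≫ f)
      invFun := fun g => biprod.desc g.1 g.2
      left_inv := fun f => by apply biprod.hom_ext' <;> simp
      right_inv := fun g => by simp
      map_add' := fun f g => by simp
      map_smul' := fun c f => by simp }

theorem finrank_hom_congr {P Q X Y : C} (e : P ≅ Q) (f : X ≅ Y) :
    Module.finrank k (P ⟶ X) = Module.finrank k (Q ⟶ Y) :=
  LinearEquiv.finrank_eq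
    { toFun := fun g => e.inv ≫ g ≫ f.hom
      invFun := fun g => e.hom ≫ g ≫ f.inv
      left_inv := fun g => by simp
      right_inv := fun g => by simp
      map_add' := fun f g => by simp
      map_smul' := fun c f => by simp }

end HomRank

/-! ### The twisted Hall algebra -/

section HallAlgebra

variable (k : Type w) [Field k] {C : Type u} [Category.{v} C] [Abelian C] [Linear k C]

theorem K0.hom_ext {G : Type*} [AddCommGroup G] {f g : K0 C →+ G}
    (h : ∀ X : C, f (K0.cl X) = g (K0.cl X)) : f = g := by
  exact QuotientAddGroup.addMonoidHom_ext _ (FreeAbelianGroup.lift_ext _ _ fun X => h X)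

theorem homRank_congr (hfin : ∀ X Y : C, Finite (X ⟶ Y)) {P Q : C} (e : P ≅ Q)
    (hP : Projective P) (hQ : Projective Q) : homRank k hfin P hP = homRank k hfin Q hQ :=
  K0.hom_ext fun X => by
    rw [homRank_cl, homRank_cl, finrank_hom_congr k e (Iso.refl X)]

theorem homRank_biprod (hfin : ∀ X Y : C, Finite (X ⟶ Y)) {P Q : C}
    (hP : Projective P) (hQ : Projective Q) (hPQ : Projective (P ⊞ Q)) :
    homRank k hfin (P ⊞ Q) hPQ = homRank k hfin P hP + homRank k hfin Q hQ :=
  K0.hom_ext fun X => by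
    rw [AddMonoidHom.add_apply, homRank_cl, homRank_cl, homRank_cl,
      finrank_hom_biprod_left k hfin, Nat.cast_add]

/-- The dimension of `Hom(M_i, -)` on the Grothendieck group. -/
def rankX (hfin : ∀ X Y : C, Finite (X ⟶ Y)) (M : CP C) (i : ZMod 2) : K0 C →+ ℤ :=
  homRank k hfin (M.obj.X i) (M.property i)

theorem rankX_cl (hfin : ∀ X Y : C, Finite (X ⟶ Y)) (M : CP C) (i : ZMod 2) (X : C) :
    rankX k hfin M i (K0.cl X) = Module.finrank k (M.obj.X i ⟶ X) :=
  homRank_cl k hfin _ _ X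

theorem rankX_congr (hfin : ∀ X Y : C, Finite (X ⟶ Y)) {M N : CP C} (e : M.obj ≅ N.obj)
    (i : ZMod 2) : rankX k hfin M i = rankX k hfin N i :=
  homRank_congr k hfin
    ((HomologicalComplex.eval C (ComplexShape.up (ZMod 2)) i).mapIso e) _ _

theorem Extn.rankX_eq (hfin : ∀ X Y : C, Finite (X ⟶ Y)) {M N L : CP C} (s : Extn M N L)
    (i : ZMod 2) : rankX k hfin L i = rankX k hfin N i + rankX k hfin M i := by
  obtain ⟨e⟩ := s.nonempty_iso_X i
  have := M.property i
  have := N.property i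
  exact (homRank_congr k hfin e _ inferInstance).trans (homRank_biprod k hfin _ _ _)

/-- The exponent `⟨M₀, N₀⟩ + ⟨M₁, N₁⟩` of the twist. -/
def twistExp (hfin : ∀ X Y : C, Finite (X ⟶ Y)) (M N : CP C) : ℤ :=
  rankX k hfin M 0 (K0.cl (N.obj.X 0)) + rankX k hfin M 1 (K0.cl (N.obj.X 1))

theorem eulerForm_add_eulerForm (hfin : ∀ X Y : C, Finite (X ⟶ Y)) (M N : CP C) :
    eulerForm k (M.obj.X 0) (N.obj.X 0) + eulerForm k (M.obj.X 1) (N.obj.X 1) =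
      twistExp k hfin M N := by
  rw [twistExp, rankX_cl, rankX_cl, eulerForm_eq k _ _ (M.property 0),
    eulerForm_eq k _ _ (M.property 1)]

theorem twCoeff_eq_zpow (hfin : ∀ X Y : C, Finite (X ⟶ Y)) (t : ℂ) (M N L : CP C) :
    twCoeff k t M N L = t ^ twistExp k hfin M N * (extnCard M N L / autCard L) := by
  rw [twCoeff_eq k hfin, eulerForm_add_eulerForm k hfin]

theorem cl_X_congr {M N : CP C} (e : M.obj ≅ N.obj) (i : ZMod 2) :
    K0.cl (M.obj.X i) = K0.cl (N.obj.X i) :=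
  K0.cl_of_iso ((HomologicalComplex.eval C (ComplexShape.up (ZMod 2)) i).mapIso e)

theorem twCoeff_congr (hfin : ∀ X Y : C, Finite (X ⟶ Y)) (t : ℂ) {M N L M' N' L' : CP C}
    (eM : M.obj ≅ M'.obj) (eN : N.obj ≅ N'.obj) (eL : L.obj ≅ L'.obj) :
    twCoeff k t M N L = twCoeff k t M' N' L' := by
  rw [twCoeff_eq_zpow k hfin, twCoeff_eq_zpow k hfin, extnCard_congr eM eN eL, autCard_congr eL,
    twistExp, twistExp, rankX_congr k hfin eM, rankX_congr k hfin eM,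
    cl_X_congr eN, cl_X_congr eN]

theorem nonempty_extn_of_twCoeff_ne_zero (hfin : ∀ X Y : C, Finite (X ⟶ Y)) {t : ℂ}
    {M N L : CP C} (h : twCoeff k t M N L ≠ 0) : Nonempty (Extn M N L) := by
  rw [← extnCard_ne_zero_iff hfin]
  intro h0
  rw [twCoeff_eq k hfin, h0] at h
  simp at h

/-- Associativity of the twisted Hall algebra, coordinatewise. -/
theorem finsum_twCoeff_mul (hfin : ∀ X Y : C, Finite (X ⟶ Y)) {t : ℂ} (ht : t ≠ 0)
    (P Q N L : CP C) :
    ∑ᶠ x : IsoCP C, twCoeff k t P Q (Quotient.out x) * twCoeff k t (Quotient.out x) N L =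
      ∑ᶠ y : IsoCP C, twCoeff k t Q N (Quotient.out y) * twCoeff k t P (Quotient.out y) L := by
  -- The twist is additive in both arguments along extensions, so both bracketings have the same
  -- total exponent.
  let κ : ℂ := t ^ (twistExp k hfin P Q + twistExp k hfin P N + twistExp k hfin Q N) /
    autCard L
  have hl : ∀ x : IsoCP C,
      twCoeff k t P Q (Quotient.out x) * twCoeff k t (Quotient.out x) N L =
      κ * (extnCard P Q (Quotient.out x) * extnCard (Quotient.out x) N L /
        autCard (Quotient.out x)) := by
    intro x
    rw [twCoeff_eq_zpow k hfin, twCoeff_eq_zpow k hfin]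
    by_cases he : Nonempty (Extn P Q (Quotient.out x))
    · obtain ⟨s⟩ := he
      have h : twistExp k hfin (Quotient.out x) N = twistExp k hfin P N + twistExp k hfin Q N := by
        simp only [twistExp, s.rankX_eq k hfin, AddMonoidHom.add_apply]
        ring
      simp only [κ]
      rw [h, add_assoc, zpow_add₀ ht (twistExp k hfin P Q)]
      ring
    · have h0 : extnCard P Q (Quotient.out x) = 0 := by
        by_contra h
        exact he ((extnCard_ne_zero_iff hfin).1 h)
      simp [h0]
  have hr : ∀ y : IsoCP C,
      twCoeff k t Q N (Quotient.out y) * twCoeff k t P (Quotient.out y) L =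
      κ * (extnCard Q N (Quotient.out y) * extnCard P (Quotient.out y) L /
        autCard (Quotient.out y)) := by
    intro y
    rw [twCoeff_eq_zpow k hfin, twCoeff_eq_zpow k hfin]
    by_cases he : Nonempty (Extn Q N (Quotient.out y))
    · obtain ⟨s⟩ := he
      have h : twistExp k hfin P (Quotient.out y) = twistExp k hfin P Q + twistExp k hfin P N := by
        simp only [twistExp, s.cl_X, map_add]
        ring
      simp only [κ]
      rw [h, add_comm _ (twistExp k hfin Q N), zpow_add₀ ht (twistExp k hfin Q N)]
      ring
    · have h0 : extnCard Q N (Quotient.out y) = 0 := by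
        by_contra h
        exact he ((extnCard_ne_zero_iff hfin).1 h)
      simp [h0]
  simp only [hl, hr, ← smul_eq_mul κ]
  rw [← smul_finsum, ← smul_finsum, sum_extnCard_mul hfin]

/-- The product of two basis elements of the twisted Hall algebra. -/
def hallMul (hfin : ∀ X Y : C, Finite (X ⟶ Y)) (t : ℂ) (x y : IsoCP C) : IsoCP C →₀ ℂ :=
  Finsupp.ofSupportFinite
    (fun z => twCoeff k t (Quotient.out x) (Quotient.out y) (Quotient.out z))
    ((finite_middle hfin (Quotient.out x) (Quotient.out y)).subset fun z hz => by
      obtain ⟨s⟩ := nonempty_extn_of_twCoeff_ne_zero k hfin hz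
      exact ⟨Quotient.mk _ s⟩)

theorem hallMul_apply (hfin : ∀ X Y : C, Finite (X ⟶ Y)) (t : ℂ) (x y z : IsoCP C) :
    hallMul k hfin t x y z = twCoeff k t (Quotient.out x) (Quotient.out y) (Quotient.out z) :=
  rfl

theorem linearCombination_apply_eq_finsum {α β : Type*} (f : α → β →₀ ℂ) (v : α →₀ ℂ) (b : β) :
    Finsupp.linearCombination ℂ f v b = ∑ᶠ a, v a * f a b := by
  rw [finsum_eq_sum_of_support_subset (s := v.support), Finsupp.linearCombination_apply,
    Finsupp.sum, Finsupp.finsetSum_apply]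
  · rfl
  · intro a ha
    rw [Finset.mem_coe, Finsupp.mem_support_iff]
    exact left_ne_zero_of_mul ha

/-- Associativity of the twisted Hall algebra. -/
theorem hallMul_assoc (hfin : ∀ X Y : C, Finite (X ⟶ Y)) {t : ℂ} (ht : t ≠ 0)
    (x y z : IsoCP C) :
    Finsupp.linearCombination ℂ (fun w => hallMul k hfin t w z) (hallMul k hfin t x y) =
      Finsupp.linearCombination ℂ (hallMul k hfin t x) (hallMul k hfin t y z) := by
  ext L
  rw [linearCombination_apply_eq_finsum, linearCombination_apply_eq_finsum]
  exact finsum_twCoeff_mul k hfin ht _ _ _ _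

/-! ### Products with acyclic complexes -/

/-- Both sequences are split, and the composite of their identifications with `N ⊞ M` is the
equivalence. -/
theorem extn_equiv_of_retraction {M N L : CP C} (s s' : Extn M N L) (r : L.obj ⟶ N.obj)
    (r' : L.obj ⟶ N.obj) (h : s.i ≫ r = 𝟙 _) (h' : s'.i ≫ r' = 𝟙 _) :
    Quotient.mk (extnSetoid M N L) s = Quotient.mk (extnSetoid M N L) s' := by
  let σ := ShortComplex.Splitting.ofExactOfRetraction _ s.exact.exact r h s.exact.epi_g
  let σ' := ShortComplex.Splitting.ofExactOfRetraction _ s'.exact.exact r' h' s'.exact.epi_g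
  let e : L.obj ≅ N.obj ⊞ M.obj := σ.isoBinaryBiproduct
  let e' : L.obj ≅ N.obj ⊞ M.obj := σ'.isoBinaryBiproduct
  have h1 : s.i ≫ e.hom = biprod.inl := by
    have : s.i ≫ s.p = 0 := s.zero
    apply biprod.hom_ext <;>
      simp [e, σ, ShortComplex.Splitting.isoBinaryBiproduct,
        ShortComplex.Splitting.ofExactOfRetraction, h, this]
  have h2 : biprod.inl ≫ e'.inv = s'.i := by
    simp [e', σ', ShortComplex.Splitting.isoBinaryBiproduct,
        ShortComplex.Splitting.ofExactOfRetraction]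
  have h3 : e.hom ≫ biprod.snd = s.p := by
    simp [e, σ, ShortComplex.Splitting.isoBinaryBiproduct,
        ShortComplex.Splitting.ofExactOfRetraction]
  have h4 : e'.hom ≫ biprod.snd = s'.p := by
    simp [e', σ', ShortComplex.Splitting.isoBinaryBiproduct,
        ShortComplex.Splitting.ofExactOfRetraction]
  refine Quotient.sound ⟨e ≪≫ e'.symm, ?_, ?_⟩
  · rw [Iso.trans_hom, Iso.symm_hom, reassoc_of% h1, h2]
  · rw [Iso.trans_hom, Iso.symm_hom, ← h3, ← h4, Category.assoc, Iso.inv_hom_id_assoc]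

theorem nonempty_iso_sum_of_retraction {M N L : CP C} (s : Extn M N L) (r : L.obj ⟶ N.obj)
    (h : s.i ≫ r = 𝟙 _) : Nonempty (L.obj ≅ (CP.sum M N).obj) :=
  ⟨(ShortComplex.Splitting.ofExactOfRetraction _ s.exact.exact r h
    s.exact.epi_g).isoBinaryBiproduct⟩

/-- The product `[M] * [N]` if all extensions of `M` by `N` split. -/
theorem hallMul_of_split (hfin : ∀ X Y : C, Finite (X ⟶ Y)) (t : ℂ) (x y : IsoCP C)
    (h : ∀ (L : CP C) (s : Extn (Quotient.out x) (Quotient.out y) L), ∃ r, s.i ≫ r = 𝟙 _) :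
    hallMul k hfin t x y =
      (t ^ twistExp k hfin (Quotient.out x) (Quotient.out y) /
        (Nat.card ((Quotient.out x).obj ⟶ (Quotient.out y).obj) : ℂ)) •
        Finsupp.single (isoClass (CP.sum (Quotient.out x) (Quotient.out y))) 1 := by
  classical
  ext z
  rw [hallMul_apply, twCoeff, eulerForm_add_eulerForm k hfin, Finsupp.smul_apply,
    Finsupp.single_apply]
  split_ifs with hz
  · subst hz
    obtain ⟨e⟩ := nonempty_iso_out (CP.sum (Quotient.out x) (Quotient.out y))
    have : Nat.card (ExtWith (Quotient.out x) (Quotient.out y)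
        (Quotient.out (isoClass (CP.sum (Quotient.out x) (Quotient.out y))))) = 1 := by
      rw [Nat.card_eq_one_iff_unique]
      refine ⟨⟨fun a b => ?_⟩, ⟨Quotient.mk _
        ((CP.sumExtn _ _).transport (Iso.refl _) (Iso.refl _) e.symm)⟩⟩
      obtain ⟨s, rfl⟩ := Quotient.exists_rep a
      obtain ⟨s', rfl⟩ := Quotient.exists_rep b
      obtain ⟨r, hr⟩ := h _ s
      obtain ⟨r', hr'⟩ := h _ s'
      exact extn_equiv_of_retraction s s' r r' hr hr'
    rw [this, Nat.cast_one, smul_eq_mul]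
    ring
  · have : IsEmpty (ExtWith (Quotient.out x) (Quotient.out y) (Quotient.out z)) := by
      refine ⟨fun a => hz ?_⟩
      obtain ⟨s, -⟩ := Quotient.exists_rep a
      obtain ⟨r, hr⟩ := h _ s
      obtain ⟨e⟩ := nonempty_iso_sum_of_retraction s r hr
      rw [← isoClass_out z, isoClass_eq_iff]
      exact ⟨e.symm⟩
    simp

theorem exists_retraction_of_acyclic_right (hher : ∀ X : C, HasProjectiveDimensionLE X 1)
    {M N L : CP C} (hN : N.obj.Acyclic) (s : Extn M N L) : ∃ r, s.i ≫ r = 𝟙 _ :=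
  relInjective_of_acyclic hher N hN s.i (fun j => by
    have h := s.exact.map_of_exact (HomologicalComplex.eval C (ComplexShape.up (ZMod 2)) j)
    have : Projective (((ShortComplex.mk s.i s.p s.zero).map
        (HomologicalComplex.eval C (ComplexShape.up (ZMod 2)) j)).X₃) := M.property j
    exact ⟨⟨h.splittingOfProjective.splitMono_f⟩⟩) (𝟙 _)

theorem exists_retraction_of_acyclic_left (hher : ∀ X : C, HasProjectiveDimensionLE X 1)
    {M N L : CP C} (hM : M.obj.Acyclic) (s : Extn M N L) : ∃ r, s.i ≫ r = 𝟙 _ := by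
  have : Projective (ShortComplex.mk s.i s.p s.zero).X₃ := projective_of_acyclic hher M hM
  exact ⟨s.exact.splittingOfProjective.r, s.exact.splittingOfProjective.f_r⟩

end HallAlgebra

/-! ### The classes of the cycles -/

section Cycles

variable {C : Type u} [Category.{v} C] [Abelian C]

instance cyclesFunctor_additive (i : ZMod 2) :
    (HomologicalComplex.cyclesFunctor C (ComplexShape.up (ZMod 2)) i).Additive where
  map_add {M N f g} := by
    change HomologicalComplex.cyclesMap (f + g) i =
      HomologicalComplex.cyclesMap f i + HomologicalComplex.cyclesMap g i
    rw [← cancel_mono (N.iCycles i), Preadditive.add_comp, HomologicalComplex.cyclesMap_i,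
      HomologicalComplex.cyclesMap_i, HomologicalComplex.cyclesMap_i,
      HomologicalComplex.add_f_apply, Preadditive.comp_add]

/-- The classes of the cycles of a complex in the Grothendieck group. -/
def cyclesClass (M : Cpx C) : K0 C × K0 C := (K0.cl (M.cycles 0), K0.cl (M.cycles 1))

theorem cyclesClass_congr {M N : Cpx C} (e : M ≅ N) : cyclesClass M = cyclesClass N :=
  Prod.ext
    (K0.cl_of_iso
      ((HomologicalComplex.cyclesFunctor C (ComplexShape.up (ZMod 2)) 0).mapIso e))
    (K0.cl_of_iso
      ((HomologicalComplex.cyclesFunctor C (ComplexShape.up (ZMod 2)) 1).mapIso e))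

theorem cyclesClass_biprod (M N : Cpx C) :
    cyclesClass (M ⊞ N) = cyclesClass M + cyclesClass N := by
  have h : ∀ i, K0.cl ((M ⊞ N).cycles i) = K0.cl (M.cycles i) + K0.cl (N.cycles i) := by
    intro i
    have := preservesBinaryBiproducts_of_preservesBiproducts
      (HomologicalComplex.cyclesFunctor C (ComplexShape.up (ZMod 2)) i)
    exact (K0.cl_of_iso ((HomologicalComplex.cyclesFunctor C
      (ComplexShape.up (ZMod 2)) i).mapBiprod M N)).trans (K0.cl_biprod _ _)
  exact Prod.ext (h 0) (h 1)

theorem cyclesClass_of_isZero {M : Cpx C} (h : IsZero M) : cyclesClass M = 0 := by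
  have h1 : ∀ i, IsZero (M.cycles i) := fun i =>
    Functor.map_isZero (HomologicalComplex.cyclesFunctor C (ComplexShape.up (ZMod 2)) i) h
  exact Prod.ext (K0.cl_of_isZero (h1 0)) (K0.cl_of_isZero (h1 1))

/-- The cycles of a complex with invertible differential `a ⟶ b`. -/
theorem cl_cycles_of_isIso_d {K : Cpx C} {a b : ZMod 2} (hab : a ≠ b) [IsIso (K.d a b)] :
    K0.cl (K.cycles a) = 0 ∧ K0.cl (K.cycles b) = K0.cl (K.X b) := by
  constructor
  · refine K0.cl_of_isZero ?_
    rw [IsZero.iff_id_eq_zero, ← cancel_mono (K.iCycles a), ← cancel_mono (K.d a b)]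
    simp
  · have := (K.isIso_iCycles b a (ComplexShape.next_eq' _ (rel_of_ne hab.symm))
      (d_eq_zero_of_isIso_d (K := K) (a := a) (b := b)))
    exact K0.cl_of_iso (asIso (K.iCycles b))

/-- The terms of `K_P` and `K_P^*` have the same classes, but their cycles sit in different degrees.
This is why cycles, and not terms, give the index `(α, β)`. -/
theorem cyclesClass_KP (P : C) (hP : Projective P) :
    cyclesClass (KP P hP).obj = (K0.cl P, 0) := by
  obtain ⟨h1, h2⟩ := cl_cycles_of_isIso_d (K := (KP P hP).obj) (a := 1) (b := 0) (by decide)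
  exact Prod.ext h2 h1

theorem cyclesClass_KPstar (P : C) (hP : Projective P) :
    cyclesClass (KPstar P hP).obj = (0, K0.cl P) := by
  obtain ⟨h1, h2⟩ := cl_cycles_of_isIso_d (K := (KPstar P hP).obj) (a := 0) (b := 1) (by decide)
  exact Prod.ext h1 h2

theorem nonempty_X_iso_of_acyclic (hher : ∀ X : C, HasProjectiveDimensionLE X 1) {K : CP C}
    (hK : K.obj.Acyclic) (i : ZMod 2) :
    Nonempty (K.obj.X i ≅ K.obj.cycles 0 ⊞ K.obj.cycles 1) := by
  obtain ⟨e⟩ := nonempty_iso_KP_biprod_KPstar hher K hK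
  exact ⟨((HomologicalComplex.eval C (ComplexShape.up (ZMod 2)) i).mapIso e).symm ≪≫
    HomologicalComplex.biprodXIso _ _ i⟩

theorem cl_X_of_acyclic (hher : ∀ X : C, HasProjectiveDimensionLE X 1) {K : CP C}
    (hK : K.obj.Acyclic) (i : ZMod 2) :
    K0.cl (K.obj.X i) = (cyclesClass K.obj).1 + (cyclesClass K.obj).2 := by
  obtain ⟨e⟩ := nonempty_X_iso_of_acyclic hher hK i
  rw [K0.cl_of_iso e, K0.cl_biprod]
  rfl

theorem card_hom_of_acyclic (hher : ∀ X : C, HasProjectiveDimensionLE X 1) (L : CP C) {K : CP C}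
    (hK : K.obj.Acyclic) : Nat.card (L.obj ⟶ K.obj) =
      Nat.card (L.obj.X 0 ⟶ K.obj.cycles 0) * Nat.card (L.obj.X 1 ⟶ K.obj.cycles 1) := by
  obtain ⟨e⟩ := nonempty_iso_KP_biprod_KPstar hher K hK
  rw [← Nat.card_prod]
  have e1 : (L.obj ⟶ K.obj) ≃ (L.obj ⟶ (KP _ (projective_cycles hher K 0)).obj) ×
      (L.obj ⟶ (KPstar _ (projective_cycles hher K 1)).obj) :=
    { toFun := fun f => (f ≫ e.inv ≫ biprod.fst, f ≫ e.inv ≫ biprod.snd)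
      invFun := fun g => biprod.lift g.1 g.2 ≫ e.hom
      left_inv := fun f => by
        rw [← cancel_mono e.inv]
        apply biprod.hom_ext <;> simp
      right_inv := fun g => by simp }
  rw [Nat.card_congr e1]
  refine Nat.card_congr (Equiv.prodCongr
    (Equiv.ofBijective _ (bijective_hom_to (a := 1) (b := 0) (by decide) L.obj))
    (Equiv.ofBijective _ (bijective_hom_to (a := 0) (b := 1) (by decide) L.obj)))

end Cycles

/-! ### The minimal part of a complex -/

section MinPart

variable {C : Type u} [Category.{v} C] [Abelian C]

/-- The class of the minimal part of a complex. -/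
def minPart (hfin : ∀ X Y : C, Finite (X ⟶ Y)) (x : IsoCP C) : MinIso C :=
  ⟨isoClass (exists_minimal_decomposition hfin (Quotient.out x)).choose, _, rfl,
    (exists_minimal_decomposition hfin (Quotient.out x)).choose_spec.choose_spec.1⟩

theorem minPart_spec (hfin : ∀ X Y : C, Finite (X ⟶ Y)) (x : IsoCP C) :
    ∃ K : CP C, K.obj.Acyclic ∧
      Nonempty ((Quotient.out x).obj ≅ (Quotient.out (minPart hfin x).1).obj ⊞ K.obj) := by
  obtain ⟨K, -, hK, ⟨e⟩⟩ := (exists_minimal_decomposition hfin (Quotient.out x)).choose_spec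
  obtain ⟨e'⟩ := nonempty_iso_out (exists_minimal_decomposition hfin (Quotient.out x)).choose
  exact ⟨K, hK, ⟨e ≪≫ biprod.mapIso e'.symm (Iso.refl _)⟩⟩

theorem minPart_eq (hfin : ∀ X Y : C, Finite (X ⟶ Y)) {x : IsoCP C} {y : MinIso C} {K : CP C}
    (hK : K.obj.Acyclic)
    (e : (Quotient.out x).obj ≅ (Quotient.out y.1).obj ⊞ K.obj) : minPart hfin x = y := by
  obtain ⟨K', hK', ⟨e'⟩⟩ := minPart_spec hfin x
  refine Subtype.ext ?_
  rw [← isoClass_out (minPart hfin x).1, ← isoClass_out y.1, isoClass_eq_iff]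
  exact nonempty_iso_of_isMinimal hfin (MinIso.isMinimal_out _) y.isMinimal_out hK' hK
    (e'.symm ≪≫ e)

theorem minPart_of_minimal (hfin : ∀ X Y : C, Finite (X ⟶ Y)) (y : MinIso C) :
    minPart hfin y.1 = y :=
  minPart_eq hfin (acyclic_of_isZero isZero_zeroCP) (isoBiprodZero isZero_zeroCP)

theorem minPart_sum (hfin : ∀ X Y : C, Finite (X ⟶ Y)) (x : IsoCP C) {K : CP C}
    (hK : K.obj.Acyclic) :
    minPart hfin (isoClass (CP.sum K (Quotient.out x))) = minPart hfin x := by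
  obtain ⟨K', hK', ⟨e'⟩⟩ := minPart_spec hfin x
  obtain ⟨e⟩ := nonempty_iso_out (CP.sum K (Quotient.out x))
  refine minPart_eq hfin (K := CP.sum K K') (acyclic_sum hK hK')
    (e ≪≫ biprod.mapIso e' (Iso.refl _) ≪≫ biprod.associator _ _ _)

/-- The classes of the acyclic part of a complex in the Grothendieck group. -/
def acyclicClass (hfin : ∀ X Y : C, Finite (X ⟶ Y)) (x : IsoCP C) : K0 C × K0 C :=
  cyclesClass (Quotient.out x).obj - cyclesClass (Quotient.out (minPart hfin x).1).obj

/-- Every acyclic complement of the minimal part has this class; the definition as a difference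
avoids choosing one. -/
theorem acyclicClass_eq (hfin : ∀ X Y : C, Finite (X ⟶ Y)) {x : IsoCP C} {K : CP C}
    (e : (Quotient.out x).obj ≅ (Quotient.out (minPart hfin x).1).obj ⊞ K.obj) :
    acyclicClass hfin x = cyclesClass K.obj := by
  rw [acyclicClass, cyclesClass_congr e, cyclesClass_biprod, add_sub_cancel_left]

theorem acyclicClass_of_minimal (hfin : ∀ X Y : C, Finite (X ⟶ Y)) (y : MinIso C) :
    acyclicClass hfin y.1 = 0 := by
  rw [acyclicClass, minPart_of_minimal, sub_self]

theorem acyclicClass_sum (hfin : ∀ X Y : C, Finite (X ⟶ Y)) (x : IsoCP C) {K : CP C}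
    (hK : K.obj.Acyclic) :
    acyclicClass hfin (isoClass (CP.sum K (Quotient.out x))) =
      acyclicClass hfin x + cyclesClass K.obj := by
  obtain ⟨e⟩ := nonempty_iso_out (CP.sum K (Quotient.out x))
  rw [acyclicClass, acyclicClass, minPart_sum hfin x hK, cyclesClass_congr e, CP.sum,
    cyclesClass_biprod]
  abel

theorem isoClass_sum_comm (M N : CP C) : isoClass (CP.sum M N) = isoClass (CP.sum N M) :=
  isoClass_eq_iff.2 ⟨biprod.braiding _ _⟩

theorem isoClass_sum_congr {M N M' N' : CP C} (e : M.obj ≅ M'.obj) (f : N.obj ≅ N'.obj) :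
    isoClass (CP.sum M N) = isoClass (CP.sum M' N') :=
  isoClass_eq_iff.2 ⟨biprod.mapIso f e⟩

end MinPart

/-! ### Products with acyclic complexes, explicitly -/

section AcyclicProducts

variable (k : Type w) [Field k] {C : Type u} [Category.{v} C] [Abelian C] [Linear k C]

/-- The exponent of `t` in `[M] * [K]` for an acyclic complex `K` with given classes of cycles. -/
def rankDiff (hfin : ∀ X Y : C, Finite (X ⟶ Y)) (M : CP C) (γ : K0 C × K0 C) : ℤ :=
  rankX k hfin M 1 (γ.1 - γ.2) - rankX k hfin M 0 (γ.1 - γ.2)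

theorem rankDiff_add (hfin : ∀ X Y : C, Finite (X ⟶ Y)) (M : CP C) (γ γ' : K0 C × K0 C) :
    rankDiff k hfin M (γ + γ') = rankDiff k hfin M γ + rankDiff k hfin M γ' := by
  simp only [rankDiff, Prod.fst_add, Prod.snd_add, map_sub, map_add]
  ring

theorem rankDiff_zero (hfin : ∀ X Y : C, Finite (X ⟶ Y)) (M : CP C) :
    rankDiff k hfin M 0 = 0 := by
  simp [rankDiff]

theorem rankDiff_congr (hfin : ∀ X Y : C, Finite (X ⟶ Y)) {M N : CP C} (e : M.obj ≅ N.obj)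
    (γ : K0 C × K0 C) : rankDiff k hfin M γ = rankDiff k hfin N γ := by
  simp only [rankDiff, rankX_congr k hfin e]

/-- The two terms of an acyclic complex are isomorphic. Consequently acyclic classes multiply
without any power of `t`. -/
theorem rankDiff_of_acyclic (hfin : ∀ X Y : C, Finite (X ⟶ Y))
    (hher : ∀ X : C, HasProjectiveDimensionLE X 1) {K : CP C} (hK : K.obj.Acyclic)
    (γ : K0 C × K0 C) : rankDiff k hfin K γ = 0 := by
  obtain ⟨e⟩ := nonempty_X_iso_of_acyclic hher hK 0
  obtain ⟨e'⟩ := nonempty_X_iso_of_acyclic hher hK 1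
  rw [rankDiff, sub_eq_zero]
  exact DFunLike.congr_fun (homRank_congr k hfin (e' ≪≫ e.symm) _ _) _

theorem rankDiff_sum (hfin : ∀ X Y : C, Finite (X ⟶ Y))
    (hher : ∀ X : C, HasProjectiveDimensionLE X 1) (M : CP C) {K : CP C} (hK : K.obj.Acyclic)
    (γ : K0 C × K0 C) : rankDiff k hfin (CP.sum K M) γ = rankDiff k hfin M γ := by
  have h := rankDiff_of_acyclic k hfin hher hK γ
  simp only [rankDiff, (CP.sumExtn K M).rankX_eq k hfin, AddMonoidHom.add_apply] at h ⊢
  linear_combination h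

/-- All extensions by the relatively injective complex `y` split, so one term survives. With `Z₀`,
`Z₁` the cycles of `y`, both terms of `y` have class `Z₀ + Z₁`, while the space of morphisms from
`x` to `y` contributes `t` to twice the sum of the dimensions of `Hom(x₀, Z₀)` and `Hom(x₁, Z₁)`.
The difference of the exponents is `rankDiff`. -/
theorem hallMul_acyclic_right [Finite k] (hfin : ∀ X Y : C, Finite (X ⟶ Y))
    (hher : ∀ X : C, HasProjectiveDimensionLE X 1) {t : ℂ} (ht0 : t ≠ 0)
    (ht : t ^ 2 = (Nat.card k : ℂ)) (x y : IsoCP C) (hy : (Quotient.out y).obj.Acyclic) :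
    hallMul k hfin t x y =
      t ^ rankDiff k hfin (Quotient.out x) (cyclesClass (Quotient.out y).obj) •
        Finsupp.single (isoClass (CP.sum (Quotient.out y) (Quotient.out x))) 1 := by
  rw [hallMul_of_split k hfin t x y (fun _ s => exists_retraction_of_acyclic_right hher hy s),
    isoClass_sum_comm]
  congr 1
  rw [card_hom_of_acyclic hher _ hy, Nat.cast_mul, card_hom_eq k hfin ht, card_hom_eq k hfin ht,
    ← zpow_add₀ ht0, ← zpow_sub₀ ht0]
  congr 1
  simp only [twistExp, cl_X_of_acyclic hher hy, map_add, rankDiff, map_sub, cyclesClass, rankX_cl]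
  ring

theorem exists_hallMul_acyclic_left (hfin : ∀ X Y : C, Finite (X ⟶ Y))
    (hher : ∀ X : C, HasProjectiveDimensionLE X 1) {t : ℂ} (ht0 : t ≠ 0)
    (x y : IsoCP C) (hx : (Quotient.out x).obj.Acyclic) :
    ∃ c : ℂ, c ≠ 0 ∧ hallMul k hfin t x y =
      c • Finsupp.single (isoClass (CP.sum (Quotient.out x) (Quotient.out y))) 1 := by
  refine ⟨_, ?_, hallMul_of_split k hfin t x y
    (fun _ s => exists_retraction_of_acyclic_left hher hx s)⟩
  have := finite_hom_cpx hfin (Quotient.out x).obj (Quotient.out y).obj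
  exact div_ne_zero (zpow_ne_zero _ ht0) (Nat.cast_ne_zero.2 Nat.card_pos.ne')

theorem AcyclicIso.acyclic_out (x : AcyclicIso C) : (Quotient.out x.1).obj.Acyclic := by
  obtain ⟨x, M, rfl, hM⟩ := x
  obtain ⟨e⟩ := nonempty_iso_out M
  exact acyclic_of_iso e.symm hM

end AcyclicProducts

/-! ### The regular representation of Bridgeland's Hall algebra -/

section Representation

variable (k : Type w) [Field k] {C : Type u} [Category.{v} C] [Abelian C] [Linear k C]

/-- Translation of the second component of the index set. -/
def shift (γ : K0 C × K0 C) : (BIdx C →₀ ℂ) →ₗ[ℂ] (BIdx C →₀ ℂ) :=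
  Finsupp.lmapDomain ℂ ℂ (fun i => (i.1, i.2 + γ))

theorem shift_single (γ : K0 C × K0 C) (i : BIdx C) (a : ℂ) :
    shift γ (Finsupp.single i a) = Finsupp.single (i.1, i.2 + γ) a := by
  simp [shift, Finsupp.lmapDomain_apply, Finsupp.mapDomain_single]

theorem shift_shift (γ γ' : K0 C × K0 C) (v : BIdx C →₀ ℂ) :
    shift γ (shift γ' v) = shift (γ' + γ) v := by
  have : shift γ ∘ₗ shift γ' = shift (γ' + γ) := by
    ext i : 2
    simp only [LinearMap.comp_apply, Finsupp.lsingle_apply, shift_single,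
      add_assoc]
  exact LinearMap.congr_fun this v

/-- The decomposition of a basis element of the twisted Hall algebra into its minimal part and its
acyclic part. -/
def splitMin (hfin : ∀ X Y : C, Finite (X ⟶ Y)) (t : ℂ) :
    (IsoCP C →₀ ℂ) →ₗ[ℂ] (BIdx C →₀ ℂ) :=
  Finsupp.linearCombination ℂ (fun x =>
    -- For `x = N ⊞ K` the product `[N] * [K]` is `t ^ rankDiff` times `[x]`, and adding `K` to `N`
    -- does not change `rankDiff`; the inverse power normalizes this.
    t ^ (-rankDiff k hfin (Quotient.out x) (acyclicClass hfin x)) •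
      Finsupp.single (minPart hfin x, acyclicClass hfin x) 1)

theorem splitMin_single (hfin : ∀ X Y : C, Finite (X ⟶ Y)) (t : ℂ) (x : IsoCP C) :
    splitMin k hfin t (Finsupp.single x 1) =
      t ^ (-rankDiff k hfin (Quotient.out x) (acyclicClass hfin x)) •
      Finsupp.single (minPart hfin x, acyclicClass hfin x) 1 := by
  simp [splitMin]

theorem splitMin_minimal (hfin : ∀ X Y : C, Finite (X ⟶ Y)) (t : ℂ) (x : MinIso C) :
    splitMin k hfin t (Finsupp.single x.1 1) = Finsupp.single (x, 0) 1 := by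
  rw [splitMin_single, acyclicClass_of_minimal, minPart_of_minimal, rankDiff_zero, neg_zero,
    zpow_zero, one_smul]

/-- The normalization in `splitMin` absorbs the power of `t`, so right multiplication by an acyclic
class becomes a pure translation. -/
theorem splitMin_hallMul_acyclic [Finite k] (hfin : ∀ X Y : C, Finite (X ⟶ Y))
    (hher : ∀ X : C, HasProjectiveDimensionLE X 1) {t : ℂ} (ht0 : t ≠ 0)
    (ht : t ^ 2 = (Nat.card k : ℂ)) (x y : IsoCP C) (hy : (Quotient.out y).obj.Acyclic) :
    splitMin k hfin t (hallMul k hfin t x y) =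
      shift (cyclesClass (Quotient.out y).obj) (splitMin k hfin t (Finsupp.single x 1)) := by
  obtain ⟨e⟩ := nonempty_iso_out (CP.sum (Quotient.out y) (Quotient.out x))
  rw [hallMul_acyclic_right k hfin hher ht0 ht x y hy, map_smul, splitMin_single, splitMin_single,
    minPart_sum hfin x hy, acyclicClass_sum hfin x hy, map_smul, shift_single, smul_smul,
    rankDiff_congr k hfin e, rankDiff_sum k hfin hher _ hy, rankDiff_add, ← zpow_add₀ ht0]
  congr 2
  ring

/-- The action of a basis element of the twisted Hall algebra. -/
def act (hfin : ∀ X Y : C, Finite (X ⟶ Y)) (t : ℂ) (x : IsoCP C) :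
    Module.End ℂ (BIdx C →₀ ℂ) :=
  -- This models `[x] * [N] * K_α * K_β^*`: multiply by the minimal part, split the result, then let
  -- the right factor translate the index.
  Finsupp.linearCombination ℂ (fun i => shift i.2 (splitMin k hfin t (hallMul k hfin t x i.1.1)))

theorem act_single (hfin : ∀ X Y : C, Finite (X ⟶ Y)) (t : ℂ) (x : IsoCP C) (i : BIdx C) :
    act k hfin t x (Finsupp.single i 1) =
      shift i.2 (splitMin k hfin t (hallMul k hfin t x i.1.1)) := by
  simp [act]

theorem act_shift (hfin : ∀ X Y : C, Finite (X ⟶ Y)) (t : ℂ) (x : IsoCP C) (γ : K0 C × K0 C)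
    (v : BIdx C →₀ ℂ) : act k hfin t x (shift γ v) = shift γ (act k hfin t x v) := by
  have : act k hfin t x ∘ₗ shift γ = shift γ ∘ₗ act k hfin t x := by
    refine Finsupp.lhom_ext' fun i => LinearMap.ext_ring ?_
    simp only [LinearMap.comp_apply, Finsupp.lsingle_apply, shift_single, act_single, shift_shift]
  exact LinearMap.congr_fun this v

/-- Passing to minimal and acyclic parts commutes with left multiplication. For `y = N ⊞ K` this is
`[x] * ([N] * [K]) = ([x] * [N]) * [K]`, where right multiplication by `[K]` is a translation. -/
theorem act_splitMin [Finite k] (hfin : ∀ X Y : C, Finite (X ⟶ Y))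
    (hher : ∀ X : C, HasProjectiveDimensionLE X 1) {t : ℂ} (ht0 : t ≠ 0)
    (ht : t ^ 2 = (Nat.card k : ℂ)) (x : IsoCP C) (v : IsoCP C →₀ ℂ) :
    act k hfin t x (splitMin k hfin t v) =
      splitMin k hfin t (Finsupp.linearCombination ℂ (hallMul k hfin t x) v) := by
  suffices h : act k hfin t x ∘ₗ splitMin k hfin t =
      splitMin k hfin t ∘ₗ Finsupp.linearCombination ℂ (hallMul k hfin t x) from
    LinearMap.congr_fun h v
  refine Finsupp.lhom_ext' fun y => LinearMap.ext_ring ?_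
  simp only [LinearMap.comp_apply, Finsupp.lsingle_apply, Finsupp.linearCombination_single,
    one_smul]
  obtain ⟨K, hK, ⟨e⟩⟩ := minPart_spec hfin y
  obtain ⟨f⟩ := nonempty_iso_out K
  have hK' : (Quotient.out (isoClass K)).obj.Acyclic := acyclic_of_iso f.symm hK
  have hc : cyclesClass (Quotient.out (isoClass K)).obj = acyclicClass hfin y := by
    rw [cyclesClass_congr f, acyclicClass_eq hfin e]
  have hy : isoClass (CP.sum (Quotient.out (isoClass K)) (Quotient.out (minPart hfin y).1)) = y := by
    rw [← isoClass_out y, isoClass_eq_iff, isoClass_out y]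
    exact ⟨biprod.mapIso (Iso.refl _) f ≪≫ e.symm⟩
  have h1 := hallMul_acyclic_right k hfin hher ht0 ht (minPart hfin y).1 (isoClass K) hK'
  rw [hy, hc] at h1
  have hB : rankDiff k hfin (Quotient.out y) (acyclicClass hfin y) =
      rankDiff k hfin (Quotient.out (minPart hfin y).1) (acyclicClass hfin y) := by
    rw [rankDiff_congr k hfin (N := CP.sum K (Quotient.out (minPart hfin y).1)) e,
      rankDiff_sum k hfin hher _ hK]
  have h2 := hallMul_assoc k hfin ht0 x (minPart hfin y).1 (isoClass K)
  have h3 : ∀ v : IsoCP C →₀ ℂ, splitMin k hfin t (Finsupp.linearCombination ℂ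
      (fun w => hallMul k hfin t w (isoClass K)) v) =
      shift (acyclicClass hfin y) (splitMin k hfin t v) := by
    intro v
    have : splitMin k hfin t ∘ₗ Finsupp.linearCombination ℂ
        (fun w => hallMul k hfin t w (isoClass K)) =
        shift (acyclicClass hfin y) ∘ₗ splitMin k hfin t := by
      refine Finsupp.lhom_ext' fun z => LinearMap.ext_ring ?_
      simp only [LinearMap.comp_apply, Finsupp.lsingle_apply, Finsupp.linearCombination_single,
        one_smul]
      rw [splitMin_hallMul_acyclic k hfin hher ht0 ht z _ hK', hc]
    exact LinearMap.congr_fun this v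
  have h4 := congrArg (splitMin k hfin t) h2
  rw [h3, h1, map_smul, map_smul, Finsupp.linearCombination_single, one_smul] at h4
  rw [splitMin_single, map_smul, act_single, hB, h4, smul_smul, ← zpow_add₀ ht0, neg_add_cancel,
    zpow_zero, one_smul]

theorem act_mul_act [Finite k] (hfin : ∀ X Y : C, Finite (X ⟶ Y))
    (hher : ∀ X : C, HasProjectiveDimensionLE X 1) {t : ℂ} (ht0 : t ≠ 0)
    (ht : t ^ 2 = (Nat.card k : ℂ)) (x y : IsoCP C) :
    act k hfin t x * act k hfin t y =
      Finsupp.linearCombination ℂ (act k hfin t) (hallMul k hfin t x y) := by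
  refine Finsupp.lhom_ext' fun i => LinearMap.ext_ring ?_
  simp only [LinearMap.comp_apply, Finsupp.lsingle_apply, Module.End.mul_apply]
  rw [act_single, act_shift, act_splitMin k hfin hher ht0 ht, ← hallMul_assoc k hfin ht0,
    Finsupp.linearCombination_apply, Finsupp.linearCombination_apply, Finsupp.sum, Finsupp.sum,
    map_sum, map_sum, LinearMap.sum_apply]
  refine Finset.sum_congr rfl fun z _ => ?_
  rw [map_smul, map_smul, LinearMap.smul_apply, act_single]

/-! ### The unit, and the action on vectors indexed by the zero complex -/

theorem hallMul_zero_left (hfin : ∀ X Y : C, Finite (X ⟶ Y))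
    (hher : ∀ X : C, HasProjectiveDimensionLE X 1) (t : ℂ) (y : IsoCP C) :
    hallMul k hfin t (isoClass (zeroCP C)) y = Finsupp.single y 1 := by
  obtain ⟨e⟩ := nonempty_iso_out (zeroCP C)
  have hZ : IsZero (Quotient.out (isoClass (zeroCP C))).obj := isZero_zeroCP.of_iso e
  rw [hallMul_of_split k hfin t _ y
    (fun _ s => exists_retraction_of_acyclic_left hher (acyclic_of_isZero hZ) s)]
  have h1 : ∀ i, rankX k hfin (Quotient.out (isoClass (zeroCP C))) i = 0 := by
    intro i
    rw [rankX_congr k hfin e]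
    refine K0.hom_ext fun X => ?_
    have : Subsingleton ((zeroCP C).obj.X i ⟶ X) := ⟨fun f g => (isZero_zero C).eq_of_src f g⟩
    rw [rankX_cl, Module.finrank_zero_of_subsingleton]
    rfl
  have h2 : Nat.card ((Quotient.out (isoClass (zeroCP C))).obj ⟶ (Quotient.out y).obj) = 1 := by
    rw [Nat.card_eq_one_iff_unique]
    exact ⟨⟨fun f g => hZ.eq_of_src f g⟩, ⟨0⟩⟩
  have h3 : isoClass (CP.sum (Quotient.out (isoClass (zeroCP C))) (Quotient.out y)) = y := by
    rw [← isoClass_out y, isoClass_eq_iff, isoClass_out y]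
    exact ⟨(isoBiprodZero hZ).symm⟩
  rw [h2, h3, twistExp, h1, h1]
  simp

theorem hallMul_zero_right [Finite k] (hfin : ∀ X Y : C, Finite (X ⟶ Y))
    (hher : ∀ X : C, HasProjectiveDimensionLE X 1) {t : ℂ} (ht0 : t ≠ 0)
    (ht : t ^ 2 = (Nat.card k : ℂ)) (x : IsoCP C) :
    hallMul k hfin t x (isoClass (zeroCP C)) = Finsupp.single x 1 := by
  obtain ⟨e⟩ := nonempty_iso_out (zeroCP C)
  have hZ : IsZero (Quotient.out (isoClass (zeroCP C))).obj := isZero_zeroCP.of_iso e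
  have h3 : isoClass (CP.sum (Quotient.out (isoClass (zeroCP C))) (Quotient.out x)) = x := by
    rw [← isoClass_out x, isoClass_eq_iff, isoClass_out x]
    exact ⟨(isoBiprodZero hZ).symm⟩
  rw [hallMul_acyclic_right k hfin hher ht0 ht _ _ (acyclic_of_isZero hZ), h3,
    cyclesClass_of_isZero hZ, rankDiff_zero, zpow_zero, one_smul]

theorem act_zero (hfin : ∀ X Y : C, Finite (X ⟶ Y))
    (hher : ∀ X : C, HasProjectiveDimensionLE X 1) (t : ℂ) :
    act k hfin t (isoClass (zeroCP C)) = 1 := by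
  refine Finsupp.lhom_ext' fun i => LinearMap.ext_ring ?_
  simp only [LinearMap.comp_apply, Finsupp.lsingle_apply, Module.End.one_apply]
  rw [act_single, hallMul_zero_left k hfin hher, splitMin_minimal, shift_single, zero_add]

theorem act_single_zero [Finite k] (hfin : ∀ X Y : C, Finite (X ⟶ Y))
    (hher : ∀ X : C, HasProjectiveDimensionLE X 1) {t : ℂ} (ht0 : t ≠ 0)
    (ht : t ^ 2 = (Nat.card k : ℂ)) (x : IsoCP C) (γ : K0 C × K0 C) :
    act k hfin t x (Finsupp.single (MinIso.zero C, γ) 1) =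
      shift γ (splitMin k hfin t (Finsupp.single x 1)) := by
  rw [act_single]
  exact congrArg (fun z => shift γ (splitMin k hfin t z)) (hallMul_zero_right k hfin hher ht0 ht x)

theorem act_minimal_single_zero [Finite k] (hfin : ∀ X Y : C, Finite (X ⟶ Y))
    (hher : ∀ X : C, HasProjectiveDimensionLE X 1) {t : ℂ} (ht0 : t ≠ 0)
    (ht : t ^ 2 = (Nat.card k : ℂ)) (x : MinIso C) (γ : K0 C × K0 C) :
    act k hfin t x.1 (Finsupp.single (MinIso.zero C, γ) 1) = Finsupp.single (x, γ) 1 := by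
  rw [act_single_zero k hfin hher ht0 ht, splitMin_minimal, shift_single, zero_add]

theorem act_acyclic_single_zero [Finite k] (hfin : ∀ X Y : C, Finite (X ⟶ Y))
    (hher : ∀ X : C, HasProjectiveDimensionLE X 1) {t : ℂ} (ht0 : t ≠ 0)
    (ht : t ^ 2 = (Nat.card k : ℂ)) {x : IsoCP C} (hx : (Quotient.out x).obj.Acyclic)
    (γ : K0 C × K0 C) :
    act k hfin t x (Finsupp.single (MinIso.zero C, γ) 1) =
      Finsupp.single (MinIso.zero C, γ + cyclesClass (Quotient.out x).obj) 1 := by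
  obtain ⟨e⟩ := nonempty_iso_out (zeroCP C)
  have hZ : IsZero (Quotient.out (isoClass (zeroCP C))).obj := isZero_zeroCP.of_iso e
  have h1 : (Quotient.out x).obj ≅ (Quotient.out (MinIso.zero C).1).obj ⊞ (Quotient.out x).obj :=
    isoBiprodZero hZ ≪≫ biprod.braiding _ _
  have h2 : minPart hfin x = MinIso.zero C := minPart_eq hfin hx h1
  have h3 : acyclicClass hfin x = cyclesClass (Quotient.out x).obj :=
    acyclicClass_eq hfin (by rw [h2]; exact h1)
  rw [act_single_zero k hfin hher ht0 ht, splitMin_single, h2, h3,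
    rankDiff_of_acyclic k hfin hher hx, neg_zero, zpow_zero, one_smul, shift_single, add_comm]

/-- An acyclic complex translates the index up to a nonzero scalar. As this scalar depends on `N`
but not on `γ`, the inverse operator is the opposite translation divided by it. -/
theorem exists_act_acyclic [Finite k] (hfin : ∀ X Y : C, Finite (X ⟶ Y))
    (hher : ∀ X : C, HasProjectiveDimensionLE X 1) {t : ℂ} (ht0 : t ≠ 0)
    {x : IsoCP C} (hx : (Quotient.out x).obj.Acyclic) (N : MinIso C) :
    ∃ s : ℂ, s ≠ 0 ∧ ∀ γ : K0 C × K0 C, act k hfin t x (Finsupp.single (N, γ) 1) =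
      s • Finsupp.single (N, γ + cyclesClass (Quotient.out x).obj) 1 := by
  obtain ⟨c, hc, h⟩ := exists_hallMul_acyclic_left k hfin hher ht0 x N.1 hx
  refine ⟨c * t ^ (-rankDiff k hfin (Quotient.out (isoClass (CP.sum (Quotient.out x)
    (Quotient.out N.1)))) (cyclesClass (Quotient.out x).obj)), mul_ne_zero hc (zpow_ne_zero _ ht0), fun γ => ?_⟩
  rw [act_single]
  dsimp only
  rw [h, map_smul, splitMin_single, minPart_sum hfin _ hx, acyclicClass_sum hfin _ hx,
    minPart_of_minimal, acyclicClass_of_minimal, map_smul, map_smul, shift_single, smul_smul,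
    zero_add, add_comm γ]

theorem exists_act_inverse [Finite k] (hfin : ∀ X Y : C, Finite (X ⟶ Y))
    (hher : ∀ X : C, HasProjectiveDimensionLE X 1) {t : ℂ} (ht0 : t ≠ 0) (x : AcyclicIso C) :
    ∃ g : Module.End ℂ (BIdx C →₀ ℂ), act k hfin t x.1 * g = 1 ∧ g * act k hfin t x.1 = 1 := by
  choose s hs h using exists_act_acyclic k hfin hher ht0 x.acyclic_out
  refine ⟨Finsupp.linearCombination ℂ (fun i : BIdx C => (s i.1)⁻¹ •
    Finsupp.single (i.1, i.2 - cyclesClass (Quotient.out x.1).obj) 1), ?_, ?_⟩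
  · refine Finsupp.lhom_ext' fun i => LinearMap.ext_ring ?_
    simp only [LinearMap.comp_apply, Finsupp.lsingle_apply, Module.End.one_apply,
      Module.End.mul_apply, Finsupp.linearCombination_single, map_smul, h, smul_smul,
      sub_add_cancel]
    rw [one_mul, inv_mul_cancel₀ (hs _), one_smul]
  · refine Finsupp.lhom_ext' fun ⟨N, γ⟩ => LinearMap.ext_ring ?_
    simp only [LinearMap.comp_apply, Finsupp.lsingle_apply, Module.End.one_apply,
      Module.End.mul_apply, h, map_smul, Finsupp.linearCombination_single, smul_smul,
      add_sub_cancel_right]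
    rw [one_mul, mul_inv_cancel₀ (hs _), one_smul]

theorem finsum_smul_eq_linearCombination {α M : Type*} [AddCommGroup M] [Module ℂ M]
    (v : α →₀ ℂ) (f : α → M) : ∑ᶠ a, v a • f a = Finsupp.linearCombination ℂ f v := by
  rw [finsum_eq_sum_of_support_subset (s := v.support), Finsupp.linearCombination_apply,
    Finsupp.sum]
  intro a ha
  rw [Finset.mem_coe, Finsupp.mem_support_iff]
  rintro h
  simp [h] at ha

theorem finsum_twCoeff_smul (hfin : ∀ X Y : C, Finite (X ⟶ Y)) (t : ℂ) (M N : CP C)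
    {A : Type*} [AddCommGroup A] [Module ℂ A] (f : IsoCP C → A) :
    ∑ᶠ L : IsoCP C, twCoeff k t M N (Quotient.out L) • f L =
      Finsupp.linearCombination ℂ f (hallMul k hfin t (isoClass M) (isoClass N)) := by
  rw [← finsum_smul_eq_linearCombination]
  refine finsum_congr fun L => ?_
  obtain ⟨e⟩ := nonempty_iso_out M
  obtain ⟨e'⟩ := nonempty_iso_out N
  rw [hallMul_apply, twCoeff_congr k hfin t e e' (Iso.refl _)]

/-- The operators `act` satisfy the multiplication table and acyclic classes act invertibly, so all
defining relations of the localization hold. -/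
theorem exists_representation [Finite k] (hfin : ∀ X Y : C, Finite (X ⟶ Y))
    (hher : ∀ X : C, HasProjectiveDimensionLE X 1) {t : ℂ} (ht0 : t ≠ 0)
    (ht : t ^ 2 = (Nat.card k : ℂ)) :
    ∃ ρ : DH k C t →ₐ[ℂ] Module.End ℂ (BIdx C →₀ ℂ),
      ∀ x, ρ (DH.of k t x) = act k hfin t x := by
  choose g hg hg' using exists_act_inverse k (C := C) hfin hher ht0
  let F : FreeAlgebra ℂ (IsoCP C ⊕ AcyclicIso C) →ₐ[ℂ] Module.End ℂ (BIdx C →₀ ℂ) :=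
    FreeAlgebra.lift ℂ (Sum.elim (act k hfin t) g)
  have hF : ∀ x, F (FreeAlgebra.ι ℂ x) = Sum.elim (act k hfin t) g x := fun x =>
    FreeAlgebra.lift_ι_apply _ _
  have hrel : ∀ ⦃a b⦄, DHRel k C t a b → F a = F b := by
    intro a b h
    cases h with
    | unit => rw [hF, map_one, Sum.elim_inl, act_zero k hfin hher]
    | mul M N =>
      rw [finsum_twCoeff_smul k hfin, map_mul, hF, hF, Sum.elim_inl, Sum.elim_inl,
        act_mul_act k hfin hher ht0 ht, Finsupp.linearCombination_apply,
        Finsupp.linearCombination_apply, Finsupp.sum, Finsupp.sum, map_sum]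
      exact Finset.sum_congr rfl fun z _ => by rw [map_smul, hF, Sum.elim_inl]
    | mul_inv x => rw [map_mul, hF, hF, map_one, Sum.elim_inl, Sum.elim_inr, hg]
    | inv_mul x => rw [map_mul, hF, hF, map_one, Sum.elim_inl, Sum.elim_inr, hg']
  refine ⟨RingQuot.liftAlgHom ℂ ⟨F, hrel⟩, fun x => ?_⟩
  rw [DH.of, RingQuot.liftAlgHom_mkAlgHom_apply, hF, Sum.elim_inl]

end Representation

/-! ### Sums of contractible complexes -/

section Contractible

variable {C : Type u} [Category.{v} C] [Abelian C]

/-- The morphism `K_P ⟶ K_Q` with both components equal to a given morphism. -/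
def KPmap {P Q : C} (hP : Projective P) (hQ : Projective Q) (f : P ⟶ Q) :
    (KP P hP).obj ⟶ (KP Q hQ).obj where
  f _ := f
  comm' i j _ := by
    by_cases h : i = 1 ∧ j = 0 <;> simp [KP, h]

/-- The morphism `K_P^* ⟶ K_Q^*` with both components equal to a given morphism. -/
def KPstarMap {P Q : C} (hP : Projective P) (hQ : Projective Q) (f : P ⟶ Q) :
    (KPstar P hP).obj ⟶ (KPstar Q hQ).obj where
  f _ := f
  comm' i j _ := by
    by_cases h : i = 0 ∧ j = 1 <;> simp [KPstar, h]

theorem nonempty_KP_iso {P Q : C} (hP : Projective P) (hQ : Projective Q) (e : P ≅ Q) :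
    Nonempty ((KP P hP).obj ≅ (KP Q hQ).obj) :=
  ⟨{ hom := KPmap hP hQ e.hom
     inv := KPmap hQ hP e.inv
     hom_inv_id := HomologicalComplex.hom_ext _ _ fun _ => e.hom_inv_id
     inv_hom_id := HomologicalComplex.hom_ext _ _ fun _ => e.inv_hom_id }⟩

theorem nonempty_KPstar_iso {P Q : C} (hP : Projective P) (hQ : Projective Q) (e : P ≅ Q) :
    Nonempty ((KPstar P hP).obj ≅ (KPstar Q hQ).obj) :=
  ⟨{ hom := KPstarMap hP hQ e.hom
     inv := KPstarMap hQ hP e.inv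
     hom_inv_id := HomologicalComplex.hom_ext _ _ fun _ => e.hom_inv_id
     inv_hom_id := HomologicalComplex.hom_ext _ _ fun _ => e.inv_hom_id }⟩

theorem nonempty_iso_biprod {D : Type u} [Category.{v} D] [Abelian D] {A B S : D}
    (i : A ⟶ S) (j : B ⟶ S) (p : S ⟶ A) (q : S ⟶ B) (hip : i ≫ p = 𝟙 A) (hjq : j ≫ q = 𝟙 B)
    (hiq : i ≫ q = 0) (hjp : j ≫ p = 0) (h : p ≫ i + q ≫ j = 𝟙 S) : Nonempty (S ≅ A ⊞ B) :=
  ⟨{ hom := biprod.lift p q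
     inv := biprod.desc i j
     hom_inv_id := by rw [biprod.lift_desc, h]
     inv_hom_id := by ext <;> simp [hip, hjq, hiq, hjp] }⟩

theorem nonempty_KP_biprod_iso {P Q : C} (hP : Projective P) (hQ : Projective Q)
    (h : Projective (P ⊞ Q)) : Nonempty ((KP (P ⊞ Q) h).obj ≅ (KP P hP).obj ⊞ (KP Q hQ).obj) :=
  nonempty_iso_biprod (KPmap _ _ biprod.inl) (KPmap _ _ biprod.inr) (KPmap _ _ biprod.fst)
    (KPmap _ _ biprod.snd) (HomologicalComplex.hom_ext _ _ fun _ => biprod.inl_fst)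
    (HomologicalComplex.hom_ext _ _ fun _ => biprod.inr_snd)
    (HomologicalComplex.hom_ext _ _ fun _ => biprod.inl_snd)
    (HomologicalComplex.hom_ext _ _ fun _ => biprod.inr_fst)
    (HomologicalComplex.hom_ext _ _ fun _ => biprod.total)

theorem nonempty_KPstar_biprod_iso {P Q : C} (hP : Projective P) (hQ : Projective Q)
    (h : Projective (P ⊞ Q)) :
    Nonempty ((KPstar (P ⊞ Q) h).obj ≅ (KPstar P hP).obj ⊞ (KPstar Q hQ).obj) :=
  nonempty_iso_biprod (KPstarMap _ _ biprod.inl) (KPstarMap _ _ biprod.inr)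
    (KPstarMap _ _ biprod.fst) (KPstarMap _ _ biprod.snd)
    (HomologicalComplex.hom_ext _ _ fun _ => biprod.inl_fst)
    (HomologicalComplex.hom_ext _ _ fun _ => biprod.inr_snd)
    (HomologicalComplex.hom_ext _ _ fun _ => biprod.inl_snd)
    (HomologicalComplex.hom_ext _ _ fun _ => biprod.inr_fst)
    (HomologicalComplex.hom_ext _ _ fun _ => biprod.total)

end Contractible

/-! ### Products in Bridgeland's Hall algebra -/

section Products

variable (k : Type w) [Field k] {C : Type u} [Category.{v} C] [Abelian C] [Linear k C]

theorem DH.of_mul_of (hfin : ∀ X Y : C, Finite (X ⟶ Y)) (t : ℂ) (x y : IsoCP C) :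
    DH.of k t x * DH.of k t y =
      Finsupp.linearCombination ℂ (DH.of k t) (hallMul k hfin t x y) := by
  have h := RingQuot.mkAlgHom_rel ℂ
    (DHRel.mul (k := k) (t := t) (Quotient.out x) (Quotient.out y))
  rw [finsum_twCoeff_smul k hfin, isoClass_out, isoClass_out, map_mul] at h
  rw [DH.of, DH.of, h, Finsupp.linearCombination_apply, Finsupp.linearCombination_apply,
    Finsupp.sum, Finsupp.sum, map_sum]
  exact Finset.sum_congr rfl fun z _ => map_smul _ _ _

theorem DH.of_zero (t : ℂ) : DH.of k t (isoClass (zeroCP C)) = 1 := by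
  rw [DH.of, RingQuot.mkAlgHom_rel ℂ DHRel.unit, map_one]

/-- The class of an acyclic complex is a unit. -/
def acyclicUnit (t : ℂ) (M : CP C) (hM : M.obj.Acyclic) : (DH k C t)ˣ where
  val := DH.of k t (isoClass M)
  inv := DH.inv k t M hM
  val_inv := by
    have h := RingQuot.mkAlgHom_rel ℂ (DHRel.mul_inv (k := k) (t := t) ⟨isoClass M, M, rfl, hM⟩)
    rwa [map_mul, map_one] at h
  inv_val := by
    have h := RingQuot.mkAlgHom_rel ℂ (DHRel.inv_mul (k := k) (t := t) ⟨isoClass M, M, rfl, hM⟩)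
    rwa [map_mul, map_one] at h

theorem acyclicUnit_congr (t : ℂ) {M N : CP C} (hM : M.obj.Acyclic) (hN : N.obj.Acyclic)
    (e : M.obj ≅ N.obj) : acyclicUnit k t M hM = acyclicUnit k t N hN :=
  Units.ext (congrArg (DH.of k t) (isoClass_eq_iff.2 ⟨e⟩))

theorem of_mul_acyclic [Finite k] (hfin : ∀ X Y : C, Finite (X ⟶ Y))
    (hher : ∀ X : C, HasProjectiveDimensionLE X 1) {t : ℂ} (ht0 : t ≠ 0)
    (ht : t ^ 2 = (Nat.card k : ℂ)) (M : CP C) {K : CP C} (hK : K.obj.Acyclic) :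
    DH.of k t (isoClass M) * DH.of k t (isoClass K) =
      t ^ rankDiff k hfin M (cyclesClass K.obj) • DH.of k t (isoClass (CP.sum K M)) := by
  obtain ⟨e⟩ := nonempty_iso_out M
  obtain ⟨f⟩ := nonempty_iso_out K
  rw [DH.of_mul_of k hfin, hallMul_acyclic_right k hfin hher ht0 ht _ _ (acyclic_of_iso f.symm hK),
    map_smul, Finsupp.linearCombination_single, one_smul, isoClass_sum_congr f e,
    rankDiff_congr k hfin e, cyclesClass_congr f]

theorem exists_acyclic_mul_of (hfin : ∀ X Y : C, Finite (X ⟶ Y))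
    (hher : ∀ X : C, HasProjectiveDimensionLE X 1) {t : ℂ} (ht0 : t ≠ 0)
    (M : CP C) {K : CP C} (hK : K.obj.Acyclic) :
    ∃ c : ℂ, c ≠ 0 ∧ DH.of k t (isoClass K) * DH.of k t (isoClass M) =
      c • DH.of k t (isoClass (CP.sum K M)) := by
  obtain ⟨e⟩ := nonempty_iso_out M
  obtain ⟨f⟩ := nonempty_iso_out K
  obtain ⟨c, hc, h⟩ := exists_hallMul_acyclic_left k hfin hher ht0 (isoClass K) (isoClass M)
    (acyclic_of_iso f.symm hK)
  refine ⟨c, hc, ?_⟩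
  rw [DH.of_mul_of k hfin, h, map_smul, Finsupp.linearCombination_single, one_smul,
    isoClass_sum_congr f e]

/-- Both `[K] * [M]` and `[M] * [K]` are nonzero multiples of the class of the direct sum, so `[K]`,
and with it `[K]⁻¹`, commutes with `[M]` up to a scalar. -/
theorem exists_inv_mul_of [Finite k] (hfin : ∀ X Y : C, Finite (X ⟶ Y))
    (hher : ∀ X : C, HasProjectiveDimensionLE X 1) {t : ℂ} (ht0 : t ≠ 0)
    (ht : t ^ 2 = (Nat.card k : ℂ)) (M : CP C) {K : CP C} (hK : K.obj.Acyclic) :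
    ∃ c : ℂ, ((acyclicUnit k t K hK)⁻¹ : (DH k C t)ˣ) * DH.of k t (isoClass M) =
      c • (DH.of k t (isoClass M) * ((acyclicUnit k t K hK)⁻¹ : (DH k C t)ˣ)) := by
  obtain ⟨c, hc, h⟩ := exists_acyclic_mul_of k hfin hher ht0 M hK
  have h' := of_mul_acyclic k hfin hher ht0 ht M hK
  have hd : t ^ rankDiff k hfin M (cyclesClass K.obj) ≠ 0 := zpow_ne_zero _ ht0
  refine ⟨t ^ rankDiff k hfin M (cyclesClass K.obj) * c⁻¹, ?_⟩
  have h1 : DH.of k t (isoClass M) * DH.of k t (isoClass K) =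
      (t ^ rankDiff k hfin M (cyclesClass K.obj) * c⁻¹) •
        (DH.of k t (isoClass K) * DH.of k t (isoClass M)) := by
    rw [h', h, smul_smul, inv_mul_cancel_right₀ hc]
  rw [Units.inv_mul_eq_iff_eq_mul, mul_smul_comm, ← mul_assoc, ← smul_mul_assoc,
    Units.eq_mul_inv_iff_mul_eq]
  exact h1

theorem acyclicUnit_mul [Finite k] (hfin : ∀ X Y : C, Finite (X ⟶ Y))
    (hher : ∀ X : C, HasProjectiveDimensionLE X 1) {t : ℂ} (ht0 : t ≠ 0)
    (ht : t ^ 2 = (Nat.card k : ℂ)) {K K' : CP C} (hK : K.obj.Acyclic) (hK' : K'.obj.Acyclic) :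
    acyclicUnit k t K hK * acyclicUnit k t K' hK' =
      acyclicUnit k t (CP.sum K' K) (acyclic_sum hK' hK) := by
  refine Units.ext ((of_mul_acyclic k hfin hher ht0 ht K hK').trans ?_)
  rw [rankDiff_of_acyclic k hfin hher hK, zpow_zero, one_smul]
  rfl

theorem acyclicUnit_comm [Finite k] (hfin : ∀ X Y : C, Finite (X ⟶ Y))
    (hher : ∀ X : C, HasProjectiveDimensionLE X 1) {t : ℂ} (ht0 : t ≠ 0)
    (ht : t ^ 2 = (Nat.card k : ℂ)) {K K' : CP C} (hK : K.obj.Acyclic) (hK' : K'.obj.Acyclic) :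
    acyclicUnit k t K hK * acyclicUnit k t K' hK' =
      acyclicUnit k t K' hK' * acyclicUnit k t K hK := by
  rw [acyclicUnit_mul k hfin hher ht0 ht, acyclicUnit_mul k hfin hher ht0 ht]
  exact acyclicUnit_congr k t _ _ (biprod.braiding _ _)

open scoped IsMulCommutative in
/-- The elements `K_α * K_β^*` form a commutative group. -/
theorem exists_acyclic_hom [EnoughProjectives C] [Finite k] (hfin : ∀ X Y : C, Finite (X ⟶ Y))
    (hher : ∀ X : C, HasProjectiveDimensionLE X 1) {t : ℂ} (ht0 : t ≠ 0)
    (ht : t ^ 2 = (Nat.card k : ℂ)) :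
    ∃ κ : Multiplicative (K0 C × K0 C) →* (DH k C t)ˣ,
      (∀ (P : C) (hP : Projective P), κ (Multiplicative.ofAdd (K0.cl P, 0)) =
        acyclicUnit k t (KP P hP) (KP_acyclic P hP)) ∧
      (∀ (P : C) (hP : Projective P), κ (Multiplicative.ofAdd (0, K0.cl P)) =
        acyclicUnit k t (KPstar P hP) (KPstar_acyclic P hP)) ∧
      ∀ (K : CP C) (hK : K.obj.Acyclic),
        κ (Multiplicative.ofAdd (cyclesClass K.obj)) = acyclicUnit k t K hK := by
  classical
  let S : Set (DH k C t)ˣ := {x | ∃ (K : CP C) (hK : K.obj.Acyclic), acyclicUnit k t K hK = x}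
  -- The acyclic classes commute, so they generate a commutative group, as is needed to extend from
  -- projectives to the Grothendieck group.
  let G : Subgroup (DH k C t)ˣ := Subgroup.closure S
  have : IsMulCommutative G := Subgroup.isMulCommutative_closure (by
    rintro _ ⟨K, hK, rfl⟩ _ ⟨K', hK', rfl⟩
    exact acyclicUnit_comm k hfin hher ht0 ht hK hK')
  let g : ∀ (K : CP C), K.obj.Acyclic → G := fun K hK =>
    ⟨acyclicUnit k t K hK, Subgroup.subset_closure ⟨K, hK, rfl⟩⟩
  have hg : ∀ {K K' L : CP C} (hK : K.obj.Acyclic) (hK' : K'.obj.Acyclic) (hL : L.obj.Acyclic),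
      Nonempty (L.obj ≅ K.obj ⊞ K'.obj) → g L hL = g K hK * g K' hK' := by
    rintro K K' L hK hK' hL ⟨e⟩
    refine Subtype.ext ?_
    refine Eq.trans ?_ (acyclicUnit_mul k hfin hher ht0 ht hK hK').symm
    exact acyclicUnit_congr k t _ _ e
  obtain ⟨Φ, hΦ⟩ := exists_hom_of_additive_on_projectives (G := Additive G) hher
    (fun P => if hP : Projective P then Additive.ofMul (g (KP P hP) (KP_acyclic P hP)) else 0)
    (by
      intro P Q hP hQ
      have hPQ : Projective (P ⊞ Q) := inferInstance
      simp only [dif_pos hP, dif_pos hQ, dif_pos hPQ, ← ofMul_mul]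
      exact congrArg Additive.ofMul (hg _ _ _ (nonempty_KP_biprod_iso hP hQ hPQ)))
    (by
      intro P Q hP e
      have hQ : Projective Q := Projective.of_iso e hP
      simp only [dif_pos hP, dif_pos hQ]
      obtain ⟨f⟩ := nonempty_KP_iso hP hQ e
      exact congrArg Additive.ofMul (Subtype.ext (acyclicUnit_congr k t _ _ f)))
  obtain ⟨Ψ, hΨ⟩ := exists_hom_of_additive_on_projectives (G := Additive G) hher
    (fun P => if hP : Projective P then
      Additive.ofMul (g (KPstar P hP) (KPstar_acyclic P hP)) else 0)
    (by
      intro P Q hP hQ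
      have hPQ : Projective (P ⊞ Q) := inferInstance
      simp only [dif_pos hP, dif_pos hQ, dif_pos hPQ, ← ofMul_mul]
      exact congrArg Additive.ofMul (hg _ _ _ (nonempty_KPstar_biprod_iso hP hQ hPQ)))
    (by
      intro P Q hP e
      have hQ : Projective Q := Projective.of_iso e hP
      simp only [dif_pos hP, dif_pos hQ]
      obtain ⟨f⟩ := nonempty_KPstar_iso hP hQ e
      exact congrArg Additive.ofMul (Subtype.ext (acyclicUnit_congr k t _ _ f)))
  have hΦ' : ∀ (P : C) (hP : Projective P),
      Φ (K0.cl P) = Additive.ofMul (g (KP P hP) (KP_acyclic P hP)) := fun P hP => by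
    rw [hΦ P hP, dif_pos hP]
  have hΨ' : ∀ (P : C) (hP : Projective P),
      Ψ (K0.cl P) = Additive.ofMul (g (KPstar P hP) (KPstar_acyclic P hP)) := fun P hP => by
    rw [hΨ P hP, dif_pos hP]
  refine ⟨G.subtype.comp (AddMonoidHom.toMultiplicativeLeft (Φ.coprod Ψ)),
    fun P hP => ?_, fun P hP => ?_, fun K hK => ?_⟩
  · have h : Φ.coprod Ψ (K0.cl P, 0) = Additive.ofMul (g (KP P hP) (KP_acyclic P hP)) := by
      rw [AddMonoidHom.coprod_apply, map_zero, add_zero, hΦ']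
    exact congrArg (fun x : Additive G => (x.toMul : (DH k C t)ˣ)) h
  · have h : Φ.coprod Ψ (0, K0.cl P) = Additive.ofMul (g (KPstar P hP) (KPstar_acyclic P hP)) := by
      rw [AddMonoidHom.coprod_apply, map_zero, zero_add, hΨ']
    exact congrArg (fun x : Additive G => (x.toMul : (DH k C t)ˣ)) h
  · have h : Φ.coprod Ψ (cyclesClass K.obj) = Additive.ofMul (g K hK) := by
      rw [cyclesClass, AddMonoidHom.coprod_apply, hΦ' _ (projective_cycles hher K 0),
        hΨ' _ (projective_cycles hher K 1), ← ofMul_mul]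
      obtain ⟨e⟩ := nonempty_iso_KP_biprod_KPstar hher K hK
      exact congrArg Additive.ofMul (hg _ _ _ ⟨e.symm⟩).symm
    exact congrArg (fun x : Additive G => (x.toMul : (DH k C t)ˣ)) h

end Products

/-! ### The basis of Bridgeland's Hall algebra -/

section BasisOfDH

variable {k : Type w} [Field k] {C : Type u} [Category.{v} C] [Abelian C] [Linear k C]

theorem span_eq_top_of_left_ideal {t : ℂ} (S : Submodule ℂ (DH k C t)) (h1 : 1 ∈ S)
    (hof : ∀ x, ∀ v ∈ S, DH.of k t x * v ∈ S)
    (hinv : ∀ (K : CP C) (hK : K.obj.Acyclic), ∀ v ∈ S, DH.inv k t K hK * v ∈ S) : S = ⊤ := by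
  rw [eq_top_iff]
  rintro x -
  have h : ∀ a : FreeAlgebra ℂ (IsoCP C ⊕ AcyclicIso C), ∀ v ∈ S,
      RingQuot.mkAlgHom ℂ (DHRel k C t) a * v ∈ S := by
    intro a
    induction a using FreeAlgebra.induction with
    | grade0 r =>
      intro v hv
      rw [AlgHom.commutes, ← Algebra.smul_def]
      exact S.smul_mem _ hv
    | grade1 x =>
      rcases x with x | ⟨_, K, rfl, hK⟩
      · exact hof x
      · exact hinv K hK
    | mul a b ha hb =>
      intro v hv
      rw [map_mul, mul_assoc]
      exact ha _ (hb _ hv)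
    | add a b ha hb =>
      intro v hv
      rw [map_add, add_mul]
      exact S.add_mem (ha _ hv) (hb _ hv)
  obtain ⟨a, rfl⟩ := RingQuot.mkAlgHom_surjective ℂ (DHRel k C t) x
  simpa using h a 1 h1

/-- The span is stable under left multiplication by the generators. A product `[x] * [N]` is a
combination of classes, each a multiple of a minimal class times an acyclic one that joins the
factor `κ`; an inverse `[K]⁻¹` moves past `[N]` up to a scalar and joins it too. -/
theorem span_of_mul_eq_top [Finite k] (hfin : ∀ X Y : C, Finite (X ⟶ Y))
    (hher : ∀ X : C, HasProjectiveDimensionLE X 1) {t : ℂ} (ht0 : t ≠ 0)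
    (ht : t ^ 2 = (Nat.card k : ℂ)) {κ : Multiplicative (K0 C × K0 C) →* (DH k C t)ˣ}
    (hκ : ∀ (K : CP C) (hK : K.obj.Acyclic),
      κ (Multiplicative.ofAdd (cyclesClass K.obj)) = acyclicUnit k t K hK) :
    Submodule.span ℂ (Set.range fun i : BIdx C =>
      DH.of k t i.1.1 * (κ (Multiplicative.ofAdd i.2) : DH k C t)) = ⊤ := by
  set S := Submodule.span ℂ (Set.range fun i : BIdx C =>
      DH.of k t i.1.1 * (κ (Multiplicative.ofAdd i.2) : DH k C t)) with hS
  have hmin : ∀ (N : MinIso C) (γ : Multiplicative (K0 C × K0 C)),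
      DH.of k t N.1 * (κ γ : DH k C t) ∈ S := fun N γ =>
    Submodule.subset_span ⟨(N, γ.toAdd), rfl⟩
  have hall : ∀ (x : IsoCP C) (γ : Multiplicative (K0 C × K0 C)),
      DH.of k t x * (κ γ : DH k C t) ∈ S := by
    intro x γ
    obtain ⟨K, hK, ⟨e⟩⟩ := minPart_spec hfin x
    have h := of_mul_acyclic k hfin hher ht0 ht (Quotient.out (minPart hfin x).1) hK
    have hx : isoClass (CP.sum K (Quotient.out (minPart hfin x).1)) = x := by
      rw [← isoClass_out x, isoClass_eq_iff, isoClass_out x]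
      exact ⟨e.symm⟩
    rw [isoClass_out, hx, ← inv_smul_eq_iff₀ (zpow_ne_zero _ ht0)] at h
    rw [← h, smul_mul_assoc, mul_assoc]
    refine S.smul_mem _ ?_
    have h' : DH.of k t (isoClass K) * (κ γ : DH k C t) =
        (κ (Multiplicative.ofAdd (cyclesClass K.obj) * γ) : DH k C t) := by
      rw [map_mul, hκ K hK, Units.val_mul]
      rfl
    rw [h']
    exact hmin _ _
  refine span_eq_top_of_left_ideal S ?_ ?_ ?_
  · have := hmin (MinIso.zero C) 1
    rwa [map_one, Units.val_one, mul_one, MinIso.zero, DH.of_zero] at this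
  · intro x v hv
    refine Submodule.span_induction (p := fun v _ => DH.of k t x * v ∈ S) ?_ ?_ ?_ ?_ hv
    · rintro _ ⟨⟨N, γ⟩, rfl⟩
      rw [← mul_assoc, DH.of_mul_of k hfin, Finsupp.linearCombination_apply, Finsupp.sum,
        Finset.sum_mul]
      refine S.sum_mem fun z _ => ?_
      rw [smul_mul_assoc]
      exact S.smul_mem _ (hall z _)
    · rw [mul_zero]
      exact S.zero_mem
    · intro a b _ _ ha hb
      rw [mul_add]
      exact S.add_mem ha hb
    · intro c a _ ha
      rw [mul_smul_comm]
      exact S.smul_mem _ ha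
  · intro K hK v hv
    refine Submodule.span_induction (p := fun v _ => DH.inv k t K hK * v ∈ S) ?_ ?_ ?_ ?_ hv
    · rintro _ ⟨⟨N, γ⟩, rfl⟩
      obtain ⟨c, h⟩ := exists_inv_mul_of k hfin hher ht0 ht (Quotient.out N.1) hK
      rw [isoClass_out] at h
      have h' : DH.inv k t K hK * (DH.of k t N.1 * (κ (Multiplicative.ofAdd γ) : DH k C t)) =
          c • (DH.of k t N.1 * (κ ((Multiplicative.ofAdd (cyclesClass K.obj))⁻¹ *
            Multiplicative.ofAdd γ) : DH k C t)) := by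
        rw [map_mul, map_inv, hκ K hK, Units.val_mul, ← mul_assoc, ← mul_assoc, ← smul_mul_assoc,
          ← h]
        rfl
      exact h' ▸ S.smul_mem _ (hmin _ _)
    · rw [mul_zero]
      exact S.zero_mem
    · intro a b _ _ ha hb
      rw [mul_add]
      exact S.add_mem ha hb
    · intro c a _ ha
      rw [mul_smul_comm]
      exact S.smul_mem _ ha

theorem linearIndependent_of_mul [EnoughProjectives C] [Finite k]
    (hfin : ∀ X Y : C, Finite (X ⟶ Y))
    (hher : ∀ X : C, HasProjectiveDimensionLE X 1) {t : ℂ} (ht0 : t ≠ 0)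
    (ht : t ^ 2 = (Nat.card k : ℂ)) {κ : Multiplicative (K0 C × K0 C) →* (DH k C t)ˣ}
    (hκ : ∀ (K : CP C) (hK : K.obj.Acyclic),
      κ (Multiplicative.ofAdd (cyclesClass K.obj)) = acyclicUnit k t K hK) :
    LinearIndependent ℂ fun i : BIdx C =>
      DH.of k t i.1.1 * (κ (Multiplicative.ofAdd i.2) : DH k C t) := by
  obtain ⟨ρ, hρ⟩ := exists_representation k hfin hher ht0 ht (C := C)
  -- `T γ` says that `κ γ` translates the vectors over the zero complex by `γ`. It holds for cycle
  -- classes of acyclic complexes and is closed under sums and negatives; the classes of `K_P` and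
  -- `K_P^*` generate everything.
  let T : K0 C × K0 C → Prop := fun γ => ∀ δ : K0 C × K0 C,
    ρ (κ (Multiplicative.ofAdd γ) : DH k C t) (Finsupp.single (MinIso.zero C, δ) 1) =
      Finsupp.single (MinIso.zero C, δ + γ) 1
  have hadd : ∀ γ γ', T γ → T γ' → T (γ + γ') := by
    intro γ γ' h h' δ
    rw [ofAdd_add, map_mul, Units.val_mul, map_mul, Module.End.mul_apply, h', h, add_assoc,
      add_comm γ']
  have hneg : ∀ γ, T γ → T (-γ) := by
    intro γ h δ
    have h1 := h (δ + -γ)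
    rw [neg_add_cancel_right] at h1
    rw [← h1, ← Module.End.mul_apply, ← map_mul, ← Units.val_mul, ← map_mul, ← ofAdd_add,
      neg_add_cancel, ofAdd_zero, map_one, Units.val_one, map_one, Module.End.one_apply]
  have hcyc : ∀ K : CP C, K.obj.Acyclic → T (cyclesClass K.obj) := by
    intro K hK δ
    obtain ⟨e⟩ := nonempty_iso_out K
    rw [hκ K hK]
    change ρ (DH.of k t (isoClass K)) _ = _
    rw [hρ, act_acyclic_single_zero k hfin hher ht0 ht (acyclic_of_iso e.symm hK),
      cyclesClass_congr e]
  have hT : ∀ γ, T γ := by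
    rintro ⟨α, β⟩
    obtain ⟨P, Q, hP, hQ, rfl⟩ := K0.exists_eq_sub hher α
    obtain ⟨P', Q', hP', hQ', rfl⟩ := K0.exists_eq_sub hher β
    have h := hadd _ _ (hadd _ _ (hcyc _ (KP_acyclic P hP)) (hneg _ (hcyc _ (KP_acyclic Q hQ))))
      (hadd _ _ (hcyc _ (KPstar_acyclic P' hP')) (hneg _ (hcyc _ (KPstar_acyclic Q' hQ'))))
    simpa only [cyclesClass_KP, cyclesClass_KPstar, Prod.neg_mk, Prod.mk_add_mk, neg_zero,
      add_zero, zero_add, ← sub_eq_add_neg] using h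
  -- Evaluation at the vector that plays the role of the unit: the element with index `i` is sent to
  -- the standard basis vector at `i`.
  let ev : DH k C t →ₗ[ℂ] (BIdx C →₀ ℂ) :=
    (LinearMap.applyₗ (Finsupp.single (MinIso.zero C, 0) 1)).comp ρ.toLinearMap
  refine LinearIndependent.of_comp ev ?_
  have h : (ev ∘ fun i : BIdx C => DH.of k t i.1.1 * (κ (Multiplicative.ofAdd i.2) : DH k C t)) =
      fun i => Finsupp.single i 1 := by
    funext i
    change ρ (DH.of k t i.1.1 * (κ (Multiplicative.ofAdd i.2) : DH k C t))
      (Finsupp.single (MinIso.zero C, 0) 1) = _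
    rw [map_mul, Module.End.mul_apply, hT, hρ, act_minimal_single_zero k hfin hher ht0 ht, zero_add]
  rw [h]
  exact Finsupp.linearIndependent_single_one ℂ _

variable (k) in
/-- The basis `[N] * K_α * K_β^*` of Bridgeland's Hall algebra. -/
theorem exists_basis [Finite k] [EnoughProjectives C]
    (hfin : ∀ X Y : C, Finite (X ⟶ Y))
    (hher : ∀ X : C, HasProjectiveDimensionLE X 1) {t : ℂ} (ht0 : t ≠ 0)
    (ht : t ^ 2 = (Nat.card k : ℂ)) :
    ∃ (KFam KFamStar : K0 C → DH k C t) (b : Module.Basis (BIdx C) ℂ (DH k C t)),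
      IsKFamily k t KFam KFamStar ∧
      ∀ i : BIdx C, b i = DH.of k t i.1.1 * KFam i.2.1 * KFamStar i.2.2 := by
  obtain ⟨κ, h1, h2, h3⟩ := exists_acyclic_hom k (C := C) hfin hher ht0 ht
  refine ⟨fun α => κ (Multiplicative.ofAdd (α, 0)), fun β => κ (Multiplicative.ofAdd (0, β)),
    Module.Basis.mk (linearIndependent_of_mul hfin hher ht0 ht h3)
      (span_of_mul_eq_top hfin hher ht0 ht h3).ge,
    ⟨K0.exists_eq_sub hher, fun P Q hP hQ => ⟨?_, ?_⟩⟩, fun i => ?_⟩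
  · have h : (K0.cl P - K0.cl Q, (0 : K0 C)) = (K0.cl P, 0) - (K0.cl Q, 0) := by
      rw [Prod.mk_sub_mk, sub_zero]
    dsimp only
    rw [h, ofAdd_sub, map_div, h1 P hP, h1 Q hQ, div_eq_mul_inv, Units.val_mul]
    rfl
  · have h : ((0 : K0 C), K0.cl P - K0.cl Q) = (0, K0.cl P) - (0, K0.cl Q) := by
      rw [Prod.mk_sub_mk, sub_zero]
    dsimp only
    rw [h, ofAdd_sub, map_div, h2 P hP, h2 Q hQ, div_eq_mul_inv, Units.val_mul]
    rfl
  · rw [Module.Basis.mk_apply, mul_assoc, ← Units.val_mul, ← map_mul, ← ofAdd_add,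
      Prod.mk_add_mk, add_zero, zero_add]

end BasisOfDH

end

end BridgelandHall

/-! ### The basis and the coalgebra axioms combined -/

theorem mainTheorem4 {k : Type w} [Field k] [Finite k]
    {C : Type u} [Category.{v} C] [Abelian C] [Linear k C]
    [EssentiallySmall.{w'} C] [EnoughProjectives C]
    (hfin : ∀ X Y : C, Finite (X ⟶ Y))
    (hher : ∀ X : C, HasProjectiveDimensionLE X 1)
    (hK : ∀ X : C, ¬ IsZero X → BridgelandHall.K0.cl X ≠ 0)
    (t : ℂ) (ht : t ^ 2 = (Nat.card k : ℂ))
    (χ : BridgelandHall.IsoCP C → BridgelandHall.IsoCP C → ℂ)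
    (hχ : BridgelandHall.IsAdditiveChi χ) :
    (∀ L : BridgelandHall.IsoCP C,
      {p : BridgelandHall.IsoCP C × BridgelandHall.IsoCP C |
        BridgelandHall.comulE0 t χ (Finsupp.single L 1) p ≠ 0}.Finite) ∧
    ∃ (KFam KFamStar : BridgelandHall.K0 C → BridgelandHall.DH k C t)
      (b : Module.Basis (BridgelandHall.BIdx C) ℂ (BridgelandHall.DH k C t)),
      BridgelandHall.IsKFamily k t KFam KFamStar ∧
      (∀ i : BridgelandHall.BIdx C,
        b i = BridgelandHall.DH.of k t i.1.1 * KFam i.2.1 * KFamStar i.2.2) ∧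
      BridgelandHall.IsTopCoassoc b (BridgelandHall.comul k t χ KFam KFamStar b) ∧
      (χ (BridgelandHall.isoClass (BridgelandHall.zeroCP C))
          (BridgelandHall.isoClass (BridgelandHall.zeroCP C)) = 0 →
        BridgelandHall.IsTopCounit b (BridgelandHall.comul k t χ KFam KFamStar b)
          (BridgelandHall.counit k t b)) := by
  have ht0 : t ≠ 0 := by
    rintro rfl
    rw [zero_pow two_ne_zero] at ht
    exact Nat.cast_ne_zero.2 Nat.card_pos.ne' ht.symm
  obtain ⟨KFam, KFamStar, b, hF, hb⟩ := BridgelandHall.exists_basis k (C := C) hfin hher ht0 ht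
  exact ⟨BridgelandHall.finite_support_comulE0 hfin t χ, KFam, KFamStar, b, hF, hb,
    BridgelandHall.comul_isTopCoassoc hfin hher ht0 hχ hb,
    BridgelandHall.comul_isTopCounit hfin hher t hχ hb⟩
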